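/- Let $p$ be a prime number and let $F$ be a finite extension of $\mathbb{Q}_p$, with ring of integers $\mathcal{O}_F$ and with the $p$-adic absolute value $\|\cdot\|$ normalized by $\|p\| = p^{-[F:\mathbb{Q}_p]}$. For $m \ge -1$ let $\Omega_m$ be the space of polynomials of degree at most $m$ with coefficients in $\mathcal{O}_F$ (so $\Omega_{-1}=\{0\}$), equipped with the probability measure for which the $m+1$ coefficients are independent and uniformly distributed for the Haar probability measure of $\mathcal{O}_F$. Let $E = K_1 \times \cdots \times K_s$ be a finite étale $F$-algebra of degree $r \ge 1$, where the $K_i$ are finite field extensions of $F$. Let $\mathcal{O}_E = \prod_i \mathcal{O}_{K_i}$ be its ring of integers, $D_E$ the discriminant of the trace form in an $\mathcal{O}_F$-basis of $\mathcal{O}_E$ (well defined up to the square of a unit of $\mathcal{O}_F$), $N_{E/F}$ the norm map, $\lambda_E$ the Haar measure of $E$ with $\lambda_E(\mathcal{O}_E) = 1$, and for $x = (x_1,\dots,x_s) \in E$ let $H(x) = \prod_i \max(1, \|N_{K_i/F}(x_i)\|)$. For an integer $n \ge r$ define $$\rho_{E,n}(x) = \frac{\|D_E\| \cdot \lambda_E\bigl(\mathcal{O}_F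 + \mathcal{O}_F x + \cdots + \mathcal{O}_F x^{r-1}\bigr)}{H(x)^{n+1}} \int_{\Omega_{n-r}} \|N_{E/F}(Q(x))\|\, dQ, \qquad \rho_n(E) = \int_E \rho_{E,n}(x)\, d\lambda_E(x).$$ An element $x \in E$ is called new in $E$ if $F[x] = E$. Theorem G. Let $r$ and $n$ be positive integers with $n \ge r$. For every finite étale $F$-algebra $E$ of degree $r$, the number $\rho_n(E)$ is the expected number of roots in $E$, new in $E$, of a random polynomial in $\Omega_n$. Moreover $$\sum_{E} \frac{\rho_n(E)}{\#\mathrm{Aut}_{F\text{-alg}}(E)} = 1,$$ where $E$ runs over the isomorphism classes of finite étale $F$-algebras of degree $r$, and $\mathrm{Aut}_{F\text{-alg}}(E)$ is the group of $F$-algebra automorphisms of $E$. -/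

import Mathlib

open MeasureTheory
open scoped ENNReal

noncomputable section

namespace PadicRoots

universe u

/-! ## The base field

`F` is a finite extension of `ℚ_[p]`.  Its Mathlib norm `‖·‖` is the unique multiplicative norm
extending the one of `ℚ_[p]`, so that `‖p‖ = 1 / p`. -/

section Base

variable (p : ℕ) [Fact p.Prime] (F : Type*) [NormedField F] [NormedAlgebra ℚ_[p] F]

/-- The ring of integers `𝒪_F` of `F`. -/
def ringOfIntegers : Subring F where
  carrier := {x | ‖x‖ ≤ 1}
  mul_mem' {a b} ha hb := by
    simp only [Set.mem_ofPred_eq, norm_mul] at *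
    exact mul_le_one₀ ha (norm_nonneg b) hb
  one_mem' := by simp
  add_mem' {a b} ha hb := by
    have : IsUltrametricDist F := IsUltrametricDist.of_normedAlgebra ℚ_[p]
    exact (IsUltrametricDist.norm_add_le_max a b).trans (max_le ha hb)
  zero_mem' := by simp
  neg_mem' {a} ha := by simpa using ha

variable {F}

/-- The absolute value of `F` normalized so that `p` has absolute value `p ^ (-[F : ℚ_p])`; with
this normalization, multiplication by `a` scales the Haar measures of `F` by `absF p a`. -/
def absF (x : F) : ℝ≥0∞ := ENNReal.ofReal (‖x‖ ^ Module.finrank ℚ_[p] F)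

end Base

/-! ## Normalized Haar measures -/

/-- The Haar measure of `G`, normalized so that the compact open subset `U` has measure `1`. -/
def normalizedHaar (G : Type*) [AddGroup G] [TopologicalSpace G] [IsTopologicalAddGroup G]
    [LocallyCompactSpace G] [MeasurableSpace G] [BorelSpace G] (U : Set G) : Measure G :=
  (Measure.addHaar U)⁻¹ • Measure.addHaar

theorem locallyCompactSpace_base (p : ℕ) [Fact p.Prime] (F : Type*) [NormedField F]
    [NormedAlgebra ℚ_[p] F] [FiniteDimensional ℚ_[p] F] : LocallyCompactSpace F := by
  have : ProperSpace F := FiniteDimensional.proper ℚ_[p] F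
  infer_instance

theorem isTopologicalAddGroup_of_moduleTopology (F E : Type*) [NormedField F] [CommRing E]
    [Algebra F E] [TopologicalSpace E] [IsModuleTopology F E] : IsTopologicalAddGroup E :=
  IsModuleTopology.topologicalAddGroup F E

theorem locallyCompactSpace_of_moduleTopology (F E : Type*) [NormedField F]
    [LocallyCompactSpace F] [CommRing E] [Algebra F E] [Module.Finite F E]
    [TopologicalSpace E] [IsModuleTopology F E] : LocallyCompactSpace E := by
  have := IsModuleTopology.toContinuousAdd F E
  let e := (Module.finBasis F E).equivFun
  let e' : E ≃ₜ (Fin (Module.finrank F E) → F) :=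
    { e.toEquiv with
      continuous_toFun := IsModuleTopology.continuous_of_linearMap e.toLinearMap
      continuous_invFun := IsModuleTopology.continuous_of_linearMap e.symm.toLinearMap }
  exact e'.isClosedEmbedding.locallyCompactSpace

/-! ## Random polynomials -/

section RandomPolynomial

variable (p : ℕ) [Fact p.Prime] (F : Type*) [NormedField F] [NormedAlgebra ℚ_[p] F]
  [FiniteDimensional ℚ_[p] F] [MeasurableSpace F] [BorelSpace F]

/-- The Haar measure of `F` with `λ_F(𝒪_F) = 1`. -/
def haarF : Measure F :=
  haveI := locallyCompactSpace_base p F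
  normalizedHaar F (ringOfIntegers p F : Set F)

/-- The law of a vector of `m` independent uniformly distributed elements of `𝒪_F`. -/
def coeffLaw (m : ℕ) : Measure (Fin m → F) :=
  Measure.pi fun _ => (haarF p F).restrict (ringOfIntegers p F : Set F)

variable {F}

/-- The polynomial `∑_{i < m} a_i X ^ i`. When `a` follows `coeffLaw p F m`, this is a uniformly
distributed polynomial of degree at most `m - 1` with coefficients in `𝒪_F` (it is `0` if
`m = 0`). -/
def polyOfCoeffs {m : ℕ} (a : Fin m → F) : Polynomial F :=
  ∑ i : Fin m, Polynomial.monomial (i : ℕ) (a i)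

end RandomPolynomial

/-! ## Finite étale algebras -/

section Algebra

variable (p : ℕ) [Fact p.Prime] (F : Type*) [NormedField F] [NormedAlgebra ℚ_[p] F]
  (E : Type*) [CommRing E] [Algebra F E]

/-- The ring of integers `𝒪_E` of `E`: the integral closure of `𝒪_F` in `E`, which is the product
of the rings of integers of the field factors of `E`. -/
abbrev integersE : Subalgebra (ringOfIntegers p F) E :=
  integralClosure (ringOfIntegers p F) E

/-- The absolute value `‖D_E‖` of the discriminant of `E`, the determinant of the trace form in
a basis of `𝒪_E` over `𝒪_F`. Such bases exist and all of them give the same absolute value, so that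
the supremum is that common value. -/
def absDiscr : ℝ≥0∞ :=
  ⨆ b : Module.Basis (Fin (Module.finrank F E)) (ringOfIntegers p F) (integersE p F E),
    absF p (Algebra.discr F fun i => ((b i : integersE p F E) : E))

variable {E}

/-- The height of `x`. The field factors of `E` are its quotients `K = E ⧸ 𝔪` by the maximal
ideals; the factor `max (1, ‖x_K‖ ^ [K : F])` of the height is written through the equality
`‖x_K‖ ^ [K : F] = ‖N_{K/F}(x_K)‖`. -/
def height (x : E) : ℝ≥0∞ :=
  ∏ᶠ m : MaximalSpectrum E,
    max 1 (absF p (Algebra.norm F (Ideal.Quotient.mk m.asIdeal x)))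

/-- The `𝒪_F`-module generated by `1, x, …, x ^ (r - 1)`, with `r = [E : F]`. It equals `𝒪_F[x]` when
`x` is integral. -/
def powerLattice (x : E) : Submodule (ringOfIntegers p F) E :=
  Submodule.span (ringOfIntegers p F)
    (Set.range fun i : Fin (Module.finrank F E) => x ^ (i : ℕ))

variable (E) in
/-- The Haar measure of `E` with `λ_E(𝒪_E) = 1`. -/
def haarE [FiniteDimensional ℚ_[p] F] [Module.Finite F E]
    [TopologicalSpace E] [IsModuleTopology F E] [MeasurableSpace E] [BorelSpace E] : Measure E :=
  haveI := locallyCompactSpace_base p F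
  haveI := isTopologicalAddGroup_of_moduleTopology F E
  haveI := locallyCompactSpace_of_moduleTopology F E
  normalizedHaar E (integersE p F E : Set E)

/-- The density function
`ρ_{E,n}(x) = ‖D_E‖ λ_E(𝒪_F + 𝒪_F x + ⋯ + 𝒪_F x ^ (r-1)) H(x) ^ (-(n+1)) ∫ ‖N_{E/F}(Q(x))‖ dQ`,
where `Q` is a uniformly distributed polynomial of degree at most `n - r` over `𝒪_F`. -/
def density [FiniteDimensional ℚ_[p] F] [MeasurableSpace F] [BorelSpace F] [Module.Finite F E]
    [TopologicalSpace E] [IsModuleTopology F E] [MeasurableSpace E] [BorelSpace E]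
    (n : ℕ) (x : E) : ℝ≥0∞ :=
  absDiscr p F E * haarE p F E (powerLattice p F x : Set E) / height p F x ^ (n + 1) *
    ∫⁻ a : Fin (n + 1 - Module.finrank F E) → F,
      absF p (Algebra.norm F (Polynomial.aeval x (polyOfCoeffs a)))
        ∂(coeffLaw p F (n + 1 - Module.finrank F E))

variable (E)

/-- `ρ_n(E)`, the integral over `E` of the density function `ρ_{E,n}`. -/
def rho [FiniteDimensional ℚ_[p] F] [MeasurableSpace F] [BorelSpace F] [Module.Finite F E]
    [TopologicalSpace E] [IsModuleTopology F E] [MeasurableSpace E] [BorelSpace E]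
    (n : ℕ) : ℝ≥0∞ :=
  ∫⁻ x : E, density p F n x ∂(haarE p F E)

/-- The number of roots of `P` in `E` which are new in `E`, i.e. generate `E` over `F`. -/
def numNewRoots {F : Type*} [Field F] (E : Type*) [CommRing E] [Algebra F E]
    (P : Polynomial F) : ℕ∞ :=
  {x : E | Polynomial.aeval x P = 0 ∧ Algebra.adjoin F {x} = ⊤}.encard

/-- The expected number of new roots in `E` of a uniformly distributed polynomial of degree at
most `n` with coefficients in `𝒪_F`. -/
def expectedNewRoots [FiniteDimensional ℚ_[p] F] [MeasurableSpace F] [BorelSpace F]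
    (n : ℕ) : ℝ≥0∞ :=
  ∫⁻ a : Fin (n + 1) → F, (numNewRoots E (polyOfCoeffs a) : ℝ≥0∞) ∂(coeffLaw p F (n + 1))

end Algebra

/-! ## Isomorphism classes of finite étale algebras -/

/-- A finite étale `F`-algebra of degree `r`. -/
structure FiniteEtaleAlgebra (F : Type u) [Field F] (r : ℕ) where
  /-- The underlying type. -/
  carrier : Type u
  [commRing : CommRing carrier]
  [algebra : Algebra F carrier]
  [finite : Module.Finite F carrier]
  [etale : Algebra.Etale F carrier]
  finrank_eq : Module.finrank F carrier = r

namespace FiniteEtaleAlgebra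

attribute [instance] commRing algebra finite etale

variable (F : Type u) (r : ℕ)

instance [Field F] : CoeSort (FiniteEtaleAlgebra F r) (Type u) := ⟨carrier⟩

/-- Isomorphism of `F`-algebras. -/
instance isoSetoid [Field F] : Setoid (FiniteEtaleAlgebra F r) where
  r A B := Nonempty (A ≃ₐ[F] B)
  iseqv := ⟨fun _ => ⟨AlgEquiv.refl⟩, fun ⟨e⟩ => ⟨e.symm⟩, fun ⟨e⟩ ⟨f⟩ => ⟨e.trans f⟩⟩

/-- The isomorphism classes of finite étale `F`-algebras of degree `r`. -/
abbrev IsoClass [Field F] := Quotient (isoSetoid F r)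

variable {F r}

/-- The topology of a finite-dimensional vector space over `F`. -/
instance [NormedField F] (E : FiniteEtaleAlgebra F r) : TopologicalSpace E :=
  moduleTopology F E

instance [NormedField F] (E : FiniteEtaleAlgebra F r) : IsModuleTopology F E := ⟨rfl⟩

instance [NormedField F] (E : FiniteEtaleAlgebra F r) : MeasurableSpace E := borel E

instance [NormedField F] (E : FiniteEtaleAlgebra F r) : BorelSpace E := ⟨rfl⟩

end FiniteEtaleAlgebra

end PadicRoots

end

namespace PadicRoots

/-! ## Scaling of Haar measures -/

/-! Why the density computes the expectation. Fix an 𝒪_F-basis of 𝒪_E, so that E becomes F^r with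
the Haar measure of mass 1 on the unit cube, and write n + 1 = r + m. A pair (x, T), with x new in E
and T in F^m, determines a unique polynomial P of degree at most n which vanishes at x and whose
coefficients in degrees ≥ r are T, because 1, x, …, x^(r-1) is a basis of E. This map, `rootMap`,
goes between spaces of the same dimension, and its fibre above a separable P is the set of new roots
of P. Almost every P is separable, so an ultrametric area formula
(`lintegral_absF_det_eq_lintegral_encard`) writes the expected number of new roots as the integral,
over the pairs for which P is integral, of the Jacobian |N(P'(x))| / |det(1, x, …, x^(r-1))|.

For fixed x with minimal polynomial f, put P = fQ. The change of variables from Q to T is unipotent,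
P'(x) = f'(x)Q(x), and N(f'(x)) is up to sign the discriminant of 1, x, …, x^(r-1), that is, det²
times D_E. By Gauss's lemma P is integral exactly when the Gauss norms of f and Q have product at
most 1, and the Gauss norm of f gives the height of x. Rescaling Q by a scalar then produces
H(x)^(-(m+r)) = H(x)^(-(n+1)) times the average of |N(Q(x))|, which is the density
(`lintegral_fiber_rootJacobian`).

Why the weighted sum is 1. The minimal polynomial of a new root of P in E is a monic factor of P of
degree r, and Aut(E) acts simply transitively on the new elements with a given minimal polynomial. A
monic factor f of a separable P arises from exactly one class, that of F[X]/(f). Hence the numbers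
of new roots, weighted by 1/#Aut(E), add up to the number of monic factors of P of degree r
(`tsum_numNewRoots_div_card`). Let e(r, n) be the expectation of this number; it has to be shown
that e(r, n) = 1.

Passing to the complementary factor gives e(r, n) = e(n - r, n). Moreover e(r, n) is independent of
n for n ≥ 2r - 1, because the densities themselves are (`normAverage_add`, `coordDensity_add`): if G
is monic and integral of degree d > r with irreducible reduction, and A is a primitive multiple of
f, then each integral Q of degree less than d + m is uniquely AU + GV with U, V integral of degrees
less than d and m; so N(Q(x)) = N(G(x))N(V(x)), and |N(G(x))| = H(x)^d. Therefore e(r, n) = e(r, 2r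
- 1) = e(r - 1, 2r - 1), and induction on r ends at e(0, n) = 1. -/

theorem norm_sub_le_max {G : Type*} [SeminormedAddGroup G] [IsUltrametricDist G] (x y : G) :
    ‖x - y‖ ≤ max ‖x‖ ‖y‖ := by
  rw [sub_eq_add_neg]
  simpa using IsUltrametricDist.norm_add_le_max x (-y)

section HaarGeneral

/-- By uniqueness of Haar measure an automorphism multiplies all measures by one constant, so one
test set of finite nonzero measure determines it. -/
theorem measure_image_continuousAddEquiv {V : Type*} [AddGroup V] [TopologicalSpace V]
    [IsTopologicalAddGroup V] [LocallyCompactSpace V] [MeasurableSpace V] [BorelSpace V]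
    (μ : Measure V) [μ.IsAddHaarMeasure] [μ.Regular] (φ : V ≃ₜ+ V) {K : Set V} {c : ℝ≥0∞}
    (h0 : μ K ≠ 0) (ht : μ K ≠ ∞) (hK : μ (φ '' K) = c * μ K) (S : Set V) :
    μ (φ '' S) = c * μ S := by
  have key : ∀ T : Set V, (addEquivAddHaarChar φ : ℝ≥0∞) * μ T = μ (φ '' T) := by
    intro T
    have := addEquivAddHaarChar_smul_preimage μ φ (X := φ '' T)
    rw [Set.preimage_image_eq _ φ.injective] at this
    rw [← this]; rfl
  have hc : (addEquivAddHaarChar φ : ℝ≥0∞) = c := by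
    rw [← key K] at hK
    exact (ENNReal.mul_left_inj h0 ht).1 hK
  rw [← key, hc]

theorem normalizedHaar_isAddHaarMeasure {G : Type*} [AddGroup G] [TopologicalSpace G]
    [IsTopologicalAddGroup G] [LocallyCompactSpace G] [MeasurableSpace G] [BorelSpace G]
    {U : Set G} (hc : IsCompact U) (hi : (interior U).Nonempty) :
    (normalizedHaar G U).IsAddHaarMeasure := by
  unfold normalizedHaar
  refine Measure.IsAddHaarMeasure.smul _ ?_ ?_
  · simpa using hc.measure_ne_top
  · simpa using (Measure.measure_pos_of_nonempty_interior _ hi).ne'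

theorem normalizedHaar_self {G : Type*} [AddGroup G] [TopologicalSpace G]
    [IsTopologicalAddGroup G] [LocallyCompactSpace G] [MeasurableSpace G] [BorelSpace G]
    {U : Set G} (hc : IsCompact U) (hi : (interior U).Nonempty) :
    normalizedHaar G U U = 1 := by
  unfold normalizedHaar
  rw [Measure.smul_apply, smul_eq_mul]
  exact ENNReal.inv_mul_cancel (Measure.measure_pos_of_nonempty_interior _ hi).ne' hc.measure_ne_top

theorem addHaar_eq_of_apply_eq {G : Type*} [AddGroup G] [TopologicalSpace G]
    [IsTopologicalAddGroup G] [LocallyCompactSpace G] [SecondCountableTopology G]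
    [MeasurableSpace G] [BorelSpace G] (μ ν : Measure G) [μ.IsAddHaarMeasure]
    [ν.IsAddHaarMeasure] {U : Set G} (h0 : μ U ≠ 0) (ht : μ U ≠ ∞) (h : μ U = ν U) : μ = ν := by
  have e := Measure.isAddLeftInvariant_eq_smul ν μ
  have h1 : (ν.addHaarScalarFactor μ : ℝ≥0∞) = 1 := by
    have h2 := congrArg (fun m => m U) e
    simp only [Measure.smul_apply, ENNReal.smul_def, smul_eq_mul] at h2
    rw [← h] at h2
    exact ((ENNReal.mul_left_inj h0 ht).1 (by rw [one_mul]; exact h2)).symm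
  rw [e, ENNReal.smul_def, h1, one_smul]

end HaarGeneral

section Padic

variable (p : ℕ) [Fact p.Prime]

theorem padic_closedBall_eq_iUnion :
    Metric.closedBall (0 : ℚ_[p]) 1 =
      ⋃ i ∈ Finset.range p, (fun x => (i : ℚ_[p]) + x) '' Metric.closedBall 0 (p : ℝ)⁻¹ := by
  ext x
  simp only [Metric.mem_closedBall, dist_zero_right, Set.mem_iUnion, Set.mem_image,
    Finset.mem_range]
  constructor
  · intro hx
    obtain ⟨n, hn, h⟩ := PadicInt.exists_mem_range (⟨x, hx⟩ : ℤ_[p])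
    refine ⟨n, hn, x - n, ?_, by ring⟩
    have h1 := (PadicInt.norm_le_pow_iff_mem_span_pow _ 1).2
      (by simpa [PadicInt.maximalIdeal_eq_span_p] using h)
    rw [PadicInt.norm_def] at h1
    refine le_of_eq_of_le ?_ (h1.trans (by simp))
    congr 1
  · rintro ⟨i, _, y, hy, rfl⟩
    have hp : ((p : ℝ))⁻¹ ≤ 1 := inv_le_one_of_one_le₀ (by exact_mod_cast (Fact.out : p.Prime).one_le)
    refine (IsUltrametricDist.norm_add_le_max _ _).trans (max_le ?_ (hy.trans hp))
    exact_mod_cast Padic.norm_int_le_one (i : ℤ)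

theorem padic_measure_p_smul [MeasurableSpace ℚ_[p]] [BorelSpace ℚ_[p]] (μ : Measure ℚ_[p])
    [μ.IsAddHaarMeasure] :
    (p : ℝ≥0∞) * μ (Metric.closedBall 0 (p : ℝ)⁻¹) = μ (Metric.closedBall 0 1) := by
  have hp : 1 < p := (Fact.out : p.Prime).one_lt
  rw [padic_closedBall_eq_iUnion, measure_biUnion_finset]
  · simp only [Set.image_add_left, measure_preimage_add, Finset.sum_const, Finset.card_range,
      nsmul_eq_mul]
  · intro i hi j hj hij
    rw [Function.onFun, Set.disjoint_left]
    rintro _ ⟨x, hx, rfl⟩ ⟨y, hy, hxy⟩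
    simp only [Metric.mem_closedBall, dist_zero_right] at hx hy
    have h1 : (((i : ℤ) - (j : ℤ) : ℤ) : ℚ_[p]) = y - x := by
      push_cast; linear_combination -hxy
    have h2 : ‖(((i : ℤ) - (j : ℤ) : ℤ) : ℚ_[p])‖ < 1 := by
      rw [h1]
      refine (norm_sub_le_max _ _).trans_lt ?_
      exact (max_le hy hx).trans_lt (inv_lt_one_of_one_lt₀ (by exact_mod_cast hp))
    rw [Padic.norm_intCast_lt_one_iff] at h2
    apply hij
    have hi' := Finset.mem_range.1 hi
    have hj' := Finset.mem_range.1 hj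
    obtain ⟨k, hk⟩ := h2
    have : k = 0 := by
      by_contra hk0
      have h3 : (p : ℤ) ≤ |(p : ℤ) * k| := by
        rw [abs_mul]
        have : 1 ≤ |k| := Int.one_le_abs hk0
        have h4 : |(p : ℤ)| = p := abs_of_nonneg (by positivity)
        rw [h4]; nlinarith
      rw [← hk] at h3
      have : |(i : ℤ) - j| < p := by rw [abs_lt]; constructor <;> omega
      omega
    subst this; omega
  · intro i _
    rw [Set.image_add_left]
    exact (Metric.isClosed_closedBall.measurableSet).preimage (by fun_prop)

end Padic

section FieldHaar

variable (p : ℕ) [Fact p.Prime] (F : Type*) [NormedField F] [NormedAlgebra ℚ_[p] F]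

theorem ultrametric_base (p : ℕ) [Fact p.Prime] (F : Type*) [NormedField F]
    [NormedAlgebra ℚ_[p] F] : IsUltrametricDist F := IsUltrametricDist.of_normedAlgebra ℚ_[p]

theorem coe_ringOfIntegers : (ringOfIntegers p F : Set F) = Metric.closedBall 0 1 := by
  ext x
  simp [ringOfIntegers]

theorem mem_ringOfIntegers {x : F} : x ∈ ringOfIntegers p F ↔ ‖x‖ ≤ 1 := Iff.rfl

theorem isOpen_ringOfIntegers : IsOpen (ringOfIntegers p F : Set F) := by
  have := ultrametric_base p F
  rw [coe_ringOfIntegers]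
  exact IsUltrametricDist.isOpen_closedBall _ one_ne_zero

/-- The norm of `a`, raised to the degree of its minimal polynomial, is the norm of the constant
coefficient, an element of ℚ_p. This reduces the scaling factor of `a` to those of `p` and of units.
-/
theorem exists_norm_pow_eq {F : Type*} [NormedField F] [NormedAlgebra ℚ_[p] F]
    [FiniteDimensional ℚ_[p] F] (a : F) (ha : a ≠ 0) :
    ∃ e : ℕ, 0 < e ∧ ∃ k : ℤ, ‖a‖ ^ e = ‖(p : ℚ_[p])‖ ^ k := by
  have halg : IsIntegral ℚ_[p] a := Algebra.IsIntegral.isIntegral a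
  refine ⟨(minpoly ℚ_[p] a).natDegree, minpoly.natDegree_pos halg, ?_⟩
  have h1 : ‖a‖ = spectralNorm ℚ_[p] F a :=
    spectralNorm_unique_field_norm_ext (f := NormedField.toAbsoluteValue F)
      (fun x => norm_algebraMap' F x) a
  have h0 : (minpoly ℚ_[p] a).coeff 0 ≠ 0 := minpoly.coeff_zero_ne_zero halg ha
  rw [h1, spectralNorm.spectralNorm_eq_norm_coeff_zero_rpow, ← Real.rpow_natCast,
    ← Real.rpow_mul (norm_nonneg _), one_div, inv_mul_cancel₀, Real.rpow_one]
  · exact ⟨_, by rw [Padic.norm_eq_zpow_neg_valuation h0, Padic.norm_p, inv_zpow', zpow_neg]⟩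
  · exact_mod_cast (minpoly.natDegree_pos halg).ne'

section absF

variable {F}

theorem absF_one : absF p (1 : F) = 1 := by simp [absF]

theorem absF_mul (x y : F) : absF p (x * y) = absF p x * absF p y := by
  simp [absF, mul_pow, ENNReal.ofReal_mul]

theorem absF_neg (x : F) : absF p (-x) = absF p x := by simp [absF]

variable (F) in
/-- `absF` as a monoid homomorphism. -/
noncomputable def absFHom : F →* ℝ≥0∞ where
  toFun := absF p
  map_one' := absF_one p
  map_mul' := absF_mul p

theorem absF_pow (x : F) (n : ℕ) : absF p (x ^ n) = absF p x ^ n := map_pow (absFHom p F) x n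

theorem absF_prod {ι : Type*} (s : Finset ι) (f : ι → F) :
    absF p (∏ i ∈ s, f i) = ∏ i ∈ s, absF p (f i) := map_prod (absFHom p F) f s

theorem absF_eq_one_of_norm_eq_one {x : F} (h : ‖x‖ = 1) : absF p x = 1 := by
  simp [absF, h]

theorem absF_ne_top (x : F) : absF p x ≠ ∞ := ENNReal.ofReal_ne_top

theorem continuous_absF : Continuous (absF p : F → ℝ≥0∞) := by
  exact ENNReal.continuous_ofReal.comp (by fun_prop)

variable [FiniteDimensional ℚ_[p] F]

theorem absF_zero : absF p (0 : F) = 0 := by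
  simp [absF, (Module.finrank_pos (R := ℚ_[p]) (M := F)).ne']

end absF

variable [FiniteDimensional ℚ_[p] F]

theorem properSpace_base (p : ℕ) [Fact p.Prime] (F : Type*) [NormedField F]
    [NormedAlgebra ℚ_[p] F] [FiniteDimensional ℚ_[p] F] : ProperSpace F := FiniteDimensional.proper ℚ_[p] F

theorem isCompact_ringOfIntegers : IsCompact (ringOfIntegers p F : Set F) := by
  have := properSpace_base p F
  rw [coe_ringOfIntegers]
  exact isCompact_closedBall _ _

variable [MeasurableSpace F] [BorelSpace F]

instance haarF_isAddHaarMeasure : (haarF p F).IsAddHaarMeasure := by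
  have := locallyCompactSpace_base p F
  refine normalizedHaar_isAddHaarMeasure (isCompact_ringOfIntegers p F) ?_
  rw [(isOpen_ringOfIntegers p F).interior_eq]
  exact ⟨0, zero_mem _⟩

theorem haarF_ringOfIntegers : haarF p F (ringOfIntegers p F : Set F) = 1 := by
  have := locallyCompactSpace_base p F
  refine normalizedHaar_self (isCompact_ringOfIntegers p F) ?_
  rw [(isOpen_ringOfIntegers p F).interior_eq]
  exact ⟨0, zero_mem _⟩

instance haarF_regular : (haarF p F).Regular := by
  have := properSpace_base p F
  infer_instance

instance haarF_sigmaFinite : SigmaFinite (haarF p F) := by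
  have := properSpace_base p F
  infer_instance

/-- Multiplication by a nonzero scalar. -/
noncomputable def smulEquiv {a : F} (ha : a ≠ 0) : F ≃ₜ+ F where
  toFun x := a * x
  invFun x := a⁻¹ * x
  left_inv x := by field_simp
  right_inv x := by field_simp
  map_add' := mul_add a
  continuous_toFun := by fun_prop
  continuous_invFun := by fun_prop

/-- Haar measure is scaled by `c` under multiplication by `a`. -/
def ScalesBy (a : F) (c : ℝ≥0∞) : Prop :=
  ∀ S : Set F, haarF p F ((fun x => a * x) '' S) = c * haarF p F S

variable {p F}

theorem ScalesBy.of_ringOfIntegers {a : F} {c : ℝ≥0∞} (ha : a ≠ 0)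
    (h : haarF p F ((fun x => a * x) '' (ringOfIntegers p F : Set F)) = c) : ScalesBy p F a c := by
  have := locallyCompactSpace_base p F
  intro S
  exact measure_image_continuousAddEquiv (haarF p F) (smulEquiv F ha)
    (K := (ringOfIntegers p F : Set F)) (by simp [haarF_ringOfIntegers])
    (by simp [haarF_ringOfIntegers]) (by rw [haarF_ringOfIntegers, mul_one]; exact h) S

theorem ScalesBy.mul {a b : F} {c d : ℝ≥0∞} (ha : ScalesBy p F a c) (hb : ScalesBy p F b d) :
    ScalesBy p F (a * b) (c * d) := by
  intro S
  have : (fun x => a * b * x) '' S = (fun x => a * x) '' ((fun x => b * x) '' S) := by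
    rw [Set.image_image]; simp [mul_assoc]
  rw [this, ha, hb, mul_assoc]

theorem ScalesBy.unique {a : F} {c d : ℝ≥0∞} (ha : ScalesBy p F a c) (hb : ScalesBy p F a d) :
    c = d := by
  have h1 := ha (ringOfIntegers p F : Set F)
  have h2 := hb (ringOfIntegers p F : Set F)
  simp only [haarF_ringOfIntegers, mul_one] at h1 h2
  rw [← h1, h2]

theorem scalesBy_one : ScalesBy p F (1 : F) 1 := by
  intro S; simp

theorem ScalesBy.pow {a : F} {c : ℝ≥0∞} (ha : ScalesBy p F a c) (n : ℕ) :
    ScalesBy p F (a ^ n) (c ^ n) := by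
  induction n with
  | zero => simpa using scalesBy_one
  | succ n ih => rw [pow_succ, pow_succ]; exact ih.mul ha

theorem scalesBy_of_norm_eq_one {a : F} (ha : ‖a‖ = 1) : ScalesBy p F a 1 := by
  have ha0 : a ≠ 0 := by rintro rfl; simp at ha
  refine ScalesBy.of_ringOfIntegers ha0 ?_
  rw [← haarF_ringOfIntegers p F]
  congr 1
  ext x
  constructor
  · rintro ⟨y, hy, rfl⟩
    simpa [mem_ringOfIntegers, ha] using hy
  · intro hx
    refine ⟨a⁻¹ * x, ?_, by field_simp⟩
    simpa [mem_ringOfIntegers, ha] using hx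

theorem exists_scalesBy {a : F} (ha : a ≠ 0) : ∃ c, ScalesBy p F a c :=
  ⟨_, ScalesBy.of_ringOfIntegers ha rfl⟩

variable (p F) in
-- A ℚ_p-basis identifies F with ℚ_p^d, where multiplication by `p` shrinks the unit ball to the
-- ball of radius 1/p; its product measure drops by p^d because ℤ_p is the union of p cosets of
-- pℤ_p.
theorem scalesBy_p : ScalesBy p F (algebraMap ℚ_[p] F p) (absF p (algebraMap ℚ_[p] F p)) := by
  classical
  set d := Module.finrank ℚ_[p] F
  have hp0 : (p : ℚ_[p]) ≠ 0 := by exact_mod_cast (Fact.out : p.Prime).ne_zero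
  have := properSpace_base p F
  let e : F ≃L[ℚ_[p]] (Fin d → ℚ_[p]) := (Module.finBasis ℚ_[p] F).equivFunL
  borelize ℚ_[p]
  let ν : Measure (Fin d → ℚ_[p]) := (haarF p F).map e
  have : ν.IsAddHaarMeasure := e.isAddHaarMeasure_map _
  let μ : Measure (Fin d → ℚ_[p]) := Measure.pi fun _ => (Measure.addHaar : Measure ℚ_[p])
  have : μ.IsAddHaarMeasure := inferInstance
  have hpb : ∀ r : ℝ, Metric.closedBall (0 : Fin d → ℚ_[p]) r = Metric.closedBall 0 r :=
    fun _ => rfl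
  have hμ : μ (Metric.closedBall 0 1) = p ^ d * μ (Metric.closedBall 0 (p : ℝ)⁻¹) := by
    rw [closedBall_pi _ zero_le_one, closedBall_pi _ (by positivity)]
    simp only [μ, Measure.pi_pi, Pi.zero_apply, ← padic_measure_p_smul, Finset.prod_const,
      Finset.card_univ, Fintype.card_fin, mul_pow]
  have hν : ν (Metric.closedBall 0 1) = p ^ d * ν (Metric.closedBall 0 (p : ℝ)⁻¹) := by
    have e1 := Measure.isAddLeftInvariant_eq_smul ν μ
    rw [e1, Measure.smul_apply, Measure.smul_apply, hμ]
    simp only [ENNReal.smul_def, smul_eq_mul]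
    ring
  have hmap : ∀ S, MeasurableSet S → ν S = haarF p F (e ⁻¹' S) := fun S hS =>
    Measure.map_apply e.continuous.measurable hS
  set K : Set F := e ⁻¹' (Metric.closedBall 0 1) with hK
  have hKfin : haarF p F K ≠ ∞ := by
    rw [← hmap _ Metric.isClosed_closedBall.measurableSet]
    exact (isCompact_closedBall _ _).measure_ne_top
  have hK0 : haarF p F K ≠ 0 := by
    rw [← hmap _ Metric.isClosed_closedBall.measurableSet]
    exact (Metric.measure_closedBall_pos _ _ one_pos).ne'
  have ha : algebraMap ℚ_[p] F p ≠ 0 := (map_ne_zero _).2 hp0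
  have himg : (smulEquiv F ha) '' K = e ⁻¹' (Metric.closedBall 0 (p : ℝ)⁻¹) := by
    ext x
    constructor
    · rintro ⟨y, hy, rfl⟩
      have : smulEquiv F ha y = (p : ℚ_[p]) • y := by rw [Algebra.smul_def]; rfl
      rw [this]
      simp only [hK, Set.mem_preimage, Metric.mem_closedBall, dist_zero_right, map_smul,
        norm_smul, Padic.norm_p] at hy ⊢
      exact mul_le_of_le_one_right (by positivity) hy
    · intro hx
      refine ⟨(p : ℚ_[p])⁻¹ • x, ?_, ?_⟩
      · simp only [hK, Set.mem_preimage, Metric.mem_closedBall, dist_zero_right, map_smul,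
          norm_smul, norm_inv, Padic.norm_p, inv_inv] at hx ⊢
        have hp : (0 : ℝ) < p := by exact_mod_cast (Fact.out : p.Prime).pos
        calc (p : ℝ) * ‖e x‖ ≤ p * (p : ℝ)⁻¹ := by gcongr
          _ = 1 := by field_simp
      · have : ∀ y, smulEquiv F ha y = (p : ℚ_[p]) • y := fun y => by
          rw [Algebra.smul_def]; rfl
        rw [this, smul_smul, mul_inv_cancel₀ hp0, one_smul]
  have hc : absF p (algebraMap ℚ_[p] F p) = ((p : ℝ≥0∞) ^ d)⁻¹ := by
    unfold absF
    rw [norm_algebraMap', Padic.norm_p, inv_pow, ENNReal.ofReal_inv_of_pos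
      (pow_pos (by exact_mod_cast (Fact.out : p.Prime).pos) _), ENNReal.ofReal_pow (by positivity)]
    simp [d]
  intro S
  refine measure_image_continuousAddEquiv (haarF p F) (smulEquiv F ha) hK0 hKfin ?_ S
  rw [himg, hK, ← hmap _ Metric.isClosed_closedBall.measurableSet,
    ← hmap _ Metric.isClosed_closedBall.measurableSet, hν, hc, ← mul_assoc, ENNReal.inv_mul_cancel,
    one_mul]
  · simp [(Fact.out : p.Prime).ne_zero]
  · simp

theorem ScalesBy.inv {a : F} {c : ℝ≥0∞} (ha0 : a ≠ 0) (ha : ScalesBy p F a c) :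
    ScalesBy p F a⁻¹ c⁻¹ := by
  obtain ⟨d, hd⟩ := exists_scalesBy (p := p) (inv_ne_zero ha0)
  have h := ha.mul hd
  rw [mul_inv_cancel₀ ha0] at h
  have h1 := h.unique scalesBy_one
  rwa [← ENNReal.eq_inv_of_mul_eq_one_left (by rwa [mul_comm] at h1)]

theorem scalesBy_absF {a : F} (ha : a ≠ 0) : ScalesBy p F a (absF p a) := by
  obtain ⟨c, hc⟩ := exists_scalesBy (p := p) ha
  obtain ⟨e, he, k, hk⟩ := exists_norm_pow_eq p a ha
  have hp0 : algebraMap ℚ_[p] F p ≠ 0 :=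
    (map_ne_zero _).2 (by exact_mod_cast (Fact.out : p.Prime).ne_zero)
  set ϖ := algebraMap ℚ_[p] F p
  have hk' : ‖a‖ ^ e = ‖ϖ‖ ^ k := by rw [hk, norm_algebraMap']
  have hϖ : ScalesBy p F ϖ (absF p ϖ) := scalesBy_p p F
  -- Some power a^e is a unit times a power of `p`, whose factor is known; e-th powers are injective
  -- on `ℝ≥0∞`.
  suffices h : c ^ e = absF p a ^ e by
    rwa [(ENNReal.pow_right_strictMono he.ne').injective h] at hc
  refine (hc.pow e).unique ?_
  rw [← absF_pow]
  have key : ∀ n : ℕ, ∀ x : F, ‖x‖ = ‖ϖ‖ ^ n → ScalesBy p F x (absF p x) := by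
    intro n x hx
    have h1 := (hϖ.pow n).mul (scalesBy_of_norm_eq_one (p := p) (a := x * (ϖ ^ n)⁻¹)
      (by rw [norm_mul, norm_inv, norm_pow, hx, mul_inv_cancel₀]; simp [hp0]))
    rw [mul_one, ← absF_pow, mul_comm x, mul_inv_cancel_left₀ (pow_ne_zero _ hp0)] at h1
    convert h1 using 1
    simp [absF, hx]
  obtain ⟨n, rfl | rfl⟩ := k.eq_nat_or_neg
  · exact key n _ (by rw [norm_pow, hk', zpow_natCast])
  · have h2 := (key n (a ^ e)⁻¹ (by
      rw [norm_inv, norm_pow, hk', zpow_neg, inv_inv, zpow_natCast])).inv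
      (inv_ne_zero (pow_ne_zero _ ha))
    rw [inv_inv] at h2
    convert h2 using 1
    apply ENNReal.eq_inv_of_mul_eq_one_left
    rw [← absF_mul, mul_inv_cancel₀ (pow_ne_zero _ ha), absF_one]

end FieldHaar

/-- The nontrivially normed field structure of `F`. -/
abbrev nontriviallyNormedBase (p : ℕ) [Fact p.Prime] (F : Type*) [NormedField F]
    [NormedAlgebra ℚ_[p] F] : NontriviallyNormedField F :=
  .ofNormNeOne ⟨algebraMap ℚ_[p] F p,
    (map_ne_zero _).2 (by exact_mod_cast (Fact.out : p.Prime).ne_zero), by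
    rw [norm_algebraMap', Padic.norm_p]
    exact (inv_lt_one_of_one_lt₀ (by exact_mod_cast (Fact.out : p.Prime).one_lt)).ne⟩

section MatrixScaling

variable (p : ℕ) [Fact p.Prime] (F : Type*) [NormedField F] [NormedAlgebra ℚ_[p] F]
  [FiniteDimensional ℚ_[p] F] [MeasurableSpace F] [BorelSpace F] (ι : Type*) [Fintype ι]

/-- The product Haar measure on `ι → F`, giving measure `1` to the unit cube. -/
noncomputable def haarPi : Measure (ι → F) := Measure.pi fun _ => haarF p F

theorem haarF_nullSingleton (p : ℕ) [Fact p.Prime] (F : Type*) [NormedField F]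
    [NormedAlgebra ℚ_[p] F] [FiniteDimensional ℚ_[p] F] [MeasurableSpace F] [BorelSpace F] :
    NullSingletonClass (haarF p F) := by
  have := properSpace_base p F
  have : (nhdsWithin (0 : F) {0}ᶜ).NeBot := by
    let _ : NontriviallyNormedField F := nontriviallyNormedBase p F
    exact NormedField.nhdsNE_neBot 0
  infer_instance

theorem secondCountable_base (p : ℕ) [Fact p.Prime] (F : Type*) [NormedField F]
    [NormedAlgebra ℚ_[p] F] [FiniteDimensional ℚ_[p] F] : SecondCountableTopology F := by
  have := properSpace_base p F
  infer_instance

instance haarPi_isAddHaarMeasure : (haarPi p F ι).IsAddHaarMeasure := by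
  have := properSpace_base p F
  unfold haarPi
  infer_instance

instance haarPi_sigmaFinite : SigmaFinite (haarPi p F ι) := by
  unfold haarPi
  infer_instance

instance haarPi_regular : (haarPi p F ι).Regular := by
  have := properSpace_base p F
  infer_instance

theorem haarPi_closedBall_one : haarPi p F ι (Metric.closedBall 0 1) = 1 := by
  rw [closedBall_pi _ zero_le_one, haarPi, Measure.pi_pi]
  simp [← coe_ringOfIntegers p F, haarF_ringOfIntegers]

variable {F ι} [DecidableEq ι]

/-- The topological automorphism of `ι → F` given by an invertible matrix. -/
noncomputable def mulVecEquiv (M : Matrix ι ι F) (hM : M.det ≠ 0) : (ι → F) ≃ₜ+ (ι → F) where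
  toFun v := M.mulVec v
  invFun v := M⁻¹.mulVec v
  left_inv v := by
    change M⁻¹.mulVec (M.mulVec v) = v
    rw [Matrix.mulVec_mulVec, Matrix.nonsing_inv_mul _ (isUnit_iff_ne_zero.2 hM), Matrix.one_mulVec]
  right_inv v := by
    change M.mulVec (M⁻¹.mulVec v) = v
    rw [Matrix.mulVec_mulVec, Matrix.mul_nonsing_inv _ (isUnit_iff_ne_zero.2 hM), Matrix.one_mulVec]
  map_add' v w := Matrix.mulVec_add M v w
  continuous_toFun := by fun_prop
  continuous_invFun := by fun_prop

theorem haarPi_image_diagonal (D : ι → F) (S : Set (ι → F)) :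
    haarPi p F ι ((Matrix.diagonal D).mulVec '' S) =
      absF p (Matrix.diagonal D).det * haarPi p F ι S := by
  have := properSpace_base p F
  by_cases hD : (Matrix.diagonal D).det = 0
  · rw [hD, absF_zero, zero_mul]
    rw [Matrix.det_diagonal, Finset.prod_eq_zero_iff] at hD
    obtain ⟨i, -, hi⟩ := hD
    refine measure_mono_null (t := {v : ι → F | v i = 0}) ?_ ?_
    · rintro _ ⟨v, -, rfl⟩
      simp [Matrix.mulVec_diagonal, hi]
    · have := haarF_nullSingleton p F
      exact Measure.pi_hyperplane _ i 0
  · refine measure_image_continuousAddEquiv (haarPi p F ι) (mulVecEquiv _ hD)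
      (K := Metric.closedBall 0 1) (by simp [haarPi_closedBall_one])
      (by simp [haarPi_closedBall_one]) ?_ S
    rw [haarPi_closedBall_one, mul_one]
    have hD' : ∀ i, D i ≠ 0 := by
      intro i hi
      exact hD (by rw [Matrix.det_diagonal]; exact Finset.prod_eq_zero (Finset.mem_univ i) hi)
    have : mulVecEquiv _ hD '' Metric.closedBall (0 : ι → F) 1 =
        Set.pi Set.univ fun i => (fun x => D i * x) '' (ringOfIntegers p F : Set F) := by
      ext v
      simp only [Set.mem_pi, Set.mem_univ, forall_const, coe_ringOfIntegers]
      constructor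
      · rintro ⟨w, hw, rfl⟩ i
        refine ⟨w i, ?_, (Matrix.mulVec_diagonal D w i).symm⟩
        rw [closedBall_pi _ zero_le_one] at hw
        exact hw i trivial
      · intro h
        choose w hw hwv using h
        refine ⟨w, ?_, ?_⟩
        · rw [closedBall_pi _ zero_le_one]
          exact fun i _ => hw i
        · ext i
          rw [← hwv i]
          exact Matrix.mulVec_diagonal D w i
    rw [this, haarPi, Measure.pi_pi, Matrix.det_diagonal, absF_prod]
    refine Finset.prod_congr rfl fun i _ => ?_
    rw [scalesBy_absF (hD' i), haarF_ringOfIntegers, mul_one]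

/-- A suitable box of finite nonzero measure is mapped onto itself by the transvection, so the
scaling factor is 1. -/
theorem haarPi_image_transvection (t : Matrix.TransvectionStruct ι F) (S : Set (ι → F)) :
    haarPi p F ι (t.toMatrix.mulVec '' S) = absF p t.toMatrix.det * haarPi p F ι S := by
  have := properSpace_base p F
  have hu := ultrametric_base p F
  have hdet : t.toMatrix.det ≠ 0 := by simp
  rw [t.det, absF_one]
  -- The side in direction `t.i` is enlarged to absorb `t.c` times a coordinate of norm at most 1;
  -- by the ultrametric inequality the box is then stable under the transvection and its inverse.
  set R : ι → ℝ := fun k => if k = t.i then max 1 ‖t.c‖ else 1 with hR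
  have hRpos : ∀ k, 0 < R k := by
    intro k; simp only [hR]; split_ifs <;> simp
  let K : Set (ι → F) := Set.pi Set.univ fun k => Metric.closedBall 0 (R k)
  have hK : haarPi p F ι K = ∏ k, haarF p F (Metric.closedBall 0 (R k)) := Measure.pi_pi _ _
  refine measure_image_continuousAddEquiv (haarPi p F ι) (mulVecEquiv _ hdet) (K := K) ?_ ?_ ?_ S
  · rw [hK]
    exact (Finset.prod_ne_zero_iff.2 fun k _ => (Metric.measure_closedBall_pos _ _ (hRpos k)).ne')
  · rw [hK]
    exact ENNReal.prod_ne_top fun k _ => (isCompact_closedBall _ _).measure_ne_top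
  have hval : ∀ (c : F) (v : ι → F) k, (Matrix.transvection t.i t.j c).mulVec v k =
      if k = t.i then v k + c * v t.j else v k := by
    intro c v k
    rw [Matrix.transvection, Matrix.add_mulVec, Matrix.one_mulVec, Pi.add_apply]
    split_ifs with h
    · subst h
      simp [Matrix.mulVec, dotProduct, Matrix.single_apply]
    · simp [Matrix.mulVec, dotProduct, Ne.symm h]
  have hji : t.j ≠ t.i := t.hij.symm
  have hmap : ∀ c : F, ‖c‖ ≤ ‖t.c‖ → ∀ v ∈ K, (Matrix.transvection t.i t.j c).mulVec v ∈ K := by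
    intro c hc v hv k _
    simp only [K, Set.mem_pi, Set.mem_univ, forall_const, Metric.mem_closedBall,
      dist_zero_right] at hv ⊢
    rw [hval]
    split_ifs with h
    · refine (IsUltrametricDist.norm_add_le_max _ _).trans (max_le (hv k) ?_)
      have h1 := hv t.j
      simp only [hR, if_neg hji] at h1
      simp only [hR, if_pos h, norm_mul]
      refine le_max_of_le_right ?_
      exact (mul_le_of_le_one_right (norm_nonneg _) h1).trans hc
    · exact hv k
  rw [one_mul]
  congr 1
  apply Set.Subset.antisymm
  · rintro _ ⟨v, hv, rfl⟩
    exact hmap _ le_rfl v hv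
  · intro v hv
    refine ⟨_, hmap (-t.c) (by simp) v hv, ?_⟩
    change (Matrix.transvection t.i t.j t.c).mulVec _ = v
    rw [Matrix.mulVec_mulVec, Matrix.transvection_mul_transvection_same _ _ t.hij]
    simp

/-- Every matrix is a product of transvections and diagonal matrices. Singular matrices are covered
too: a diagonal one with a zero entry has image in a hyperplane, which is null. -/
theorem haarPi_image_mulVec (M : Matrix ι ι F) (S : Set (ι → F)) :
    haarPi p F ι (M.mulVec '' S) = absF p M.det * haarPi p F ι S := by
  revert S
  refine Matrix.diagonal_transvection_induction
    (fun M => ∀ S, haarPi p F ι (M.mulVec '' S) = absF p M.det * haarPi p F ι S) M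
    (fun D _ => haarPi_image_diagonal p D) (fun t => haarPi_image_transvection p t) ?_
  intro A B hA hB S
  have : (A * B).mulVec '' S = A.mulVec '' (B.mulVec '' S) := by
    rw [Set.image_image]; simp [Matrix.mulVec_mulVec]
  rw [this, hA, hB, Matrix.det_mul, absF_mul, mul_assoc]

theorem lintegral_comp_mulVec (M : Matrix ι ι F) (hM : M.det ≠ 0) (f : (ι → F) → ℝ≥0∞) :
    absF p M.det * ∫⁻ v, f (M.mulVec v) ∂(haarPi p F ι) = ∫⁻ v, f v ∂(haarPi p F ι) := by
  have := properSpace_base p F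
  let e := (mulVecEquiv M hM).toHomeomorph.toMeasurableEquiv
  have hmap : absF p M.det • (haarPi p F ι).map e = haarPi p F ι := by
    ext S hS
    rw [Measure.smul_apply, e.map_apply, smul_eq_mul, ← haarPi_image_mulVec]
    congr 1
    exact Set.image_preimage_eq S e.surjective
  conv_rhs => rw [← hmap, lintegral_smul_measure, lintegral_map_equiv]
  rfl

end MatrixScaling

/-! ### The ultrametric area formula -/

section AreaFormula

variable {p : ℕ} [Fact p.Prime] {F : Type*} [NormedField F] [NormedAlgebra ℚ_[p] F]
  [FiniteDimensional ℚ_[p] F] {ι : Type*} [Fintype ι] [DecidableEq ι]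

theorem norm_mulVec_le {m n : Type*} [Fintype m] [Fintype n] {F : Type*} [NormedField F]
    [IsUltrametricDist F] {A : Matrix m n F} {c : ℝ} (hc : 0 ≤ c) (hA : ∀ i j, ‖A i j‖ ≤ c)
    (v : n → F) : ‖A.mulVec v‖ ≤ c * ‖v‖ := by
  rw [pi_norm_le_iff_of_nonneg (by positivity)]
  intro i
  refine IsUltrametricDist.norm_sum_le_of_forall_le_of_nonneg (by positivity) fun j _ => ?_
  rw [norm_mul]
  gcongr
  · exact hA i j
  · exact norm_le_pi_norm v j

/-- A map all of whose difference quotients are close to the identity on a ball is an isometry of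
this ball onto a ball of the same radius. -/
theorem image_closedBall_of_near_id {V : Type*} [NormedAddCommGroup V] [IsUltrametricDist V]
    [CompleteSpace V] {h : V → V} {x : V} {ρ : ℝ} (hρ : 0 ≤ ρ)
    (hh : ∀ y ∈ Metric.closedBall x ρ, ∀ z ∈ Metric.closedBall x ρ,
      ‖h y - h z - (y - z)‖ ≤ 2⁻¹ * ‖y - z‖) :
    Set.InjOn h (Metric.closedBall x ρ) ∧
      h '' Metric.closedBall x ρ = Metric.closedBall (h x) ρ := by
  have hx : x ∈ Metric.closedBall x ρ := Metric.mem_closedBall_self hρ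
  have hle : ∀ y ∈ Metric.closedBall x ρ, ∀ z ∈ Metric.closedBall x ρ,
      ‖h y - h z‖ ≤ ‖y - z‖ := by
    intro y hy z hz
    have := IsUltrametricDist.norm_add_le_max (h y - h z - (y - z)) (y - z)
    rw [sub_add_cancel] at this
    refine this.trans (max_le ((hh y hy z hz).trans ?_) le_rfl)
    linarith [norm_nonneg (y - z)]
  refine ⟨?_, Set.Subset.antisymm ?_ ?_⟩
  · intro y hy z hz hyz
    have := hh y hy z hz
    rw [hyz, sub_self, zero_sub, norm_neg] at this
    have h0 : ‖y - z‖ = 0 := le_antisymm (by linarith [norm_nonneg (y - z)]) (norm_nonneg _)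
    exact sub_eq_zero.1 (norm_eq_zero.1 h0)
  · rintro _ ⟨y, hy, rfl⟩
    rw [Metric.mem_closedBall, dist_eq_norm]
    exact (hle y hy x hx).trans (by rwa [← dist_eq_norm])
  · intro t ht
    rw [Metric.mem_closedBall, dist_eq_norm] at ht
    -- A fixed point of `Φ` is a preimage of `t`, and the hypothesis on difference quotients makes
    -- `Φ` a contraction of ratio 1/2.
    let Φ : V → V := fun y => y - (h y - t)
    have hΦmaps : Set.MapsTo Φ (Metric.closedBall x ρ) (Metric.closedBall x ρ) := by
      intro y hy
      have hy' := hy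
      rw [Metric.mem_closedBall, dist_eq_norm] at hy ⊢
      have e : Φ y - x = (y - x) - ((h y - h x) - (t - h x)) := by simp only [Φ]; abel
      rw [e]
      refine (norm_sub_le_max _ _).trans (max_le hy ((norm_sub_le_max _ _).trans (max_le ?_ ht)))
      exact (hle y hy' x hx).trans hy
    have hcontr : ContractingWith 2⁻¹ (hΦmaps.restrict Φ _ _) := by
      refine ⟨by norm_num, LipschitzWith.of_dist_le_mul ?_⟩
      rintro ⟨y, hy⟩ ⟨z, hz⟩
      change dist (Φ y) (Φ z) ≤ (2⁻¹ : NNReal) * dist y z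
      rw [dist_eq_norm, dist_eq_norm]
      have e : Φ y - Φ z = -(h y - h z - (y - z)) := by simp only [Φ]; abel
      rw [e, norm_neg]
      simpa using hh y hy z hz
    obtain ⟨y, hy, hfix, -⟩ := hcontr.exists_fixedPoint' Metric.isClosed_closedBall.isComplete
      hΦmaps hx (edist_ne_top _ _)
    refine ⟨y, hy, ?_⟩
    have : y - (h y - t) = y := hfix
    exact sub_eq_zero.1 (by simpa using this)

variable [MeasurableSpace F] [BorelSpace F]

variable (p) in
/-- A strictly differentiable map between open subsets of `ι → F` is, near a point where the
Jacobian does not vanish, a bijection onto an open set which scales measure by the Jacobian. -/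
theorem exists_good_closedBall {U : Set (ι → F)} (hU : IsOpen U) {g : (ι → F) → ι → F}
    {M : (ι → F) → (ι → F) → Matrix ι ι F} (hM : ContinuousOn M.uncurry (U ×ˢ U))
    (hg : ∀ y ∈ U, ∀ z ∈ U, g y - g z = (M y z).mulVec (y - z)) {x : ι → F} (hx : x ∈ U)
    (hdet : (M x x).det ≠ 0) :
    ∃ ρ₀ > 0, ∀ ρ, 0 < ρ → ρ ≤ ρ₀ → Metric.closedBall x ρ ⊆ U ∧
      Set.InjOn g (Metric.closedBall x ρ) ∧ IsOpen (g '' Metric.closedBall x ρ) ∧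
      haarPi p F ι (g '' Metric.closedBall x ρ) =
        ∫⁻ y in Metric.closedBall x ρ, absF p (M y y).det ∂(haarPi p F ι) := by
  have := properSpace_base p F
  have hu := ultrametric_base p F
  set D := M x x with hD
  have hUU : U ×ˢ U ∈ nhds (x, x) := (hU.prod hU).mem_nhds ⟨hx, hx⟩
  have hMx : ContinuousAt M.uncurry (x, x) := hM.continuousAt hUU
  -- Near `x` the map factors as `D` after a map whose difference quotients are within 1/2 of the
  -- identity; the latter carries balls onto balls of the same radius, so `D` alone accounts for the
  -- measure.
  have h1 : ∀ᶠ q in nhds (x, x), ∀ i j, ‖(D⁻¹ * M q.1 q.2 - 1) i j‖ ≤ 2⁻¹ := by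
    rw [Filter.eventually_all]; intro i
    rw [Filter.eventually_all]; intro j
    have hc : ContinuousAt (fun q : (ι → F) × (ι → F) => ‖(D⁻¹ * M q.1 q.2 - 1) i j‖) (x, x) := by
      have : ContinuousAt (fun q : (ι → F) × (ι → F) => M q.1 q.2) (x, x) := hMx
      have h2 : Continuous fun A : Matrix ι ι F => ‖(D⁻¹ * A - 1) i j‖ := by fun_prop
      exact h2.continuousAt.comp this
    have h0 : ‖(D⁻¹ * M x x - 1) i j‖ < 2⁻¹ := by
      rw [← hD, Matrix.nonsing_inv_mul _ (isUnit_iff_ne_zero.2 hdet)]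
      simp
    exact (hc.eventually_lt_const h0).mono fun _ h => h.le
  -- By the ultrametric inequality this forces |det M(y, y)| = |det D|: the integrand is constant
  -- near `x`.
  have h2 : ∀ᶠ q in nhds (x, x), ‖(M q.1 q.2).det - D.det‖ < ‖D.det‖ := by
    have hc : ContinuousAt (fun q : (ι → F) × (ι → F) => ‖(M q.1 q.2).det - D.det‖) (x, x) := by
      have : ContinuousAt (fun q : (ι → F) × (ι → F) => M q.1 q.2) (x, x) := hMx
      have h2 : Continuous fun A : Matrix ι ι F => ‖A.det - D.det‖ := by fun_prop
      exact h2.continuousAt.comp this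
    refine hc.eventually_lt_const ?_
    simp only [← hD, sub_self, norm_zero]
    exact norm_pos_iff.2 hdet
  have h3 := (h1.and h2).and hUU
  rw [nhds_prod_eq, Filter.eventually_prod_self_iff'] at h3
  obtain ⟨t, ht, h3⟩ := h3
  obtain ⟨ρ₀, hρ₀, hball⟩ := Metric.nhds_basis_closedBall.mem_iff.1 ht
  refine ⟨ρ₀, hρ₀, fun ρ hρ hρρ => ?_⟩
  have hsub : Metric.closedBall x ρ ⊆ t := (Metric.closedBall_subset_closedBall hρρ).trans hball
  have hBU : Metric.closedBall x ρ ⊆ U := fun y hy => (h3 y (hsub hy) y (hsub hy)).2.1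
  let h : (ι → F) → ι → F := fun y => D⁻¹.mulVec (g y)
  have hgh : ∀ y, g y = D.mulVec (h y) := fun y => by
    simp only [h]
    rw [Matrix.mulVec_mulVec, Matrix.mul_nonsing_inv _ (isUnit_iff_ne_zero.2 hdet),
      Matrix.one_mulVec]
  obtain ⟨hinj, himg⟩ := image_closedBall_of_near_id (h := h) (x := x) hρ.le (by
    intro y hy z hz
    have e : h y - h z - (y - z) = (D⁻¹ * M y z - 1).mulVec (y - z) := by
      simp only [h]
      rw [← Matrix.mulVec_sub, hg y (hBU hy) z (hBU hz), Matrix.sub_mulVec, Matrix.one_mulVec,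
        Matrix.mulVec_mulVec]
    rw [e]
    exact norm_mulVec_le (by norm_num) (h3 y (hsub hy) z (hsub hz)).1.1 _)
  have himg' : g '' Metric.closedBall x ρ = D.mulVec '' Metric.closedBall (h x) ρ := by
    rw [← himg, Set.image_image]
    exact Set.image_congr fun y _ => hgh y
  refine ⟨hBU, fun y hy z hz hyz => hinj hy hz (by simp only [h, hyz]), ?_, ?_⟩
  · rw [himg']
    exact (mulVecEquiv D hdet).toHomeomorph.isOpenMap _
      (IsUltrametricDist.isOpen_closedBall _ hρ.ne')
  · rw [himg', haarPi_image_mulVec]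
    have : ∀ y ∈ Metric.closedBall x ρ, absF p (M y y).det = absF p D.det := by
      intro y hy
      have := (h3 y (hsub hy) y (hsub hy)).1.2
      unfold absF
      rw [IsUltrametricDist.norm_eq_of_add_norm_lt_max (x := (M y y).det) (y := -D.det), norm_neg]
      rw [← sub_eq_add_neg, norm_neg]
      exact lt_max_of_lt_right this
    rw [setLIntegral_congr_fun Metric.isClosed_closedBall.measurableSet this, setLIntegral_const]
    congr 1
    rw [Measure.addHaar_closedBall_center, ← Measure.addHaar_closedBall_center _ x]

theorem isOpen_image_of_det_ne_zero (p : ℕ) [Fact p.Prime] {F : Type*} [NormedField F]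
    [NormedAlgebra ℚ_[p] F] [FiniteDimensional ℚ_[p] F] {ι : Type*} [Fintype ι] [DecidableEq ι]
    {U : Set (ι → F)} (hU : IsOpen U) {g : (ι → F) → ι → F}
    {M : (ι → F) → (ι → F) → Matrix ι ι F} (hM : ContinuousOn M.uncurry (U ×ˢ U))
    (hg : ∀ y ∈ U, ∀ z ∈ U, g y - g z = (M y z).mulVec (y - z))
    (hdet : ∀ x ∈ U, (M x x).det ≠ 0) : IsOpen (g '' U) := by
  rw [isOpen_iff_mem_nhds]
  rintro _ ⟨x, hx, rfl⟩
  borelize F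
  obtain ⟨ρ, hρ, h⟩ := exists_good_closedBall p hU hM hg hx (hdet x hx)
  obtain ⟨hBU, -, ho, -⟩ := h ρ hρ le_rfl
  exact Filter.mem_of_superset
    (ho.mem_nhds (Set.mem_image_of_mem g (Metric.mem_closedBall_self hρ.le))) (Set.image_mono hBU)

/-- An open set each point of which has arbitrarily small "good" balls is a countable disjoint union
of good balls. -/
theorem exists_countable_partition_closedBall {V : Type*} [PseudoMetricSpace V]
    [IsUltrametricDist V] [TopologicalSpace.SeparableSpace V] {U : Set V} (good : Set V → Prop)
    (h : ∀ x ∈ U, ∃ ρ₀ > 0, ∀ ρ, 0 < ρ → ρ ≤ ρ₀ →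
      Metric.closedBall x ρ ⊆ U ∧ good (Metric.closedBall x ρ)) :
    ∃ P : Set (Set V), P.Countable ∧ P.PairwiseDisjoint id ∧ ⋃₀ P = U ∧
      ∀ B ∈ P, good B ∧ IsClosed B := by
  classical
  have hex : ∀ x : U, ∃ k : ℕ, Metric.closedBall (x : V) (2⁻¹ ^ k) ⊆ U ∧
      good (Metric.closedBall (x : V) (2⁻¹ ^ k)) := by
    rintro ⟨x, hx⟩
    obtain ⟨ρ₀, hρ₀, hr⟩ := h x hx
    obtain ⟨k, hk⟩ := exists_pow_lt_of_lt_one hρ₀ (by norm_num : (2⁻¹ : ℝ) < 1)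
    exact ⟨k, hr _ (by positivity) hk.le⟩
  -- The least exponent gives the largest good ball among the radii 2⁻ᵏ. Two such balls that meet
  -- are nested, hence concentric at a common point, and maximality makes them equal.
  let κ : U → ℕ := fun x => Nat.find (hex x)
  let ball : U → Set V := fun x => Metric.closedBall (x : V) (2⁻¹ ^ κ x)
  have hκ : ∀ x : U, ball x ⊆ U ∧ good (ball x) := fun x => Nat.find_spec (hex x)
  have hmem : ∀ x : U, (x : V) ∈ ball x := fun x => Metric.mem_closedBall_self (by positivity)
  have heq : ∀ x y : U, κ x ≤ κ y → (ball x ∩ ball y).Nonempty → ball x = ball y := by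
    rintro x y hxy ⟨z, hzx, hzy⟩
    have e1 : Metric.closedBall (y : V) (2⁻¹ ^ κ y) = Metric.closedBall z (2⁻¹ ^ κ y) :=
      (IsUltrametricDist.closedBall_eq_of_mem hzy)
    have e2 : ball x = Metric.closedBall z (2⁻¹ ^ κ x) := IsUltrametricDist.closedBall_eq_of_mem hzx
    have hle : (2⁻¹ : ℝ) ^ κ y ≤ 2⁻¹ ^ κ x := pow_le_pow_of_le_one (by norm_num) (by norm_num) hxy
    have hyx : (y : V) ∈ ball x := by
      rw [e2]
      have : (y : V) ∈ Metric.closedBall z (2⁻¹ ^ κ y) := by rw [← e1]; exact hmem y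
      exact Metric.closedBall_subset_closedBall hle this
    have e3 : ball x = Metric.closedBall (y : V) (2⁻¹ ^ κ x) :=
      IsUltrametricDist.closedBall_eq_of_mem hyx
    have hle2 : κ y ≤ κ x := Nat.find_min' (hex y) (by rw [← e3]; exact hκ x)
    rw [e3, le_antisymm hxy hle2]
  have hdisj : (Set.range ball).PairwiseDisjoint id := by
    rintro _ ⟨x, rfl⟩ _ ⟨y, rfl⟩ hne
    by_contra hnd
    rw [Function.onFun, Set.not_disjoint_iff_nonempty_inter] at hnd
    rcases le_total (κ x) (κ y) with hle | hle
    · exact hne (heq x y hle hnd)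
    · exact hne (heq y x hle (by rwa [Set.inter_comm] at hnd)).symm
  refine ⟨Set.range ball, ?_, hdisj, ?_, ?_⟩
  · refine hdisj.countable_of_isOpen ?_ ?_
    · rintro _ ⟨x, rfl⟩
      exact IsUltrametricDist.isOpen_closedBall _ (by positivity)
    · rintro _ ⟨x, rfl⟩
      exact ⟨x, hmem x⟩
  · ext z
    simp only [Set.mem_sUnion, Set.mem_range, exists_exists_eq_and]
    exact ⟨fun ⟨x, hx⟩ => (hκ x).1 hx, fun hz => ⟨⟨z, hz⟩, hmem ⟨z, hz⟩⟩⟩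
  · rintro _ ⟨x, rfl⟩
    exact ⟨(hκ x).2, Metric.isClosed_closedBall⟩

/-- Each solution of g x = w lies in exactly one piece and each piece holds at most one solution, so
solutions correspond to the pieces whose image contains w. -/
theorem tsum_indicator_image_eq_encard {V W : Type*} {P : Set (Set V)} {U : Set V} {g : V → W}
    (hd : P.PairwiseDisjoint id) (hP : ⋃₀ P = U) (hinj : ∀ B ∈ P, Set.InjOn g B) (w : W) :
    ∑' B : P, (g '' (B : Set V)).indicator (fun _ => (1 : ℝ≥0∞)) w =
      ({x ∈ U | g x = w}.encard : ℝ≥0∞) := by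
  have e1 : ∀ B : P, (g '' (B : Set V)).indicator (fun _ => (1 : ℝ≥0∞)) w =
      ({B : P | w ∈ g '' (B : Set V)}).indicator (fun _ => (1 : ℝ≥0∞)) B := by
    intro B; rfl
  rw [tsum_congr e1, ← tsum_subtype, ENNReal.tsum_set_one]
  suffices h : {x ∈ U | g x = w}.encard = {B : P | w ∈ g '' (B : Set V)}.encard by rw [h]
  have hsub : ∀ x ∈ {x ∈ U | g x = w}, ∃ B : P, x ∈ (B : Set V) := by
    rintro x ⟨hx, -⟩
    rw [← hP] at hx
    obtain ⟨B, hB, hxB⟩ := hx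
    exact ⟨⟨B, hB⟩, hxB⟩
  refine Set.encard_congr ?_
  refine Equiv.ofBijective (fun x => ⟨(hsub x.1 x.2).choose, x.1, (hsub x.1 x.2).choose_spec, x.2.2⟩)
    ⟨?_, ?_⟩
  · rintro ⟨x, hx⟩ ⟨y, hy⟩ hxy
    have hc : (hsub x hx).choose = (hsub y hy).choose := congrArg Subtype.val hxy
    have hxB := (hsub x hx).choose_spec
    have hyB := (hsub y hy).choose_spec
    rw [← hc] at hyB
    exact Subtype.ext (hinj _ (hsub x hx).choose.2 hxB hyB (hx.2.trans hy.2.symm))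
  · rintro ⟨B, x, hxB, hxw⟩
    have hx : x ∈ {x ∈ U | g x = w} := ⟨by rw [← hP]; exact ⟨B, B.2, hxB⟩, hxw⟩
    refine ⟨⟨x, hx⟩, Subtype.ext ?_⟩
    by_contra hne
    exact Set.disjoint_left.1 (hd (hsub x hx).choose.2 B.2 fun h => hne (Subtype.ext h))
      (hsub x hx).choose_spec hxB

variable (p) in
/-- The area formula for locally invertible strictly differentiable maps. -/
theorem lintegral_absF_det_eq_lintegral_encard {U : Set (ι → F)} (hU : IsOpen U)
    {g : (ι → F) → ι → F} {M : (ι → F) → (ι → F) → Matrix ι ι F}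
    (hM : ContinuousOn M.uncurry (U ×ˢ U))
    (hg : ∀ y ∈ U, ∀ z ∈ U, g y - g z = (M y z).mulVec (y - z))
    (hdet : ∀ x ∈ U, (M x x).det ≠ 0) :
    ∫⁻ x in U, absF p (M x x).det ∂(haarPi p F ι) =
      ∫⁻ y, ({x ∈ U | g x = y}.encard : ℝ≥0∞) ∂(haarPi p F ι) := by
  have := properSpace_base p F
  have hu := ultrametric_base p F
  obtain ⟨P, hPc, hPd, hPU, hPg⟩ := exists_countable_partition_closedBall (U := U)
    (fun B => Set.InjOn g B ∧ IsOpen (g '' B) ∧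
      haarPi p F ι (g '' B) = ∫⁻ y in B, absF p (M y y).det ∂(haarPi p F ι))
    (fun x hx => exists_good_closedBall p hU hM hg hx (hdet x hx))
  have := hPc.to_subtype
  calc ∫⁻ x in U, absF p (M x x).det ∂(haarPi p F ι)
      = ∑' B : P, ∫⁻ x in (B : Set _), absF p (M x x).det ∂(haarPi p F ι) := by
        rw [← hPU, Set.sUnion_eq_iUnion, lintegral_iUnion
          (fun B => (hPg _ B.2).2.measurableSet)]
        intro B C hBC
        exact hPd B.2 C.2 (fun h => hBC (Subtype.ext h))
    _ = ∑' B : P, haarPi p F ι (g '' (B : Set _)) :=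
        tsum_congr fun B => (hPg _ B.2).1.2.2.symm
    _ = ∑' B : P, ∫⁻ y, (g '' (B : Set _)).indicator (fun _ => 1) y ∂(haarPi p F ι) :=
        tsum_congr fun B => (lintegral_indicator_one (hPg _ B.2).1.2.1.measurableSet).symm
    _ = ∫⁻ y, ∑' B : P, (g '' (B : Set _)).indicator (fun _ => 1) y ∂(haarPi p F ι) :=
        (lintegral_tsum fun B =>
          (measurable_const.indicator (hPg _ B.2).1.2.1.measurableSet).aemeasurable).symm
    _ = _ := lintegral_congr fun y =>
        tsum_indicator_image_eq_encard hPd hPU (fun B hB => (hPg B hB).1.1) y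

end AreaFormula

/-! ## The ring of integers -/

section Integers

variable (p : ℕ) [Fact p.Prime] (F : Type*) [NormedField F] [NormedAlgebra ℚ_[p] F]

instance isFractionRing_ringOfIntegers : IsFractionRing (ringOfIntegers p F) F := by
  refine IsFractionRing.of_field (ringOfIntegers p F) F fun z => ?_
  by_cases hz : ‖z‖ ≤ 1
  · exact ⟨⟨z, hz⟩, 1, by simp; rfl⟩
  · refine ⟨1, ⟨z⁻¹, ?_⟩, ?_⟩
    · rw [mem_ringOfIntegers, norm_inv]
      exact inv_le_one_of_one_le₀ (not_le.1 hz).le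
    · change z = _ / z⁻¹
      simp

variable [FiniteDimensional ℚ_[p] F]

/-- A nonzero ideal contains a ball, so it is an open, hence closed, subgroup of the compact ring
𝒪_F. It therefore has an element of maximal norm, and this element divides all the others. -/
instance isPrincipalIdealRing_ringOfIntegers : IsPrincipalIdealRing (ringOfIntegers p F) := by
  have hprop := properSpace_base p F
  have hu := ultrametric_base p F
  refine ⟨fun I => ?_⟩
  by_cases hI : I = ⊥
  · subst hI; infer_instance
  obtain ⟨a, haI, ha0⟩ := Submodule.exists_mem_ne_zero_of_ne_bot hI
  let A : AddSubgroup F := I.toAddSubgroup.map (ringOfIntegers p F).subtype.toAddMonoidHom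
  have hA : ∀ x : F, x ∈ A ↔ ∃ h : x ∈ ringOfIntegers p F, (⟨x, h⟩ : ringOfIntegers p F) ∈ I := by
    intro x
    constructor
    · rintro ⟨y, hy, rfl⟩
      exact ⟨y.2, hy⟩
    · rintro ⟨h, hx⟩
      exact ⟨⟨x, h⟩, hx, rfl⟩
  have ha0' : (a : F) ≠ 0 := fun h => ha0 (Subtype.ext h)
  have hdiv : ∀ b ∈ I, ∀ x : ringOfIntegers p F, (b : F) ≠ 0 → ‖(x : F)‖ ≤ ‖(b : F)‖ →
      ∃ c : ringOfIntegers p F, x = c * b := by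
    intro b _ x hb hx
    refine ⟨⟨(x : F) / b, ?_⟩, Subtype.ext ?_⟩
    · rw [mem_ringOfIntegers, norm_div]
      exact div_le_one_of_le₀ hx (norm_nonneg _)
    · change (x : F) = (x : F) / b * b
      field_simp
  have hopen : IsOpen (A : Set F) := by
    refine AddSubgroup.isOpen_of_mem_nhds A (g := 0) ?_
    refine Filter.mem_of_superset (Metric.closedBall_mem_nhds 0 (norm_pos_iff.2 ha0')) ?_
    intro x hx
    rw [Metric.mem_closedBall, dist_zero_right] at hx
    have hxO : x ∈ ringOfIntegers p F := hx.trans a.2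
    obtain ⟨c, hc⟩ := hdiv a haI ⟨x, hxO⟩ ha0' hx
    exact (hA x).2 ⟨hxO, by rw [hc]; exact I.mul_mem_left c haI⟩
  have hcomp : IsCompact (A : Set F) :=
    (isCompact_ringOfIntegers p F).of_isClosed_subset (AddSubgroup.isClosed_of_isOpen A hopen)
      fun x hx => ((hA x).1 hx).1
  obtain ⟨b, hbA, hmax⟩ := hcomp.exists_isMaxOn ⟨0, A.zero_mem⟩ continuous_norm.continuousOn
  obtain ⟨hbO, hbI⟩ := (hA b).1 hbA
  have hb0 : b ≠ 0 := by
    rintro rfl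
    have := hmax ((hA a).2 ⟨a.2, haI⟩)
    simp only [Set.mem_ofPred_eq, norm_zero, norm_le_zero_iff] at this
    exact ha0' this
  refine ⟨⟨⟨b, hbO⟩, ?_⟩⟩
  apply le_antisymm
  · intro x hx
    obtain ⟨c, hc⟩ := hdiv _ hbI x hb0 (hmax ((hA x).2 ⟨x.2, hx⟩))
    exact Ideal.mem_span_singleton'.2 ⟨c, hc.symm⟩
  · rw [Submodule.span_singleton_le_iff_mem]
    exact hbI

theorem charZero_base (p : ℕ) [Fact p.Prime] (F : Type*) [NormedField F] [NormedAlgebra ℚ_[p] F] :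
    CharZero F := charZero_of_injective_algebraMap (algebraMap ℚ_[p] F).injective

end Integers

section EtaleIntegers

variable (p : ℕ) [Fact p.Prime] (F : Type*) [NormedField F] [NormedAlgebra ℚ_[p] F]
  [FiniteDimensional ℚ_[p] F] (E : Type*) [CommRing E] [Algebra F E] [Module.Finite F E]
  [Algebra.Etale F E]

/-- E is reduced and Artinian, so it is the product of its residue fields; 𝒪_E embeds in the product
of the integral closures in these fields, each finite over the Noetherian ring 𝒪_F because the
extensions are separable. -/
theorem finite_integersE : Module.Finite (ringOfIntegers p F) (integersE p F E) := by
  have := charZero_base p F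
  have : IsReduced E := Algebra.FormallyUnramified.isReduced_of_field F E
  have : IsArtinianRing E := IsArtinianRing.of_finite F E
  let K : MaximalSpectrum E → Type _ := fun m => E ⧸ m.asIdeal
  let φ : E →ₐ[ringOfIntegers p F] ∀ m, K m := AlgHom.pi fun m => Ideal.Quotient.mkₐ _ m.asIdeal
  have hφ : Function.Injective φ := by
    intro x y hxy
    apply (IsArtinianRing.equivPi E).injective
    ext m
    exact congrFun hxy m
  have hfin : ∀ m, Module.Finite (ringOfIntegers p F) (integralClosure (ringOfIntegers p F) (K m)) := by
    intro m
    let _ : Field (K m) := Ideal.Quotient.field m.asIdeal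
    have : FiniteDimensional F (K m) := inferInstanceAs (Module.Finite F (E ⧸ m.asIdeal))
    have : IsScalarTower (ringOfIntegers p F) F (K m) :=
      inferInstanceAs (IsScalarTower (ringOfIntegers p F) F (E ⧸ m.asIdeal))
    exact IsIntegralClosure.finite (ringOfIntegers p F) F (K m)
      (integralClosure (ringOfIntegers p F) (K m))
  let ψ : integersE p F E →ₗ[ringOfIntegers p F]
      ∀ m, integralClosure (ringOfIntegers p F) (K m) :=
    LinearMap.pi fun m =>
      { toFun := fun x => ⟨Ideal.Quotient.mkₐ (ringOfIntegers p F) m.asIdeal x.1, x.2.map _⟩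
        map_add' := fun x y => rfl
        map_smul' := fun c x => Subtype.ext (map_smul _ c x.1) }
  have hψ : Function.Injective ψ := by
    intro x y hxy
    apply Subtype.ext
    apply hφ
    ext m
    exact congrArg Subtype.val (congrFun hxy m)
  exact Module.Finite.of_injective ψ hψ

/-- A finite torsion-free module over a principal ideal domain is free, and an 𝒪_F-basis of 𝒪_E
spans E over F since every element of E has a nonzero integral multiple. -/
theorem exists_basis_integersE :
    ∃ (b : Module.Basis (Fin (Module.finrank F E)) (ringOfIntegers p F) (integersE p F E))
      (B : Module.Basis (Fin (Module.finrank F E)) F E), ∀ i, B i = (b i : E) := by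
  have := finite_integersE p F E
  have htf : Module.IsTorsionFree (ringOfIntegers p F) (integersE p F E) := by
    have h1 : Module.IsTorsionFree (ringOfIntegers p F) E :=
      Module.IsTorsionFree.trans_faithfulSMul (ringOfIntegers p F) F E
    infer_instance
  obtain ⟨n, b⟩ := Module.basisOfFiniteTypeTorsionFree' (R := ringOfIntegers p F)
    (M := integersE p F E)
  have hli : LinearIndependent (ringOfIntegers p F) fun i => ((b i : integersE p F E) : E) :=
    b.linearIndependent.map' (integersE p F E).val.toLinearMap
      (LinearMap.ker_eq_bot.2 Subtype.val_injective)
  have hliF : LinearIndependent F fun i => ((b i : integersE p F E) : E) :=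
    (LinearIndependent.iff_fractionRing (ringOfIntegers p F) F).1 hli
  have hspan : ⊤ ≤ Submodule.span F (Set.range fun i => ((b i : integersE p F E) : E)) := by
    intro x _
    have halg : IsAlgebraic (ringOfIntegers p F) x :=
      (IsFractionRing.isAlgebraic_iff (ringOfIntegers p F) F E).2
        (Algebra.IsAlgebraic.isAlgebraic (R := F) x)
    obtain ⟨y, hy, hint⟩ := halg.exists_integral_multiple
    have hy' : (y : F) ≠ 0 := fun h => hy (Subtype.ext h)
    have h1 : (⟨y • x, hint⟩ : integersE p F E) ∈ Submodule.span (ringOfIntegers p F) (Set.range b) :=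
      by rw [b.span_eq]; trivial
    have h2 : y • x ∈ Submodule.span F (Set.range fun i => ((b i : integersE p F E) : E)) := by
      have h3 := Submodule.mem_map_of_mem (f := (integersE p F E).val.toLinearMap) h1
      rw [Submodule.map_span, ← Set.range_comp] at h3
      exact Submodule.span_subset_span (ringOfIntegers p F) F _ h3
    have h4 : x = (y : F)⁻¹ • (y • x) := by
      change x = (y : F)⁻¹ • ((y : F) • x)
      rw [smul_smul, inv_mul_cancel₀ hy', one_smul]
    rw [h4]
    exact Submodule.smul_mem _ _ h2
  let B := Module.Basis.mk hliF hspan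
  have hn : n = Module.finrank F E := by
    rw [Module.finrank_eq_card_basis B, Fintype.card_fin]
  subst hn
  exact ⟨b, B, fun i => by simp [B]⟩

variable {p F E}

omit [FiniteDimensional ℚ_[p] F] [Module.Finite F E] [Algebra.Etale F E] in
theorem mem_integersE_iff {ι : Type*} [Fintype ι]
    {b : Module.Basis ι (ringOfIntegers p F) (integersE p F E)}
    {B : Module.Basis ι F E} (hB : ∀ i, B i = (b i : E)) (x : E) :
    x ∈ integersE p F E ↔ ∀ i, ‖B.repr x i‖ ≤ 1 := by
  constructor
  · intro hx i
    have h : x = ∑ j, ((b.repr ⟨x, hx⟩ j : ringOfIntegers p F) : F) • B j := by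
      conv_lhs => rw [show x = ((⟨x, hx⟩ : integersE p F E) : E) from rfl, ← b.sum_repr ⟨x, hx⟩]
      rw [AddSubmonoidClass.coe_finsetSum]
      refine Finset.sum_congr rfl fun j _ => ?_
      rw [hB]; rfl
    rw [h, B.repr_sum_self]
    exact (b.repr ⟨x, hx⟩ i).2
  · intro h
    rw [← B.sum_repr x]
    refine Subalgebra.sum_mem _ fun i _ => ?_
    rw [hB]
    exact Subalgebra.smul_mem _ (b i).2 (⟨B.repr x i, h i⟩ : ringOfIntegers p F)

omit [FiniteDimensional ℚ_[p] F] [Module.Finite F E] [Algebra.Etale F E] in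
-- The change of basis has a unit determinant, so the supremum in `absDiscr` is taken over equal
-- values.
theorem absF_discr_eq {ι : Type*} [Fintype ι] [DecidableEq ι]
    (b b' : Module.Basis ι (ringOfIntegers p F) (integersE p F E)) :
    absF p (Algebra.discr F fun i => (b i : E)) = absF p (Algebra.discr F fun i => (b' i : E)) := by
  let P : Matrix ι ι (ringOfIntegers p F) := b'.toMatrix b
  have hP : P * b.toMatrix b' = 1 := Module.Basis.toMatrix_mul_toMatrix_flip _ _
  have hdet : ‖((P.det : ringOfIntegers p F) : F)‖ = 1 := by
    have h1 := congrArg Matrix.det hP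
    rw [Matrix.det_mul, Matrix.det_one] at h1
    have h2 := congrArg (fun z : ringOfIntegers p F => ‖(z : F)‖) h1
    simp only [Subring.coe_mul, norm_mul, Subring.coe_one, norm_one] at h2
    have h3 : ‖((P.det : ringOfIntegers p F) : F)‖ ≤ 1 := P.det.2
    have h4 : ‖(((b.toMatrix b').det : ringOfIntegers p F) : F)‖ ≤ 1 := (b.toMatrix b').det.2
    refine le_antisymm h3 ?_
    rw [← h2]
    exact mul_le_of_le_one_right (norm_nonneg _) h4
  have h : (fun i => (b i : E)) = Matrix.vecMul (fun i => (b' i : E))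
      ((P.map (algebraMap (ringOfIntegers p F) F)).map (algebraMap F E)) := by
    ext i
    have h1 := b'.sum_toMatrix_smul_self b i
    have h2 := congrArg (fun z : integersE p F E => (z : E)) h1
    rw [← h2, AddSubmonoidClass.coe_finsetSum, Matrix.vecMul, dotProduct]
    refine Finset.sum_congr rfl fun j _ => ?_
    rw [mul_comm]
    change (P j i : F) • (b' j : E) = algebraMap F E (P j i : F) * _
    rw [Algebra.smul_def]
  have hmap : (P.map (algebraMap (ringOfIntegers p F) F)).det = ((P.det : ringOfIntegers p F) : F) := by
    change (((algebraMap (ringOfIntegers p F) F)).mapMatrix P).det = _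
    rw [← RingHom.map_det]
    rfl
  rw [h, Algebra.discr_of_matrix_vecMul, absF_mul, absF_pow, hmap,
    absF_eq_one_of_norm_eq_one p hdet, one_pow, one_mul]

omit [FiniteDimensional ℚ_[p] F] [Module.Finite F E] [Algebra.Etale F E] in
theorem absDiscr_eq {b : Module.Basis (Fin (Module.finrank F E)) (ringOfIntegers p F)
      (integersE p F E)} {B : Module.Basis (Fin (Module.finrank F E)) F E}
    (hB : ∀ i, B i = (b i : E)) : absDiscr p F E = absF p (Algebra.discr F B) := by
  have h : (B : Fin (Module.finrank F E) → E) = fun i => (b i : E) := funext hB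
  rw [h]
  refine le_antisymm (iSup_le fun b' => (absF_discr_eq b' b).le) ?_
  exact le_iSup (fun b' : Module.Basis (Fin (Module.finrank F E)) (ringOfIntegers p F)
    (integersE p F E) => absF p (Algebra.discr F fun i => (b' i : E))) b

end EtaleIntegers

open Polynomial

/-! ## Norm, trace and discriminant in terms of the roots of a minimal polynomial -/

section Embeddings

variable {F E L ι : Type*} [Field F] [CommRing E] [Algebra F E] [Field L] [Algebra F L]
  [Fintype ι] [DecidableEq ι] (b : Module.Basis ι F E) (σ : ι → E →ₐ[F] L)

/-- The matrix of values of `σ i` on the basis `b`. -/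
noncomputable def valueMatrix : Matrix ι ι L := Matrix.of fun i j => σ i (b j)

/-- Row i consists of the values of a ring homomorphism, so it is a left eigenvector of
multiplication by `y`, with eigenvalue σ i y. When the value matrix is invertible, norm, trace and
discriminant can be read off. -/
theorem valueMatrix_mul_leftMulMatrix (y : E) :
    valueMatrix b σ * (Algebra.leftMulMatrix b y).map (algebraMap F L) =
      Matrix.diagonal (fun i => σ i y) * valueMatrix b σ := by
  ext i k
  rw [Matrix.diagonal_mul, Matrix.mul_apply]
  simp only [valueMatrix, Matrix.of_apply, Matrix.map_apply, ← map_mul]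
  have h : ∑ j, Algebra.leftMulMatrix b y j k • b j = y * b k := by
    simp_rw [Algebra.leftMulMatrix_eq_repr_mul]
    exact b.sum_repr _
  rw [← h, map_sum]
  refine Finset.sum_congr rfl fun j _ => ?_
  rw [map_smul, Algebra.smul_def, mul_comm]

variable {b σ}

theorem leftMulMatrix_eq_conj (hS : (valueMatrix b σ).det ≠ 0) (y : E) :
    (Algebra.leftMulMatrix b y).map (algebraMap F L) =
      (valueMatrix b σ)⁻¹ * Matrix.diagonal (fun i => σ i y) * valueMatrix b σ := by
  rw [mul_assoc, ← valueMatrix_mul_leftMulMatrix, ← mul_assoc,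
    Matrix.nonsing_inv_mul _ (isUnit_iff_ne_zero.2 hS), one_mul]

theorem norm_eq_prod_values (hS : (valueMatrix b σ).det ≠ 0) (y : E) :
    algebraMap F L (Algebra.norm F y) = ∏ i, σ i y := by
  have h := congrArg Matrix.det (valueMatrix_mul_leftMulMatrix b σ y)
  rw [Matrix.det_mul, Matrix.det_mul, mul_comm, Matrix.det_diagonal] at h
  have h2 := mul_right_cancel₀ hS h
  rw [← h2, Algebra.norm_eq_matrix_det b, RingHom.map_det]
  rfl

theorem trace_eq_sum_values (hS : (valueMatrix b σ).det ≠ 0) (y : E) :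
    algebraMap F L (Algebra.trace F E y) = ∑ i, σ i y := by
  rw [Algebra.trace_eq_matrix_trace b, ← Matrix.trace_diagonal]
  have h : algebraMap F L (Algebra.leftMulMatrix b y).trace =
      ((Algebra.leftMulMatrix b y).map (algebraMap F L)).trace := by
    simp [Matrix.trace]
  rw [h, leftMulMatrix_eq_conj hS, Matrix.trace_mul_cycle,
    Matrix.mul_nonsing_inv _ (isUnit_iff_ne_zero.2 hS), one_mul]

theorem discr_eq_det_valueMatrix_sq (hS : (valueMatrix b σ).det ≠ 0) :
    algebraMap F L (Algebra.discr F b) = (valueMatrix b σ).det ^ 2 := by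
  rw [Algebra.discr_def, RingHom.map_det]
  have h : (algebraMap F L).mapMatrix (Algebra.traceMatrix F b) =
      (valueMatrix b σ).transpose * valueMatrix b σ := by
    ext i j
    simp only [RingHom.mapMatrix_apply, Matrix.map_apply, Algebra.traceMatrix_apply,
      Algebra.traceForm_apply, Matrix.mul_apply, Matrix.transpose_apply, valueMatrix,
      Matrix.of_apply]
    rw [trace_eq_sum_values hS]
    simp
  rw [h, Matrix.det_mul, Matrix.det_transpose, sq]

end Embeddings

section NewElements

variable {F E : Type*} [Field F] [CommRing E] [Algebra F E] [Module.Finite F E]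

/-- The power basis of `E` given by an element which generates `E`. -/
noncomputable def newPowerBasis {x : E} (hx : Algebra.adjoin F {x} = ⊤) : PowerBasis F E :=
  (AdjoinRoot.powerBasis (minpoly.ne_zero (Algebra.IsIntegral.isIntegral (R := F) x))).map
    ((AlgEquiv.adjoinSingletonEquivAdjoinRootMinpoly F x).symm.trans
      ((Subalgebra.equivOfEq _ _ hx).trans Subalgebra.topEquiv))

theorem newPowerBasis_gen {x : E} (hx : Algebra.adjoin F {x} = ⊤) :
    (newPowerBasis hx).gen = x := by
  simp [newPowerBasis, AlgEquiv.adjoinSingletonEquivAdjoinRootMinpoly]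

theorem natDegree_minpoly_eq_finrank {x : E} (hx : Algebra.adjoin F {x} = ⊤) :
    (minpoly F x).natDegree = Module.finrank F E := by
  rw [(newPowerBasis hx).finrank]
  simp [newPowerBasis]

/-- The basis `1, x, …, x ^ (r - 1)` given by an element `x` which generates `E`. -/
noncomputable def newBasis {x : E} (hx : Algebra.adjoin F {x} = ⊤) :
    Module.Basis (Fin (Module.finrank F E)) F E :=
  (newPowerBasis hx).basis.reindex (finCongr (newPowerBasis hx).finrank.symm)

theorem newBasis_apply {x : E} (hx : Algebra.adjoin F {x} = ⊤) (i : Fin (Module.finrank F E)) :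
    newBasis hx i = x ^ (i : ℕ) := by
  simp [newBasis, newPowerBasis_gen]

theorem adjoin_eq_top_iff_det_ne_zero (B : Module.Basis (Fin (Module.finrank F E)) F E) (x : E) :
    Algebra.adjoin F {x} = ⊤ ↔
      (B.toMatrix fun j : Fin (Module.finrank F E) => x ^ (j : ℕ)).det ≠ 0 := by
  constructor
  · intro hx
    have h : (fun j : Fin (Module.finrank F E) => x ^ (j : ℕ)) = newBasis hx :=
      funext fun j => (newBasis_apply hx j).symm
    rw [h, ← B.det_apply]
    exact (B.isUnit_det (newBasis hx)).ne_zero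
  · intro h
    have h1 : IsUnit (B.det fun j : Fin (Module.finrank F E) => x ^ (j : ℕ)) := by
      rw [B.det_apply]; exact isUnit_iff_ne_zero.2 h
    obtain ⟨-, hspan⟩ := (B.is_basis_iff_det).2 h1
    rw [← top_le_iff]
    intro y _
    have hy : y ∈ Submodule.span F
      (Set.range fun j : Fin (Module.finrank F E) => x ^ (j : ℕ)) := by rw [hspan]; trivial
    have hle : Submodule.span F (Set.range fun j : Fin (Module.finrank F E) => x ^ (j : ℕ)) ≤
        Subalgebra.toSubmodule (Algebra.adjoin F {x}) := by
      rw [Submodule.span_le]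
      rintro _ ⟨j, rfl⟩
      exact pow_mem (Algebra.self_mem_adjoin_singleton F x) _
    exact hle hy

/-- The homomorphisms E → L sending x to the roots of its minimal polynomial have a Vandermonde
matrix as value matrix in the basis 1, x, …, x^(r-1), invertible because the roots are distinct. -/
theorem exists_roots_of_adjoin_eq_top {x : E} (hx : Algebra.adjoin F {x} = ⊤)
    (hsep : (minpoly F x).Separable) {L : Type*} [Field L] [Algebra F L]
    (hL : ((minpoly F x).map (algebraMap F L)).Splits) :
    ∃ α : Fin (Module.finrank F E) → L, Function.Injective α ∧
      (minpoly F x).map (algebraMap F L) = ∏ i, (X - C (α i)) ∧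
      (∀ Q : F[X], algebraMap F L (Algebra.norm F (aeval x Q)) = ∏ i, aeval (α i) Q) ∧
      algebraMap F L (Algebra.discr F fun j : Fin (Module.finrank F E) => x ^ (j : ℕ)) =
        (Matrix.vandermonde α).det ^ 2 := by
  classical
  set f := minpoly F x
  have hint : IsIntegral F x := Algebra.IsIntegral.isIntegral x
  have hf0 : f ≠ 0 := minpoly.ne_zero hint
  have hnd : (f.aroots L).Nodup := nodup_aroots_iff_of_splits hf0 hL |>.2 hsep
  have hcard : Multiset.card (f.aroots L) = Module.finrank F E := by
    rw [← natDegree_minpoly_eq_finrank hx, ← natDegree_map (algebraMap F L)]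
    exact hL.natDegree_eq_card_roots.symm
  have hcard2 : Fintype.card (Fin (Module.finrank F E)) =
      Fintype.card {a // a ∈ (f.aroots L).toFinset} := by
    rw [Fintype.card_fin, Fintype.card_coe, Multiset.toFinset_card_of_nodup hnd, hcard]
  let e := Fintype.equivOfCardEq hcard2
  let α : Fin (Module.finrank F E) → L := fun i => (e i : L)
  have hα : Function.Injective α := Subtype.val_injective.comp e.injective
  have hroot : ∀ i, aeval (α i) f = 0 := fun i => by
    have := (e i).2
    rw [Multiset.mem_toFinset, mem_aroots] at this
    exact this.2
  have hprod : f.map (algebraMap F L) = ∏ i, (X - C (α i)) := by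
    rw [hL.eq_prod_roots_of_monic ((minpoly.monic hint).map _)]
    rw [e.prod_comp fun a => (X - C (a : L)), Finset.prod_coe_sort (f.aroots L).toFinset
      fun a => X - C a, Finset.prod, Multiset.toFinset_val, hnd.dedup]
  let pb := newPowerBasis hx
  have hgen : pb.gen = x := newPowerBasis_gen hx
  let σ : Fin (Module.finrank F E) → E →ₐ[F] L := fun i =>
    pb.lift (α i) (by rw [hgen]; exact hroot i)
  have hσ : ∀ i, σ i x = α i := fun i => by
    have := pb.lift_gen (α i) (by rw [hgen]; exact hroot i)
    exact (congrArg (σ i) hgen).symm.trans this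
  have hV : valueMatrix (newBasis hx) σ = Matrix.vandermonde α := by
    ext i j
    simp [valueMatrix, newBasis_apply, hσ, Matrix.vandermonde_apply]
  have hdet : (valueMatrix (newBasis hx) σ).det ≠ 0 := by
    rw [hV]; exact Matrix.det_vandermonde_ne_zero_iff.2 hα
  refine ⟨α, hα, hprod, fun Q => ?_, ?_⟩
  · rw [norm_eq_prod_values hdet]
    refine Finset.prod_congr rfl fun i _ => ?_
    rw [← aeval_algHom_apply, hσ]
  · rw [← hV, ← discr_eq_det_valueMatrix_sq hdet]
    congr 2
    exact funext fun j => (newBasis_apply hx j).symm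

/-- Both sides are products of differences of roots: over pairs i < j, squared, and over ordered
pairs i ≠ j. The sign is left open because only absolute values are used later. -/
theorem discr_pow_eq_or_neg {x : E} (hx : Algebra.adjoin F {x} = ⊤)
    (hsep : (minpoly F x).Separable) :
    (Algebra.discr F fun j : Fin (Module.finrank F E) => x ^ (j : ℕ)) =
        Algebra.norm F (aeval x (derivative (minpoly F x))) ∨
    (Algebra.discr F fun j : Fin (Module.finrank F E) => x ^ (j : ℕ)) =
        -Algebra.norm F (aeval x (derivative (minpoly F x))) := by
  let L := (minpoly F x).SplittingField
  obtain ⟨α, hα, hprod, hN, hD⟩ := exists_roots_of_adjoin_eq_top hx hsep (L := L)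
    (SplittingField.splits _)
  have hder : ∀ i, aeval (α i) (derivative (minpoly F x)) = ∏ j ∈ {i}ᶜ, (α i - α j) := by
    intro i
    have : aeval (α i) (derivative (minpoly F x)) =
        (derivative ((minpoly F x).map (algebraMap F L))).eval (α i) := by
      rw [derivative_map, eval_map_algebraMap]
    rw [this, hprod, derivative_prod_finset]
    simp only [eval_finsetSum, derivative_X_sub_C, mul_one, eval_prod,
      eval_sub, eval_X, eval_C]
    rw [Finset.sum_eq_single i]
    · rw [Finset.compl_eq_univ_sdiff, Finset.sdiff_singleton_eq_erase]
    · intro j _ hj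
      exact Finset.prod_eq_zero (Finset.mem_erase.2 ⟨hj.symm, Finset.mem_univ i⟩) (sub_self _)
    · simp
  have hkey : ∏ i, ∏ j ∈ Finset.Ioi i, (α i - α j) * (α j - α i) =
      ∏ i, ∏ j ∈ {i}ᶜ, (α i - α j) := by
    have := Finset.prod_prod_Ioi_mul_eq_prod_prod_off_diag
      fun a b : Fin (Module.finrank F E) => (α b - α a)
    simpa using this
  have hsq : (Matrix.vandermonde α).det ^ 2 = (∏ i : Fin (Module.finrank F E), ∏ j ∈ Finset.Ioi i, (-1 : L)) *
      ∏ i, ∏ j ∈ Finset.Ioi i, (α i - α j) * (α j - α i) := by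
    rw [Matrix.det_vandermonde, ← Finset.prod_pow, ← Finset.prod_mul_distrib]
    refine Finset.prod_congr rfl fun i _ => ?_
    rw [← Finset.prod_pow, ← Finset.prod_mul_distrib]
    refine Finset.prod_congr rfl fun j _ => by ring
  rw [hkey] at hsq
  have hNf := hN (derivative (minpoly F x))
  simp_rw [hder] at hNf
  rw [← hNf] at hsq
  have hsq := hD.trans hsq
  have hsign : (∏ i : Fin (Module.finrank F E), ∏ j ∈ Finset.Ioi i, (-1 : L)) = 1 ∨
      (∏ i : Fin (Module.finrank F E), ∏ j ∈ Finset.Ioi i, (-1 : L)) = -1 := by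
    simp only [Finset.prod_const, Finset.prod_pow_eq_pow_sum]
    exact neg_one_pow_eq_or L _
  have hinj := (algebraMap F L).injective
  rcases hsign with h | h
  · left; apply hinj; rw [hsq, h, one_mul]
  · right; apply hinj; rw [hsq, h, map_neg, neg_one_mul]

theorem separable_minpoly_of_isReduced [CharZero F] [IsReduced E] (x : E) :
    (minpoly F x).Separable :=
  PerfectField.separable_iff_squarefree.2
    ((minpoly.isRadical F x).squarefree (minpoly.ne_zero (Algebra.IsIntegral.isIntegral x)))

end NewElements

/-! ## Gauss norms and heights -/

section Gauss

/-- The Gauss norm of a polynomial, the largest norm of a coefficient. -/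
noncomputable def gauss {F : Type*} [NormedField F] (f : F[X]) : ℝ :=
  f.gaussNorm (NormedField.toAbsoluteValue F) 1

variable {F : Type*} [NormedField F]

theorem norm_coeff_le_gauss (f : F[X]) (i : ℕ) : ‖f.coeff i‖ ≤ gauss f := by
  have := f.le_gaussNorm (NormedField.toAbsoluteValue F) zero_le_one i
  rwa [one_pow, mul_one] at this

theorem exists_gauss_eq (f : F[X]) : ∃ i, gauss f = ‖f.coeff i‖ := by
  obtain ⟨i, hi⟩ := f.exists_eq_gaussNorm (NormedField.toAbsoluteValue F) 1
  exact ⟨i, by rwa [one_pow, mul_one] at hi⟩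

theorem gauss_nonneg (f : F[X]) : 0 ≤ gauss f := gaussNorm_nonneg _ _ zero_le_one

theorem gauss_le_iff {f : F[X]} {c : ℝ} : gauss f ≤ c ↔ ∀ i, ‖f.coeff i‖ ≤ c := by
  refine ⟨fun h i => (norm_coeff_le_gauss f i).trans h, fun h => ?_⟩
  obtain ⟨i, hi⟩ := exists_gauss_eq f
  exact hi ▸ h i

theorem one_le_gauss_of_monic {f : F[X]} (hf : f.Monic) : 1 ≤ gauss f := by
  have := norm_coeff_le_gauss f f.natDegree
  rwa [hf.coeff_natDegree, norm_one] at this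

theorem gauss_one : gauss (1 : F[X]) = 1 := by
  unfold gauss
  rw [← C_1, gaussNorm_C]
  exact norm_one

theorem gauss_mul [hu : IsUltrametricDist F] (f g : F[X]) : gauss (f * g) = gauss f * gauss g :=
  gaussNorm_mul (v := NormedField.toAbsoluteValue F)
    (fun x y => IsUltrametricDist.norm_add_le_max x y) one_pos f g

theorem gauss_prod [IsUltrametricDist F] {ι : Type*} (s : Finset ι) (f : ι → F[X]) :
    gauss (∏ i ∈ s, f i) = ∏ i ∈ s, gauss (f i) := by
  classical
  induction s using Finset.induction_on with
  | empty => simp [gauss_one]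
  | insert a s ha ih => rw [Finset.prod_insert ha, Finset.prod_insert ha, gauss_mul, ih]

end Gauss

section SpectralField

/-- If s is the spectral norm of y and n the degree, then |c_i| ≤ s^(n-i) and |c_0| = s^n. So every
coefficient is bounded by the larger of the two extreme ones. -/
theorem gauss_minpoly {F K : Type*} [NontriviallyNormedField F] [CompleteSpace F]
    [IsUltrametricDist F] [Field K] [Algebra F K] [FiniteDimensional F K] (y : K) :
    gauss (minpoly F y) = max 1 ‖(minpoly F y).coeff 0‖ := by
  have hint : IsIntegral F y := Algebra.IsIntegral.isIntegral y
  set f := minpoly F y with hf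
  set n := f.natDegree
  have hn : 0 < n := minpoly.natDegree_pos hint
  apply le_antisymm
  · rw [gauss_le_iff]
    intro i
    rcases lt_trichotomy i n with hi | hi | hi
    · set s := spectralNorm F K y with hs
      have hs0 : 0 ≤ s := spectralNorm_nonneg y
      have hsn : s ^ n = ‖f.coeff 0‖ := by
        rw [hs, spectralNorm.spectralNorm_eq_norm_coeff_zero_rpow, ← hf, ← Real.rpow_natCast,
          ← Real.rpow_mul (norm_nonneg _), one_div, inv_mul_cancel₀, Real.rpow_one]
        exact_mod_cast hn.ne'
      have h1 : ‖f.coeff i‖ ^ (1 / ((n : ℝ) - i)) ≤ s := by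
        have := le_ciSup (spectralValueTerms_bddAbove f) i
        rwa [spectralValueTerms_of_lt_natDegree _ hi] at this
      have hni : (0 : ℝ) < (n : ℝ) - i := sub_pos.2 (by exact_mod_cast hi)
      have h2 : ‖f.coeff i‖ ≤ s ^ (n - i) := by
        have h3 := Real.rpow_le_rpow (by positivity) h1 hni.le
        rw [← Real.rpow_mul (norm_nonneg _), one_div, inv_mul_cancel₀ hni.ne', Real.rpow_one] at h3
        rwa [← Nat.cast_sub hi.le, Real.rpow_natCast] at h3
      refine h2.trans ?_
      rw [← hsn]
      rcases le_total s 1 with h | h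
      · exact (pow_le_one₀ hs0 h).trans (le_max_left _ _)
      · exact (pow_le_pow_right₀ h (Nat.sub_le _ _)).trans (le_max_right _ _)
    · subst hi
      rw [(minpoly.monic hint).coeff_natDegree, norm_one]
      exact le_max_left _ _
    · rw [coeff_eq_zero_of_natDegree_lt hi, norm_zero]
      exact zero_le_one.trans (le_max_left _ _)
  · exact max_le (one_le_gauss_of_monic (minpoly.monic hint)) (norm_coeff_le_gauss f 0)

theorem gauss_minpoly_eq_norm {F K : Type*} [NontriviallyNormedField F] [CompleteSpace F]
    [IsUltrametricDist F] [Field K] [Algebra F K] [FiniteDimensional F K] {y : K}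
    (hy : Algebra.adjoin F {y} = ⊤) : gauss (minpoly F y) = max 1 ‖Algebra.norm F y‖ := by
  rw [gauss_minpoly]
  have := Algebra.PowerBasis.norm_gen_eq_coeff_zero_minpoly (newPowerBasis hy)
  rw [newPowerBasis_gen] at this
  rw [this, norm_mul, norm_pow, norm_neg, norm_one, one_pow, one_mul]

end SpectralField

section Height

variable {F E : Type*} [Field F] [CommRing E] [Algebra F E] [Module.Finite F E]

omit [Module.Finite F E] in
theorem adjoin_quotient_eq_top {x : E} (hx : Algebra.adjoin F {x} = ⊤) (I : Ideal E) :
    Algebra.adjoin F {Ideal.Quotient.mk I x} = ⊤ := by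
  have h := congrArg (Subalgebra.map (Ideal.Quotient.mkₐ F I)) hx
  rw [AlgHom.map_adjoin_singleton, Algebra.map_top] at h
  rw [← (AlgHom.range_eq_top _).2 (Ideal.Quotient.mkₐ_surjective F I), ← h]
  rfl

/-- The product vanishes at x modulo every maximal ideal, hence is divisible by the minimal
polynomial of x; the degrees agree since E is the product of its residue fields. -/
theorem prod_minpoly_quotient [IsReduced E] [Fintype (MaximalSpectrum E)] {x : E}
    (hx : Algebra.adjoin F {x} = ⊤) :
    ∏ m : MaximalSpectrum E, minpoly F (Ideal.Quotient.mk m.asIdeal x) = minpoly F x := by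
  have : IsArtinianRing E := IsArtinianRing.of_finite F E
  have hint : IsIntegral F x := Algebra.IsIntegral.isIntegral x
  have hintm : ∀ m : MaximalSpectrum E, IsIntegral F (Ideal.Quotient.mk m.asIdeal x) :=
    fun m => Algebra.IsIntegral.isIntegral _
  have hmon : (∏ m : MaximalSpectrum E, minpoly F (Ideal.Quotient.mk m.asIdeal x)).Monic :=
    monic_prod_of_monic _ _ fun m _ => minpoly.monic (hintm m)
  let e : E ≃ₗ[F] ∀ m : MaximalSpectrum E, E ⧸ m.asIdeal :=
    { (IsArtinianRing.equivPi E).toRingEquiv with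
      map_smul' := fun c y => by
        ext m
        rfl }
  refine eq_of_monic_of_dvd_of_natDegree_le (minpoly.monic hint) hmon ?_ ?_
  · refine minpoly.dvd F x ?_
    apply e.injective
    rw [map_zero]
    ext m
    change Ideal.Quotient.mkₐ F m.asIdeal (aeval x _) = 0
    rw [← aeval_algHom_apply, map_prod]
    exact Finset.prod_eq_zero (Finset.mem_univ m) (minpoly.aeval F _)
  · rw [natDegree_prod_of_monic _ _ fun m _ => minpoly.monic (hintm m),
      natDegree_minpoly_eq_finrank hx, e.finrank_eq, Module.finrank_pi_fintype]
    refine Finset.sum_le_sum fun m _ => ?_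
    exact (natDegree_minpoly_eq_finrank (adjoin_quotient_eq_top hx _)).le

end Height

section HeightGauss

variable (p : ℕ) [Fact p.Prime] {F : Type*} [NormedField F] [NormedAlgebra ℚ_[p] F]
  [FiniteDimensional ℚ_[p] F] {E : Type*} [CommRing E] [Algebra F E] [Module.Finite F E]

/-- Each factor of the height is a power of the Gauss norm of the minimal polynomial of the
corresponding component of x, and the Gauss norm is multiplicative. -/
theorem height_eq_gauss [IsReduced E] {x : E} (hx : Algebra.adjoin F {x} = ⊤) :
    height p F x = ENNReal.ofReal (gauss (minpoly F x) ^ Module.finrank ℚ_[p] F) := by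
  have : IsArtinianRing E := IsArtinianRing.of_finite F E
  have := Fintype.ofFinite (MaximalSpectrum E)
  have hu := ultrametric_base p F
  have := properSpace_base p F
  unfold height
  rw [finprod_eq_prod_of_fintype, ← prod_minpoly_quotient hx, gauss_prod, ← Finset.prod_pow,
    ENNReal.ofReal_prod_of_nonneg fun m _ => pow_nonneg (gauss_nonneg _) _]
  refine Finset.prod_congr rfl fun m _ => ?_
  let _ : NontriviallyNormedField F := nontriviallyNormedBase p F
  let _ : Field (E ⧸ m.asIdeal) := Ideal.Quotient.field m.asIdeal
  have : FiniteDimensional F (E ⧸ m.asIdeal) := inferInstance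
  have h := gauss_minpoly_eq_norm (adjoin_quotient_eq_top hx m.asIdeal)
  have h2 : gauss (minpoly F (Ideal.Quotient.mk m.asIdeal x)) =
      max 1 ‖Algebra.norm F (Ideal.Quotient.mk m.asIdeal x)‖ := h
  rw [h2]
  unfold absF
  rcases le_total 1 ‖Algebra.norm F (Ideal.Quotient.mk m.asIdeal x)‖ with h3 | h3
  · rw [max_eq_right h3, max_eq_right]
    rw [← ENNReal.ofReal_one]
    exact ENNReal.ofReal_le_ofReal (one_le_pow₀ h3)
  · rw [max_eq_left h3, max_eq_left, one_pow, ENNReal.ofReal_one]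
    rw [← ENNReal.ofReal_one]
    exact ENNReal.ofReal_le_ofReal (pow_le_one₀ (norm_nonneg _) h3)

end HeightGauss

/-! ## The incidence variety of pairs (polynomial, new root) -/

section Incidence

variable {F E : Type*} [NormedField F] [CommRing E] [Algebra F E] {r : ℕ}
  (B : Module.Basis (Fin r) F E) (m : ℕ)

/-- The matrix of multiplication by the element with coordinates `v`. -/
noncomputable def mulMat (v : Fin r → F) : Matrix (Fin r) (Fin r) F :=
  Algebra.leftMulMatrix B (B.equivFun.symm v)

/-- The coordinates of the powers `x ^ (k + j)`, `j < l`, of the element with coordinates `v`. -/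
noncomputable def powMat (k l : ℕ) (v : Fin r → F) : Matrix (Fin r) (Fin l) F :=
  Matrix.of fun i j => B.equivFun (B.equivFun.symm v ^ (k + (j : ℕ))) i

theorem equivFun_mul (x y : E) :
    B.equivFun (x * y) = (Algebra.leftMulMatrix B x).mulVec (B.equivFun y) := by
  rw [Module.Basis.equivFun_apply, Module.Basis.equivFun_apply,
    Algebra.leftMulMatrix_mulVec_repr]

theorem mulMat_pow (v : Fin r → F) (k : ℕ) :
    mulMat B v ^ k = Algebra.leftMulMatrix B (B.equivFun.symm v ^ k) := by
  rw [mulMat, map_pow]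

theorem equivFun_pow (v : Fin r → F) (k : ℕ) :
    B.equivFun (B.equivFun.symm v ^ k) = (mulMat B v ^ k).mulVec (B.equivFun 1) := by
  rw [mulMat_pow, ← equivFun_mul, mul_one]

theorem continuous_mulMat : Continuous (mulMat B) := by
  have h : mulMat B = fun v => ∑ i, v i • Algebra.leftMulMatrix B (B i) := by
    ext1 v
    rw [mulMat, Module.Basis.equivFun_symm_apply, map_sum]
    simp
  rw [h]
  fun_prop

theorem continuous_powMat (k l : ℕ) : Continuous (powMat B k l) := by
  refine continuous_matrix fun i j => ?_
  have h : (fun v => powMat B k l v i j) =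
      fun v => (mulMat B v ^ (k + (j : ℕ))).mulVec (B.equivFun 1) i := by
    ext v
    rw [powMat, Matrix.of_apply, equivFun_pow]
  rw [h]
  have := continuous_mulMat B
  fun_prop

/-- The polynomial of degree less than `r + m` with the given coefficients, the first `r` of which
are put apart. -/
noncomputable def sumPoly {m : ℕ} (u : Fin r ⊕ Fin m → F) : F[X] :=
  polyOfCoeffs (u ∘ finSumFinEquiv.symm)

theorem aeval_polyOfCoeffs {n : ℕ} (a : Fin n → F) (x : E) :
    aeval x (polyOfCoeffs a) = ∑ i, a i • x ^ (i : ℕ) := by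
  simp [polyOfCoeffs, aeval_monomial, Algebra.smul_def]

theorem aeval_sumPoly (u : Fin r ⊕ Fin m → F) (x : E) :
    aeval x (sumPoly u) = ∑ j, u (.inl j) • x ^ (j : ℕ) + ∑ k, u (.inr k) • x ^ (r + (k : ℕ)) := by
  rw [sumPoly, aeval_polyOfCoeffs, Fin.sum_univ_add]
  simp

theorem equivFun_aeval_sumPoly (u : Fin r ⊕ Fin m → F) (v : Fin r → F) :
    B.equivFun (aeval (B.equivFun.symm v) (sumPoly u)) =
      (powMat B 0 r v).mulVec (u ∘ Sum.inl) + (powMat B r m v).mulVec (u ∘ Sum.inr) := by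
  rw [aeval_sumPoly, map_add, map_sum, map_sum]
  congr 1
  · ext i
    simp [Matrix.mulVec, dotProduct, powMat, mul_comm]
  · ext i
    simp [Matrix.mulVec, dotProduct, powMat, mul_comm]

/-- The polynomial with high coefficients `w ∘ inr` which vanishes at the element with coordinates
`w ∘ inl`. -/
noncomputable def rootMap (w : Fin r ⊕ Fin m → F) : Fin r ⊕ Fin m → F :=
  Sum.elim (-((powMat B 0 r (w ∘ Sum.inl))⁻¹.mulVec
    ((powMat B r m (w ∘ Sum.inl)).mulVec (w ∘ Sum.inr)))) (w ∘ Sum.inr)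

/-- The vanishing at x is a linear system for the low coefficients, with matrix `powMat B 0 r`; this
matrix is invertible exactly when x is new. -/
theorem rootMap_eq_iff {w : Fin r ⊕ Fin m → F} (hw : (powMat B 0 r (w ∘ Sum.inl)).det ≠ 0)
    (u : Fin r ⊕ Fin m → F) :
    rootMap B m w = u ↔
      w ∘ Sum.inr = u ∘ Sum.inr ∧ aeval (B.equivFun.symm (w ∘ Sum.inl)) (sumPoly u) = 0 := by
  have hunit := isUnit_iff_ne_zero.2 hw
  rw [← map_eq_zero_iff B.equivFun B.equivFun.injective, equivFun_aeval_sumPoly]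
  constructor
  · rintro rfl
    refine ⟨by simp [rootMap], ?_⟩
    simp only [rootMap, Sum.elim_comp_inl, Sum.elim_comp_inr]
    rw [Matrix.mulVec_neg, Matrix.mulVec_mulVec, Matrix.mul_nonsing_inv _ hunit, Matrix.one_mulVec,
      neg_add_cancel]
  · rintro ⟨h1, h2⟩
    have h3 : u ∘ Sum.inl = -((powMat B 0 r (w ∘ Sum.inl))⁻¹.mulVec
        ((powMat B r m (w ∘ Sum.inl)).mulVec (w ∘ Sum.inr))) := by
      rw [h1, ← Matrix.mulVec_neg, ← eq_neg_of_add_eq_zero_left h2, Matrix.mulVec_mulVec,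
        Matrix.nonsing_inv_mul _ hunit, Matrix.one_mulVec]
    rw [rootMap, ← h3, h1, Sum.elim_comp_inl_inr]

/-- The divided difference of `sumPoly u`, evaluated on commuting matrices. -/
noncomputable def divDiff {m : ℕ} (u : Fin r ⊕ Fin m → F) (A A' : Matrix (Fin r) (Fin r) F) :
    Matrix (Fin r) (Fin r) F :=
  ∑ i : Fin (r + m), u (finSumFinEquiv.symm i) •
    ∑ a ∈ Finset.range i, A ^ a * A' ^ ((i : ℕ) - 1 - a)

theorem divDiff_mulVec (u : Fin r ⊕ Fin m → F) (v v' : Fin r → F) :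
    (divDiff u (mulMat B v) (mulMat B v')).mulVec (v - v') =
      B.equivFun (aeval (B.equivFun.symm v) (sumPoly u)) -
        B.equivFun (aeval (B.equivFun.symm v') (sumPoly u)) := by
  have h : divDiff u (mulMat B v) (mulMat B v') =
      Algebra.leftMulMatrix B (∑ i : Fin (r + m), u (finSumFinEquiv.symm i) •
        ∑ a ∈ Finset.range i,
          B.equivFun.symm v ^ a * B.equivFun.symm v' ^ ((i : ℕ) - 1 - a)) := by
    simp [divDiff, mulMat, map_sum, map_mul, map_pow]
  have h2 : v - v' = B.equivFun (B.equivFun.symm v - B.equivFun.symm v') := by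
    rw [← map_sub, LinearEquiv.apply_symm_apply]
  rw [h, h2, ← equivFun_mul, ← map_sub B.equivFun, sumPoly, aeval_polyOfCoeffs, aeval_polyOfCoeffs,
    Finset.sum_mul, ← Finset.sum_sub_distrib]
  congr 1
  refine Finset.sum_congr rfl fun i _ => ?_
  rw [smul_mul_assoc, geom_sum₂_mul, smul_sub]
  rfl

theorem det_divDiff_self (u : Fin r ⊕ Fin m → F) (v : Fin r → F) :
    (divDiff u (mulMat B v) (mulMat B v)).det =
      Algebra.norm F (aeval (B.equivFun.symm v) (derivative (sumPoly u))) := by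
  rw [Algebra.norm_eq_matrix_det B]
  congr 1
  simp only [divDiff, mulMat, geom_sum₂_self, sumPoly, polyOfCoeffs,
    derivative_monomial, map_sum, aeval_monomial, map_mul, map_pow]
  refine Finset.sum_congr rfl fun i _ => ?_
  simp only [Function.comp, map_natCast, AlgHom.commutes, Algebra.smul_def]
  rw [mul_assoc]

theorem continuous_divDiff : Continuous fun q : (Fin r ⊕ Fin m → F) ×
    Matrix (Fin r) (Fin r) F × Matrix (Fin r) (Fin r) F => divDiff q.1 q.2.1 q.2.2 := by
  unfold divDiff
  fun_prop

/-- The difference quotients of `rootMap`. -/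
noncomputable def rootMapQuot (w w' : Fin r ⊕ Fin m → F) :
    Matrix (Fin r ⊕ Fin m) (Fin r ⊕ Fin m) F :=
  Matrix.fromBlocks
    (-((powMat B 0 r (w ∘ Sum.inl))⁻¹ *
      divDiff (rootMap B m w') (mulMat B (w ∘ Sum.inl)) (mulMat B (w' ∘ Sum.inl))))
    (-((powMat B 0 r (w ∘ Sum.inl))⁻¹ * powMat B r m (w ∘ Sum.inl))) 0 1

/-- Both low coefficient vectors are compared through the linear system at the first root x. The
second polynomial vanishes at x', not at x; its value at x is a divided difference applied to x -
x', which yields the upper left block. -/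
theorem rootMap_sub_rootMap {w w' : Fin r ⊕ Fin m → F}
    (hw : (powMat B 0 r (w ∘ Sum.inl)).det ≠ 0) (hw' : (powMat B 0 r (w' ∘ Sum.inl)).det ≠ 0) :
    rootMap B m w - rootMap B m w' = (rootMapQuot B m w w').mulVec (w - w') := by
  have hunit := isUnit_iff_ne_zero.2 hw
  rw [rootMapQuot, Matrix.fromBlocks_mulVec]
  have hz := ((rootMap_eq_iff B m hw' _).1 rfl).2
  have h1 : (w - w') ∘ Sum.inl = w ∘ Sum.inl - w' ∘ Sum.inl := rfl
  have h2 : (w - w') ∘ Sum.inr = w ∘ Sum.inr - w' ∘ Sum.inr := rfl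
  have hr : ∀ w : Fin r ⊕ Fin m → F, rootMap B m w ∘ Sum.inr = w ∘ Sum.inr := fun w => by
    simp [rootMap]
  rw [Matrix.neg_mulVec, Matrix.neg_mulVec, ← Matrix.mulVec_mulVec, ← Matrix.mulVec_mulVec, h1,
    divDiff_mulVec, hz, map_zero, sub_zero, equivFun_aeval_sumPoly, hr, h2, Matrix.mulVec_add,
    Matrix.mulVec_mulVec, Matrix.nonsing_inv_mul _ hunit, Matrix.one_mulVec, Matrix.mulVec_sub,
    Matrix.mulVec_sub, Matrix.zero_mulVec, Matrix.one_mulVec, zero_add]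
  ext i
  rcases i with i | i
  · simp [rootMap]
    ring
  · simp [rootMap]

theorem continuousOn_powMat_inv : ContinuousOn (fun w : Fin r ⊕ Fin m → F =>
    (powMat B 0 r (w ∘ Sum.inl))⁻¹) {w | (powMat B 0 r (w ∘ Sum.inl)).det ≠ 0} := by
  have hc := continuous_powMat B 0 r
  have hc' : Continuous fun w : Fin r ⊕ Fin m → F => powMat B 0 r (w ∘ Sum.inl) :=
    hc.comp (by fun_prop)
  intro w hw
  simp only [Matrix.inv_def, Ring.inverse_eq_inv']
  refine ContinuousAt.continuousWithinAt ?_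
  exact ContinuousAt.smul (f := fun w : Fin r ⊕ Fin m → F => (powMat B 0 r (w ∘ Sum.inl)).det⁻¹)
    (g := fun w : Fin r ⊕ Fin m → F => (powMat B 0 r (w ∘ Sum.inl)).adjugate)
    (ContinuousAt.inv₀ hc'.matrix_det.continuousAt hw) hc'.matrix_adjugate.continuousAt

theorem isOpen_det_powMat_ne_zero : IsOpen {w : Fin r ⊕ Fin m → F |
    (powMat B 0 r (w ∘ Sum.inl)).det ≠ 0} := by
  have hc := continuous_powMat B 0 r
  have hc' : Continuous fun w : Fin r ⊕ Fin m → F => powMat B 0 r (w ∘ Sum.inl) :=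
    hc.comp (by fun_prop)
  exact isOpen_ne.preimage hc'.matrix_det

theorem continuousOn_rootMap : ContinuousOn (rootMap B m)
    {w | (powMat B 0 r (w ∘ Sum.inl)).det ≠ 0} := by
  have h1 := continuousOn_powMat_inv B m
  have h2 : Continuous fun w : Fin r ⊕ Fin m → F => powMat B r m (w ∘ Sum.inl) :=
    (continuous_powMat B r m).comp (by fun_prop)
  refine continuousOn_pi.2 fun i => ?_
  rcases i with i | i
  · simp only [rootMap, Sum.elim_inl]
    have h3 : ContinuousOn (fun w : Fin r ⊕ Fin m → F => (powMat B 0 r (w ∘ Sum.inl))⁻¹.mulVec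
      ((powMat B r m (w ∘ Sum.inl)).mulVec (w ∘ Sum.inr)))
        {w | (powMat B 0 r (w ∘ Sum.inl)).det ≠ 0} := by
      have h4 : Continuous fun q : Matrix (Fin r) (Fin r) F × (Fin r → F) => q.1.mulVec q.2 := by
        fun_prop
      exact h4.comp_continuousOn
        (h1.prodMk (h2.matrix_mulVec (by fun_prop : Continuous fun w : Fin r ⊕ Fin m → F =>
          w ∘ Sum.inr)).continuousOn)
    exact (continuousOn_pi.1 h3 i).neg
  · simp only [rootMap, Sum.elim_inr]
    fun_prop

theorem continuousOn_rootMapQuot : ContinuousOn (rootMapQuot B m).uncurry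
    ({w | (powMat B 0 r (w ∘ Sum.inl)).det ≠ 0} ×ˢ
      {w | (powMat B 0 r (w ∘ Sum.inl)).det ≠ 0}) := by
  have h1 := continuousOn_powMat_inv B m
  have h2 : Continuous fun w : Fin r ⊕ Fin m → F => powMat B r m (w ∘ Sum.inl) :=
    (continuous_powMat B r m).comp (by fun_prop)
  have h3 := continuousOn_rootMap B m
  have h4 : Continuous fun w : Fin r ⊕ Fin m → F => mulMat B (w ∘ Sum.inl) :=
    (continuous_mulMat B).comp (by fun_prop)
  have hmul : ∀ l, Continuous fun q : Matrix (Fin r) (Fin r) F × Matrix (Fin r) (Fin l) F =>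
      -(q.1 * q.2) := fun l => by fun_prop
  set S := {w : Fin r ⊕ Fin m → F | (powMat B 0 r (w ∘ Sum.inl)).det ≠ 0}
  have hf : Set.MapsTo Prod.fst (S ×ˢ S) S := fun q hq => hq.1
  have hs : Set.MapsTo Prod.snd (S ×ˢ S) S := fun q hq => hq.2
  have h5 : ContinuousOn (fun q : (Fin r ⊕ Fin m → F) × (Fin r ⊕ Fin m → F) =>
      (powMat B 0 r (q.1 ∘ Sum.inl))⁻¹) (S ×ˢ S) := h1.comp continuousOn_fst hf
  have h6 : ContinuousOn (fun q : (Fin r ⊕ Fin m → F) × (Fin r ⊕ Fin m → F) =>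
      divDiff (rootMap B m q.2) (mulMat B (q.1 ∘ Sum.inl)) (mulMat B (q.2 ∘ Sum.inl)))
        (S ×ˢ S) := by
    exact (continuous_divDiff m).comp_continuousOn
      (f := fun q : (Fin r ⊕ Fin m → F) × (Fin r ⊕ Fin m → F) => (rootMap B m q.2,
        mulMat B (q.1 ∘ Sum.inl), mulMat B (q.2 ∘ Sum.inl)))
      ((h3.comp continuousOn_snd hs).prodMk
        ((h4.comp continuous_fst).prodMk (h4.comp continuous_snd)).continuousOn)
  have h7 : ContinuousOn (fun q : (Fin r ⊕ Fin m → F) × (Fin r ⊕ Fin m → F) =>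
      -((powMat B 0 r (q.1 ∘ Sum.inl))⁻¹ *
        divDiff (rootMap B m q.2) (mulMat B (q.1 ∘ Sum.inl)) (mulMat B (q.2 ∘ Sum.inl))))
        (S ×ˢ S) :=
    (hmul r).comp_continuousOn (f := fun q : (Fin r ⊕ Fin m → F) × (Fin r ⊕ Fin m → F) =>
      ((powMat B 0 r (q.1 ∘ Sum.inl))⁻¹,
        divDiff (rootMap B m q.2) (mulMat B (q.1 ∘ Sum.inl)) (mulMat B (q.2 ∘ Sum.inl))))
      (h5.prodMk h6)
  have h8 : ContinuousOn (fun q : (Fin r ⊕ Fin m → F) × (Fin r ⊕ Fin m → F) =>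
      -((powMat B 0 r (q.1 ∘ Sum.inl))⁻¹ * powMat B r m (q.1 ∘ Sum.inl))) (S ×ˢ S) :=
    (hmul m).comp_continuousOn (f := fun q : (Fin r ⊕ Fin m → F) × (Fin r ⊕ Fin m → F) =>
      ((powMat B 0 r (q.1 ∘ Sum.inl))⁻¹, powMat B r m (q.1 ∘ Sum.inl)))
      (h5.prodMk (h2.comp continuous_fst).continuousOn)
  have hblocks : Continuous fun q : Matrix (Fin r) (Fin r) F × Matrix (Fin r) (Fin m) F =>
      Matrix.fromBlocks q.1 q.2 (0 : Matrix (Fin m) (Fin r) F) 1 :=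
    Continuous.matrix_fromBlocks continuous_fst continuous_snd continuous_const continuous_const
  exact hblocks.comp_continuousOn (h7.prodMk h8)

theorem det_rootMapQuot_self (w : Fin r ⊕ Fin m → F) :
    (rootMapQuot B m w w).det = (-1) ^ r * ((powMat B 0 r (w ∘ Sum.inl)).det⁻¹ *
      Algebra.norm F (aeval (B.equivFun.symm (w ∘ Sum.inl))
        (derivative (sumPoly (rootMap B m w))))) := by
  rw [rootMapQuot, Matrix.det_fromBlocks_zero₂₁, Matrix.det_one, mul_one, Matrix.det_neg,
    Matrix.det_mul, det_divDiff_self, Matrix.det_nonsing_inv, Ring.inverse_eq_inv',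
    Fintype.card_fin]

end Incidence

/-! ### Coefficient vectors -/

section Coefficients

variable {F : Type*} [NormedField F]

theorem coeff_polyOfCoeffs {n : ℕ} (a : Fin n → F) (i : ℕ) :
    (polyOfCoeffs a).coeff i = if h : i < n then a ⟨i, h⟩ else 0 := by
  simp only [polyOfCoeffs, finsetSum_coeff, coeff_monomial]
  split_ifs with h
  · rw [Finset.sum_eq_single ⟨i, h⟩]
    · simp
    · intro j _ hj
      exact if_neg fun h2 => hj (Fin.ext h2)
    · simp
  · refine Finset.sum_eq_zero fun j _ => if_neg ?_
    have := j.2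
    omega

theorem polyOfCoeffs_coeff {n : ℕ} {P : F[X]} (hP : P.degree < n) :
    polyOfCoeffs (fun i : Fin n => P.coeff i) = P := by
  ext i
  rw [coeff_polyOfCoeffs]
  split_ifs with h
  · rfl
  · exact (coeff_eq_zero_of_degree_lt (hP.trans_le (by exact_mod_cast not_lt.1 h))).symm

theorem degree_polyOfCoeffs_lt {n : ℕ} (a : Fin n → F) : (polyOfCoeffs a).degree < n := by
  rw [degree_lt_iff_coeff_zero]
  intro i hi
  rw [coeff_polyOfCoeffs, dif_neg (by omega)]

theorem gauss_polyOfCoeffs_le_iff {n : ℕ} (a : Fin n → F) {c : ℝ} (hc : 0 ≤ c) :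
    gauss (polyOfCoeffs a) ≤ c ↔ ∀ i, ‖a i‖ ≤ c := by
  rw [gauss_le_iff]
  constructor
  · intro h i
    have := h i
    rwa [coeff_polyOfCoeffs, dif_pos i.2] at this
  · intro h i
    rw [coeff_polyOfCoeffs]
    split_ifs with hi
    · exact h _
    · simpa using hc

theorem polyOfCoeffs_smul {n : ℕ} (c : F) (a : Fin n → F) :
    polyOfCoeffs (c • a) = C c * polyOfCoeffs a := by
  simp [polyOfCoeffs, Finset.mul_sum, C_mul_monomial]

theorem mem_cube_iff {ι : Type*} [Fintype ι] {u : ι → F} :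
    u ∈ Metric.closedBall (0 : ι → F) 1 ↔ ∀ i, ‖u i‖ ≤ 1 := by
  rw [Metric.mem_closedBall, dist_zero_right, pi_norm_le_iff_of_nonneg zero_le_one]

end Coefficients

/-! ### The area formula on the incidence variety -/

section AreaRootMap

variable (p : ℕ) [Fact p.Prime] {F : Type*} [NormedField F] [NormedAlgebra ℚ_[p] F]
  [FiniteDimensional ℚ_[p] F] [MeasurableSpace F] [BorelSpace F]
  {E : Type*} [CommRing E] [Algebra F E] {r : ℕ} (B : Module.Basis (Fin r) F E) (m : ℕ)

theorem det_powMat_ne_zero_iff {F : Type*} [NormedField F] [Algebra F E]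
    (B : Module.Basis (Fin r) F E) (v : Fin r → F) :
    (powMat B 0 r v).det ≠ 0 ↔ Algebra.adjoin F {B.equivFun.symm v} = ⊤ := by
  have hr : r = Module.finrank F E := by rw [Module.finrank_eq_card_basis B, Fintype.card_fin]
  subst hr
  have : Module.Finite F E := Module.Finite.of_basis B
  rw [adjoin_eq_top_iff_det_ne_zero B]
  have h : powMat B 0 (Module.finrank F E) v =
      B.toMatrix fun j : Fin (Module.finrank F E) => B.equivFun.symm v ^ (j : ℕ) := by
    ext i j
    simp [powMat, Module.Basis.toMatrix_apply]
  rw [h]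

/-- The open set of pairs (new element, high coefficients) on which `rootMap` is a local
isomorphism. -/
def regularSet : Set (Fin r ⊕ Fin m → F) :=
  {w | (powMat B 0 r (w ∘ Sum.inl)).det ≠ 0} ∩
    {w | Algebra.norm F (aeval (B.equivFun.symm (w ∘ Sum.inl))
        (derivative (sumPoly (rootMap B m w)))) ≠ 0}

omit [NormedAlgebra ℚ_[p] F] [FiniteDimensional ℚ_[p] F] [MeasurableSpace F] [BorelSpace F] in
theorem continuousOn_norm_derivative : ContinuousOn
    (fun w : Fin r ⊕ Fin m → F => Algebra.norm F (aeval (B.equivFun.symm (w ∘ Sum.inl))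
        (derivative (sumPoly (rootMap B m w)))))
    {w | (powMat B 0 r (w ∘ Sum.inl)).det ≠ 0} := by
  have h4 : Continuous fun w : Fin r ⊕ Fin m → F => mulMat B (w ∘ Sum.inl) :=
    (continuous_mulMat B).comp (by fun_prop)
  simp_rw [← det_divDiff_self]
  have h : ContinuousOn (fun w : Fin r ⊕ Fin m → F =>
      divDiff (rootMap B m w) (mulMat B (w ∘ Sum.inl)) (mulMat B (w ∘ Sum.inl)))
      {w | (powMat B 0 r (w ∘ Sum.inl)).det ≠ 0} :=
    (continuous_divDiff m).comp_continuousOn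
      (f := fun w : Fin r ⊕ Fin m → F => (rootMap B m w,
        mulMat B (w ∘ Sum.inl), mulMat B (w ∘ Sum.inl)))
      ((continuousOn_rootMap B m).prodMk (h4.prodMk h4).continuousOn)
  have hd : Continuous fun A : Matrix (Fin r) (Fin r) F => A.det := by fun_prop
  exact hd.comp_continuousOn h

omit [NormedAlgebra ℚ_[p] F] [FiniteDimensional ℚ_[p] F] [MeasurableSpace F] [BorelSpace F] in
theorem isOpen_regularSet : IsOpen (regularSet B m) :=
  (continuousOn_norm_derivative B m).isOpen_inter_preimage (isOpen_det_powMat_ne_zero B m)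
    isOpen_ne

omit [NormedAlgebra ℚ_[p] F] [FiniteDimensional ℚ_[p] F] [MeasurableSpace F] [BorelSpace F] in
theorem det_rootMapQuot_ne_zero {w : Fin r ⊕ Fin m → F} (hw : w ∈ regularSet B m) :
    (rootMapQuot B m w w).det ≠ 0 := by
  rw [det_rootMapQuot_self]
  exact mul_ne_zero (pow_ne_zero _ (neg_ne_zero.2 one_ne_zero))
    (mul_ne_zero (inv_ne_zero hw.1) hw.2)

omit [MeasurableSpace F] [BorelSpace F] in
include p in
theorem isOpen_image_rootMap : IsOpen (rootMap B m '' regularSet B m) :=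
  isOpen_image_of_det_ne_zero p (isOpen_regularSet B m)
    ((continuousOn_rootMapQuot B m).mono (Set.prod_mono (fun _ h => h.1) fun _ h => h.1))
    (fun _ hy _ hz => rootMap_sub_rootMap B m hy.1 hz.1) fun _ hx => det_rootMapQuot_ne_zero B m hx

omit [NormedAlgebra ℚ_[p] F] [FiniteDimensional ℚ_[p] F] [MeasurableSpace F] [BorelSpace F] in
-- Points of the fibre are the new roots of the polynomial; the nonvanishing of N(P'(x)) required by
-- `regularSet` is automatic when P is separable.
theorem encard_fiber_rootMap {u : Fin r ⊕ Fin m → F} (hu : (sumPoly u).Separable) :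
    {w ∈ regularSet B m | rootMap B m w = u}.encard = numNewRoots E (sumPoly u) := by
  unfold numNewRoots
  have himg : {x : E | aeval x (sumPoly u) = 0 ∧ Algebra.adjoin F {x} = ⊤} =
      (fun w : Fin r ⊕ Fin m → F => B.equivFun.symm (w ∘ Sum.inl)) ''
        {w ∈ regularSet B m | rootMap B m w = u} := by
    ext x
    constructor
    · rintro ⟨hx0, hx⟩
      let w : Fin r ⊕ Fin m → F := Sum.elim (B.equivFun x) (u ∘ Sum.inr)
      have hwx : B.equivFun.symm (w ∘ Sum.inl) = x := by
        simp only [w, Sum.elim_comp_inl, LinearEquiv.symm_apply_apply]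
      have hdet : (powMat B 0 r (w ∘ Sum.inl)).det ≠ 0 := by
        rw [det_powMat_ne_zero_iff, hwx]; exact hx
      have hroot : rootMap B m w = u := by
        rw [rootMap_eq_iff B m hdet, hwx]
        exact ⟨by simp [w], hx0⟩
      refine ⟨w, ⟨⟨hdet, ?_⟩, hroot⟩, hwx⟩
      rw [Set.mem_ofPred_eq, hroot, hwx]
      -- The Bézout identity aP + bP' = 1, evaluated at the root x, shows that P'(x) is a unit of E.
      obtain ⟨a, b, hab⟩ := hu
      have h1 := congrArg (aeval x) hab
      rw [map_add, map_mul, map_mul, hx0, mul_zero, zero_add, map_one] at h1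
      have h2 := congrArg (Algebra.norm F) h1
      rw [map_mul, map_one] at h2
      exact right_ne_zero_of_mul (h2 ▸ one_ne_zero)
    · rintro ⟨w, ⟨hw, hwu⟩, rfl⟩
      rw [rootMap_eq_iff B m hw.1] at hwu
      exact ⟨hwu.2, (det_powMat_ne_zero_iff B _).1 hw.1⟩
  rw [himg, Set.InjOn.encard_image]
  rintro w ⟨hw, hwu⟩ w' ⟨hw', hwu'⟩ h
  have h1 : w ∘ Sum.inl = w' ∘ Sum.inl := B.equivFun.symm.injective h
  rw [rootMap_eq_iff B m hw.1] at hwu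
  rw [rootMap_eq_iff B m hw'.1] at hwu'
  have h2 : w ∘ Sum.inr = w' ∘ Sum.inr := hwu.1.trans hwu'.1.symm
  ext i
  rcases i with i | i
  · exact congrFun h1 i
  · exact congrFun h2 i

/-- The Jacobian of `rootMap`. -/
noncomputable def rootJacobian (w : Fin r ⊕ Fin m → F) : ℝ≥0∞ :=
  absF p (Algebra.norm F (aeval (B.equivFun.symm (w ∘ Sum.inl))
    (derivative (sumPoly (rootMap B m w))))) * absF p (powMat B 0 r (w ∘ Sum.inl)).det⁻¹

omit [FiniteDimensional ℚ_[p] F] [MeasurableSpace F] [BorelSpace F] in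
theorem absF_det_rootMapQuot (w : Fin r ⊕ Fin m → F) :
    absF p (rootMapQuot B m w w).det = rootJacobian p B m w := by
  have h1 : absF p ((-1 : F) ^ r) = 1 := absF_eq_one_of_norm_eq_one p (by simp)
  rw [det_rootMapQuot_self, absF_mul, absF_mul, h1, one_mul, mul_comm]
  rfl

/-- The set of pairs (new element, high coefficients) whose polynomial has integral coefficients. -/
def integralPairs : Set (Fin r ⊕ Fin m → F) :=
  {w | (powMat B 0 r (w ∘ Sum.inl)).det ≠ 0} ∩ rootMap B m ⁻¹' Metric.closedBall 0 1

/-- The area formula applies on the regular pairs with integral polynomial. The remaining pairs of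
`integralPairs` have Jacobian zero, and almost all polynomials are separable, so that regular fibres
count all new roots. -/
theorem lintegral_numNewRoots (h : ∀ᵐ u ∂(haarPi p F (Fin r ⊕ Fin m)), (sumPoly u).Separable) :
    ∫⁻ u in Metric.closedBall 0 1, (numNewRoots E (sumPoly u) : ℝ≥0∞)
        ∂(haarPi p F (Fin r ⊕ Fin m)) =
      ∫⁻ w in integralPairs B m, rootJacobian p B m w ∂(haarPi p F (Fin r ⊕ Fin m)) := by
  have hu := ultrametric_base p F
  have hprop := properSpace_base p F
  have hcube : IsOpen (Metric.closedBall (0 : Fin r ⊕ Fin m → F) 1) :=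
    IsUltrametricDist.isOpen_closedBall _ one_ne_zero
  set U := regularSet B m ∩ rootMap B m ⁻¹' Metric.closedBall 0 1 with hU
  have hUo : IsOpen U :=
    ((continuousOn_rootMap B m).mono fun _ h => h.1).isOpen_inter_preimage (isOpen_regularSet B m)
      hcube
  have hIo : IsOpen (integralPairs B m) :=
    (continuousOn_rootMap B m).isOpen_inter_preimage (isOpen_det_powMat_ne_zero B m) hcube
  have harea := lintegral_absF_det_eq_lintegral_encard p hUo
    ((continuousOn_rootMapQuot B m).mono (Set.prod_mono (fun _ h => h.1.1) fun _ h => h.1.1))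
    (fun _ hy _ hz => rootMap_sub_rootMap B m hy.1.1 hz.1.1)
    fun _ hx => det_rootMapQuot_ne_zero B m hx.1
  simp_rw [absF_det_rootMapQuot] at harea
  have hUI : U ⊆ integralPairs B m := fun w hw => ⟨hw.1.1, hw.2⟩
  have hleft : ∫⁻ w in integralPairs B m, rootJacobian p B m w ∂(haarPi p F (Fin r ⊕ Fin m)) =
      ∫⁻ w in U, rootJacobian p B m w ∂(haarPi p F (Fin r ⊕ Fin m)) := by
    rw [← lintegral_indicator hIo.measurableSet, ← lintegral_indicator hUo.measurableSet]
    refine lintegral_congr fun w => ?_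
    by_cases hw : w ∈ U
    · rw [Set.indicator_of_mem hw, Set.indicator_of_mem (hUI hw)]
    · rw [Set.indicator_of_notMem hw]
      by_cases hw2 : w ∈ integralPairs B m
      · rw [Set.indicator_of_mem hw2, rootJacobian]
        have : Algebra.norm F (aeval (B.equivFun.symm (w ∘ Sum.inl))
            (derivative (sumPoly (rootMap B m w)))) = 0 := by
          by_contra h0
          exact hw ⟨⟨hw2.1, h0⟩, hw2.2⟩
        rw [this, absF_zero, zero_mul]
      · rw [Set.indicator_of_notMem hw2]
  rw [hleft, harea, ← lintegral_indicator hcube.measurableSet]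
  refine lintegral_congr_ae ?_
  filter_upwards [h] with u hsep
  by_cases huc : u ∈ Metric.closedBall (0 : Fin r ⊕ Fin m → F) 1
  · rw [Set.indicator_of_mem huc, ← encard_fiber_rootMap B m hsep]
    congr 2
    ext w
    constructor
    · rintro ⟨hw, rfl⟩
      exact ⟨⟨hw, huc⟩, rfl⟩
    · rintro ⟨hw, hwu⟩
      exact ⟨hw.1, hwu⟩
  · rw [Set.indicator_of_notMem huc]
    have : {w ∈ U | rootMap B m w = u} = ∅ := by
      rw [Set.eq_empty_iff_forall_notMem]
      rintro w ⟨hw, rfl⟩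
      exact huc hw.2
    rw [this]
    simp

end AreaRootMap

/-! ### The fibre above a fixed root: writing P = fQ -/

section Substitution

variable {F E : Type*} [NormedField F] [CommRing E] [Algebra F E] {r : ℕ}
  (B : Module.Basis (Fin r) F E) (m : ℕ)

/-- The matrix giving the coefficients of `X ^ r, …, X ^ (r + m - 1)` in the product of `f` and a
polynomial of degree less than `m`. -/
def topCoeffMat (r : ℕ) (f : F[X]) : Matrix (Fin m) (Fin m) F :=
  Matrix.of fun k j => if (j : ℕ) ≤ r + k then f.coeff (r + k - j) else 0

theorem topCoeffMat_mulVec {r : ℕ} (f : F[X]) (Q : Fin m → F) (k : Fin m) :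
    (topCoeffMat m r f).mulVec Q k = (f * polyOfCoeffs Q).coeff (r + k) := by
  simp only [polyOfCoeffs, Finset.mul_sum, finsetSum_coeff, Matrix.mulVec, dotProduct, topCoeffMat,
    Matrix.of_apply]
  refine Finset.sum_congr rfl fun j _ => ?_
  rw [← C_mul_X_pow_eq_monomial, ← mul_assoc, coeff_mul_X_pow']
  split_ifs
  · rw [coeff_mul_C]
  · rw [zero_mul]

/-- The matrix is upper triangular with the leading coefficient of f on the diagonal, so passing
from Q to the top coefficients of fQ preserves Haar measure. -/
theorem det_topCoeffMat {f : F[X]} (hf : f.Monic) : (topCoeffMat m f.natDegree f).det = 1 := by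
  rw [Matrix.det_of_isUpperTriangular]
  · refine Finset.prod_eq_one fun i _ => ?_
    simp [topCoeffMat, hf.coeff_natDegree]
  · intro i j hij
    have : (j : ℕ) < i := hij
    simp only [topCoeffMat, Matrix.of_apply]
    rw [if_pos (by omega), coeff_eq_zero_of_natDegree_lt (by omega)]

/-- The coefficients of a polynomial of degree less than `r + m`. -/
def coeffVec (r m : ℕ) (P : F[X]) : Fin r ⊕ Fin m → F := fun i => P.coeff (finSumFinEquiv i)

theorem sumPoly_coeffVec {P : F[X]} (hP : P.degree < (r + m : ℕ)) :
    sumPoly (coeffVec r m P) = P := by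
  rw [sumPoly]
  convert polyOfCoeffs_coeff hP using 2
  ext i
  simp [coeffVec]

variable {m}

/-- The polynomial fQ vanishes at x and has the prescribed top coefficients, and `rootMap` produces
the only such polynomial. Thus Q parametrizes the fibre above x. -/
theorem rootMap_topCoeffMat_mulVec {v : Fin r → F}
    (hv : Algebra.adjoin F {B.equivFun.symm v} = ⊤) (Q : Fin m → F) :
    rootMap B m (Sum.elim v ((topCoeffMat m r (minpoly F (B.equivFun.symm v))).mulVec Q)) =
        coeffVec r m (minpoly F (B.equivFun.symm v) * polyOfCoeffs Q) ∧
      sumPoly (coeffVec r m (minpoly F (B.equivFun.symm v) * polyOfCoeffs Q)) =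
        minpoly F (B.equivFun.symm v) * polyOfCoeffs Q := by
  have : Module.Finite F E := Module.Finite.of_basis B
  have hr : Module.finrank F E = r := by rw [Module.finrank_eq_card_basis B, Fintype.card_fin]
  set x := B.equivFun.symm v
  have hint : IsIntegral F x := Algebra.IsIntegral.isIntegral x
  have hdeg : (minpoly F x * polyOfCoeffs Q).degree < (r + m : ℕ) := by
    have h1 : (minpoly F x).degree = (r : ℕ) := by
      rw [degree_eq_natDegree (minpoly.ne_zero hint), natDegree_minpoly_eq_finrank hv, hr]
    rw [degree_mul, h1]
    have h2 := degree_polyOfCoeffs_lt Q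
    rw [Nat.cast_add]
    exact WithBot.add_lt_add_left (WithBot.natCast_ne_bot r) h2
  refine ⟨?_, sumPoly_coeffVec m hdeg⟩
  rw [rootMap_eq_iff B m (by rw [Sum.elim_comp_inl, det_powMat_ne_zero_iff]; exact hv),
    sumPoly_coeffVec m hdeg, Sum.elim_comp_inl, Sum.elim_comp_inr]
  refine ⟨?_, ?_⟩
  · ext k
    rw [topCoeffMat_mulVec]
    simp [coeffVec]
  · rw [map_mul, minpoly.aeval, zero_mul]

theorem coeffVec_mem_cube_iff {P : F[X]} (hP : sumPoly (coeffVec r m P) = P) :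
    coeffVec r m P ∈ Metric.closedBall 0 1 ↔ gauss P ≤ 1 := by
  rw [mem_cube_iff]
  conv_rhs => rw [← hP, sumPoly, gauss_polyOfCoeffs_le_iff _ zero_le_one]
  exact ⟨fun h i => h _, fun h i => by simpa using h (finSumFinEquiv i)⟩

end Substitution

/-! ### Integration over the fibres -/

section Tonelli

variable (p : ℕ) [Fact p.Prime] {F : Type*} [NormedField F] [NormedAlgebra ℚ_[p] F]
  [FiniteDimensional ℚ_[p] F] [MeasurableSpace F] [BorelSpace F]
  {E : Type*} [CommRing E] [Algebra F E] {r : ℕ} (B : Module.Basis (Fin r) F E) (m : ℕ)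

/-- The average of the absolute value of the norm of `Q(x)` for random `Q` of degree less
than `m`. -/
noncomputable def normAverage (m : ℕ) (x : E) : ℝ≥0∞ :=
  ∫⁻ Q in Metric.closedBall (0 : Fin m → F) 1,
    absF p (Algebra.norm F (aeval x (polyOfCoeffs Q))) ∂(haarPi p F (Fin m))

theorem normAverage_eq (m : ℕ) (x : E) : normAverage p (F := F) m x =
    ∫⁻ a : Fin m → F, absF p (Algebra.norm F (aeval x (polyOfCoeffs a))) ∂(coeffLaw p F m) := by
  rw [normAverage, coeffLaw, haarPi, closedBall_pi _ zero_le_one, Measure.restrict_pi_pi]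
  simp only [coe_ringOfIntegers, Pi.zero_apply]

/-- Substitute aQ for Q, where a is the inverse of a largest coefficient of f; the condition becomes
that Q is integral. The scaling of the measure on F^m contributes |a|^m, and N(a) = a^[E:F]
contributes the rest of the exponent. -/
theorem setLIntegral_gauss_le (x : E) [Module.Finite F E] {f : F[X]} (hf : f ≠ 0) (m : ℕ) :
    ∫⁻ Q, {Q : Fin m → F | gauss f * gauss (polyOfCoeffs Q) ≤ 1}.indicator
      (fun Q => absF p (Algebra.norm F (aeval x (polyOfCoeffs Q)))) Q ∂(haarPi p F (Fin m)) =
      ENNReal.ofReal (gauss f ^ Module.finrank ℚ_[p] F)⁻¹ ^ (m + Module.finrank F E) *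
        normAverage p (F := F) m x := by
  have hprop := properSpace_base p F
  obtain ⟨i, hi⟩ := exists_gauss_eq f
  have hfi : f.coeff i ≠ 0 := by
    intro h
    rw [h, norm_zero] at hi
    apply hf
    ext j
    have := norm_coeff_le_gauss f j
    rw [hi] at this
    simpa using this
  set a := (f.coeff i)⁻¹ with ha
  have ha0 : a ≠ 0 := inv_ne_zero hfi
  have hanorm : ‖a‖ = (gauss f)⁻¹ := by rw [ha, norm_inv, hi]
  have hgpos : 0 < gauss f := by rw [hi]; exact norm_pos_iff.2 hfi
  have haF : absF p a = ENNReal.ofReal (gauss f ^ Module.finrank ℚ_[p] F)⁻¹ := by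
    rw [absF, hanorm, inv_pow]
  have hdet : (Matrix.diagonal fun _ : Fin m => a).det = a ^ m := by
    simp
  have hmul : ∀ Q : Fin m → F, (Matrix.diagonal fun _ : Fin m => a).mulVec Q = a • Q := by
    intro Q
    ext j
    rw [Matrix.mulVec_diagonal]
    rfl
  rw [← lintegral_comp_mulVec p (Matrix.diagonal fun _ => a) (by rw [hdet]; exact pow_ne_zero _ ha0),
    hdet, absF_pow, ← haF, pow_add, mul_assoc]
  congr 1
  rw [normAverage, ← lintegral_const_mul' _ _ (ENNReal.pow_ne_top (absF_ne_top p a)),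
    ← lintegral_indicator Metric.isClosed_closedBall.measurableSet]
  refine lintegral_congr fun Q => ?_
  rw [hmul]
  have hmem : a • Q ∈ {Q : Fin m → F | gauss f * gauss (polyOfCoeffs Q) ≤ 1} ↔
      Q ∈ Metric.closedBall (0 : Fin m → F) 1 := by
    rw [mem_cube_iff, Set.mem_ofPred_eq, ← le_div_iff₀' hgpos, one_div,
      gauss_polyOfCoeffs_le_iff _ (by positivity)]
    refine forall_congr' fun j => ?_
    rw [Pi.smul_apply, smul_eq_mul, norm_mul, hanorm]
    exact mul_le_iff_le_one_right (by positivity)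
  by_cases hQ : Q ∈ Metric.closedBall (0 : Fin m → F) 1
  · rw [Set.indicator_of_mem hQ, Set.indicator_of_mem (hmem.2 hQ), polyOfCoeffs_smul, map_mul,
      map_mul, absF_mul, aeval_C, Algebra.norm_algebraMap, absF_pow]
  · rw [Set.indicator_of_notMem hQ, Set.indicator_of_notMem (mt hmem.1 hQ)]

/-- The density of new roots, in coordinates. -/
noncomputable def coordDensity (v : Fin r → F) : ℝ≥0∞ :=
  absF p (Algebra.discr F B) * absF p (powMat B 0 r v).det /
    height p F (B.equivFun.symm v) ^ (r + m) * normAverage p (F := F) m (B.equivFun.symm v)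

/-- After the substitution P = fQ the Jacobian is |N(f'(x))| |N(Q(x))| / |det|. The discriminant
formula turns |N(f'(x))| into |det|² |D_E|, which leaves one factor |det|; Gauss's lemma and
rescaling give the height. -/
theorem lintegral_fiber_rootJacobian [IsReduced E] {v : Fin r → F}
    (hv : (powMat B 0 r v).det ≠ 0) :
    ∫⁻ T, (integralPairs B m).indicator (rootJacobian p B m) (Sum.elim v T)
      ∂(haarPi p F (Fin m)) = coordDensity p B m v := by
  have hr : r = Module.finrank F E := by rw [Module.finrank_eq_card_basis B, Fintype.card_fin]
  have : Module.Finite F E := Module.Finite.of_basis B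
  have := charZero_base p F
  have hu := ultrametric_base p F
  have hadj := (det_powMat_ne_zero_iff B v).1 hv
  set x := B.equivFun.symm v with hx
  set f := minpoly F x with hf
  have hint : IsIntegral F x := Algebra.IsIntegral.isIntegral x
  have hfm : f.Monic := minpoly.monic hint
  have hnat : f.natDegree = r := by rw [hf, natDegree_minpoly_eq_finrank hadj, hr]
  have hdet : (topCoeffMat m r f).det = 1 := by rw [← hnat]; exact det_topCoeffMat m hfm
  have hJ : ∀ Q, (integralPairs B m).indicator (rootJacobian p B m)
      (Sum.elim v ((topCoeffMat m r f).mulVec Q)) =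
      absF p (Algebra.norm F (aeval x (derivative f))) * absF p (powMat B 0 r v).det⁻¹ *
        {Q : Fin m → F | gauss f * gauss (polyOfCoeffs Q) ≤ 1}.indicator
          (fun Q => absF p (Algebra.norm F (aeval x (polyOfCoeffs Q)))) Q := by
    intro Q
    obtain ⟨h1, h2⟩ := rootMap_topCoeffMat_mulVec B hadj Q
    rw [← hx, ← hf] at h1 h2
    have hmem : Sum.elim v ((topCoeffMat m r f).mulVec Q) ∈ integralPairs B m ↔
        Q ∈ {Q : Fin m → F | gauss f * gauss (polyOfCoeffs Q) ≤ 1} := by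
      rw [integralPairs, Set.mem_inter_iff, Set.mem_preimage, h1, coeffVec_mem_cube_iff h2,
        gauss_mul]
      exact and_iff_right (by rw [Set.mem_ofPred_eq, Sum.elim_comp_inl]; exact hv)
    by_cases hQ : Q ∈ {Q : Fin m → F | gauss f * gauss (polyOfCoeffs Q) ≤ 1}
    -- In the product rule for fQ the term f(x)Q'(x) vanishes.
    · rw [Set.indicator_of_mem hQ, Set.indicator_of_mem (hmem.2 hQ), rootJacobian, h1, h2,
        Sum.elim_comp_inl, ← hx, derivative_mul, map_add, map_mul, map_mul, hf, minpoly.aeval,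
        zero_mul, add_zero, map_mul, absF_mul]
      ring
    · rw [Set.indicator_of_notMem hQ, Set.indicator_of_notMem (mt hmem.1 hQ), mul_zero]
  rw [← lintegral_comp_mulVec p (topCoeffMat m r f) (by rw [hdet]; exact one_ne_zero), hdet,
    absF_one, one_mul]
  simp_rw [hJ]
  rw [lintegral_const_mul' _ _ (ENNReal.mul_ne_top (absF_ne_top p _) (absF_ne_top p _)),
    setLIntegral_gauss_le p x hfm.ne_zero, coordDensity, ← hx, height_eq_gauss p hadj, ← hr]
  have hdisc : absF p (Algebra.norm F (aeval x (derivative f))) =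
      absF p (powMat B 0 r v).det ^ 2 * absF p (Algebra.discr F B) := by
    have hpow : (fun j : Fin r => x ^ (j : ℕ)) = Matrix.vecMul (B : Fin r → E)
        ((powMat B 0 r v).map (algebraMap F E)) := by
      ext j
      rw [Matrix.vecMul, dotProduct]
      simp only [Matrix.map_apply, powMat, Matrix.of_apply, ← hx, zero_add]
      conv_lhs => rw [← B.sum_equivFun (x ^ (j : ℕ))]
      refine Finset.sum_congr rfl fun i _ => ?_
      rw [Algebra.smul_def, mul_comm]
    have hd : absF p (Algebra.discr F fun j : Fin r => x ^ (j : ℕ)) =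
        absF p (Algebra.norm F (aeval x (derivative f))) := by
      subst hr
      rcases discr_pow_eq_or_neg hadj (separable_minpoly_of_isReduced x) with h | h
      · rw [h]
      · rw [h, absF_neg]
    rw [← hd, hpow, Algebra.discr_of_matrix_vecMul, absF_mul, absF_pow]
  have hinv : absF p (powMat B 0 r v).det * absF p (powMat B 0 r v).det⁻¹ = 1 := by
    rw [← absF_mul, mul_inv_cancel₀ hv, absF_one]
  have hg : 0 < gauss f ^ Module.finrank ℚ_[p] F :=
    pow_pos (zero_lt_one.trans_le (one_le_gauss_of_monic hfm)) _
  rw [hdisc, ENNReal.ofReal_inv_of_pos hg, ENNReal.div_eq_inv_mul, ← ENNReal.inv_pow, add_comm m r]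
  calc _ = (absF p (powMat B 0 r v).det * absF p (powMat B 0 r v).det⁻¹) *
        (absF p (powMat B 0 r v).det * absF p (Algebra.discr F B) *
        ((ENNReal.ofReal (gauss f ^ Module.finrank ℚ_[p] F) ^ (r + m))⁻¹ *
          normAverage p (F := F) m x)) := by ring
    _ = _ := by rw [hinv]; ring

omit [FiniteDimensional ℚ_[p] F] [MeasurableSpace F] [BorelSpace F] in
theorem continuousOn_rootJacobian : ContinuousOn (rootJacobian p B m)
    {w | (powMat B 0 r (w ∘ Sum.inl)).det ≠ 0} := by
  have h1 : ContinuousOn (fun w : Fin r ⊕ Fin m → F => rootMapQuot B m w w)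
      {w | (powMat B 0 r (w ∘ Sum.inl)).det ≠ 0} :=
    (continuousOn_rootMapQuot B m).comp (f := fun w : Fin r ⊕ Fin m → F => (w, w))
      (continuous_id.prodMk continuous_id).continuousOn fun w hw => ⟨hw, hw⟩
  have h2 : Continuous fun A : Matrix (Fin r ⊕ Fin m) (Fin r ⊕ Fin m) F => A.det := by fun_prop
  have h3 : rootJacobian p B m = absF p ∘ (fun A : Matrix (Fin r ⊕ Fin m) (Fin r ⊕ Fin m) F =>
      A.det) ∘ fun w : Fin r ⊕ Fin m → F => rootMapQuot B m w w := by
    ext w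
    exact (absF_det_rootMapQuot p B m w).symm
  rw [h3]
  exact (continuous_absF p).comp_continuousOn (h2.comp_continuousOn h1)

theorem lintegral_haarPi_sum {ι κ : Type*} [Fintype ι] [Fintype κ] (f : (ι ⊕ κ → F) → ℝ≥0∞)
    (hf : AEMeasurable f (haarPi p F (ι ⊕ κ))) :
    ∫⁻ w, f w ∂(haarPi p F (ι ⊕ κ)) =
      ∫⁻ v, ∫⁻ T, f (Sum.elim v T) ∂(haarPi p F κ) ∂(haarPi p F ι) := by
  have hmp : MeasurePreserving (MeasurableEquiv.sumPiEquivProdPi fun _ : ι ⊕ κ => F).symm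
      ((haarPi p F ι).prod (haarPi p F κ)) (haarPi p F (ι ⊕ κ)) :=
    measurePreserving_sumPiEquivProdPi_symm fun _ : ι ⊕ κ => haarF p F
  have hS : ∀ q : (ι → F) × (κ → F),
      (MeasurableEquiv.sumPiEquivProdPi fun _ : ι ⊕ κ => F).symm q = Sum.elim q.1 q.2 := by
    intro q
    ext i
    rcases i with i | i <;> rfl
  rw [← hmp.lintegral_comp_emb (MeasurableEquiv.measurableEmbedding _)]
  have h := hf.comp_quasiMeasurePreserving hmp.quasiMeasurePreserving
  simp only [Function.comp_def, hS] at h ⊢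
  rw [lintegral_prod _ h]

theorem lintegral_integralPairs_eq [IsReduced E] :
    ∫⁻ w in integralPairs B m, rootJacobian p B m w ∂(haarPi p F (Fin r ⊕ Fin m)) =
      ∫⁻ v, coordDensity p B m v ∂(haarPi p F (Fin r)) := by
  have hu := ultrametric_base p F
  have hprop := properSpace_base p F
  have hcube : IsOpen (Metric.closedBall (0 : Fin r ⊕ Fin m → F) 1) :=
    IsUltrametricDist.isOpen_closedBall _ one_ne_zero
  have hIo : IsOpen (integralPairs B m) :=
    (continuousOn_rootMap B m).isOpen_inter_preimage (isOpen_det_powMat_ne_zero B m) hcube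
  have hcont := (continuousOn_rootJacobian p B m).mono fun w (hw : w ∈ integralPairs B m) => hw.1
  have hmeas : AEMeasurable ((integralPairs B m).indicator (rootJacobian p B m))
      (haarPi p F (Fin r ⊕ Fin m)) :=
    (aemeasurable_indicator_iff hIo.measurableSet).2 (hcont.aemeasurable hIo.measurableSet)
  rw [← lintegral_indicator hIo.measurableSet, lintegral_haarPi_sum p _ hmeas]
  refine lintegral_congr fun v => ?_
  -- Elements that are not new contribute nothing: no pair lies above them, and their coordinate
  -- density has the factor |det| = 0.
  by_cases hv : (powMat B 0 r v).det = 0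
  · have h0 : coordDensity p B m v = 0 := by
      rw [coordDensity, hv, absF_zero, mul_zero, ENNReal.zero_div, zero_mul]
    rw [h0, lintegral_eq_zero_iff' ?_]
    · refine Filter.Eventually.of_forall fun T => ?_
      refine Set.indicator_of_notMem ?_ _
      rintro ⟨h1, -⟩
      rw [Set.mem_ofPred_eq, Sum.elim_comp_inl] at h1
      exact h1 hv
    · refine (measurable_const (a := (0 : ℝ≥0∞))).aemeasurable.congr ?_
      refine Filter.Eventually.of_forall fun T => (Set.indicator_of_notMem ?_ _).symm
      rintro ⟨h1, -⟩
      rw [Set.mem_ofPred_eq, Sum.elim_comp_inl] at h1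
      exact h1 hv
  · exact lintegral_fiber_rootJacobian p B m hv

end Tonelli

/-! ### Almost all polynomials are separable -/

section Separable

variable (p : ℕ) [Fact p.Prime] {F : Type*} [NormedField F] [NormedAlgebra ℚ_[p] F]
  [FiniteDimensional ℚ_[p] F] [MeasurableSpace F] [BorelSpace F]

theorem measurePreserving_comp_equiv {ι κ : Type*} [Fintype ι] [Fintype κ] (e : ι ≃ κ) :
    MeasurePreserving (fun u : κ → F => u ∘ e) (haarPi p F κ) (haarPi p F ι) := by
  have h : MeasurePreserving _ (haarPi p F κ) (haarPi p F ι) :=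
    measurePreserving_piCongrLeft (fun _ : ι => haarF p F) e.symm
  convert h using 1
  ext u i
  have := Equiv.piCongrLeft_apply_apply (fun _ : ι => F) e.symm u (e i)
  rw [Equiv.symm_apply_apply] at this
  exact this.symm

theorem lintegral_comp_equiv {ι κ : Type*} [Fintype ι] [Fintype κ] (e : ι ≃ κ)
    (g : (ι → F) → ℝ≥0∞) :
    ∫⁻ u : κ → F, g (u ∘ e) ∂(haarPi p F κ) = ∫⁻ u, g u ∂(haarPi p F ι) := by
  refine (measurePreserving_comp_equiv p e).lintegral_comp_emb ?_ g
  convert (MeasurableEquiv.piCongrLeft (fun _ : ι => F) e.symm).measurableEmbedding using 1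
  ext u i
  have := Equiv.piCongrLeft_apply_apply (fun _ : ι => F) e.symm u (e i)
  rw [Equiv.symm_apply_apply] at this
  exact this.symm

/-- A common root α of c + P and Q over the algebraic closure forces c = -P(α), and Q has finitely
many roots. -/
theorem finite_setOf_not_isCoprime_add_C {K : Type*} [Field K] {P Q : K[X]} (hQ : Q ≠ 0) :
    {c : K | ¬ IsCoprime (C c + P) Q}.Finite := by
  have hfin : ((fun α : AlgebraicClosure K => -aeval α P) '' (Q.rootSet (AlgebraicClosure K))).Finite :=
    (Q.rootSet_finite _).image _
  refine (hfin.preimage (algebraMap K (AlgebraicClosure K)).injective.injOn).subset ?_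
  intro c hc
  rw [Set.mem_ofPred_eq, isCoprime_iff_aeval_ne_zero_of_isAlgClosed _ (AlgebraicClosure K)] at hc
  push Not at hc
  obtain ⟨α, h1, h2⟩ := hc
  refine ⟨α, (mem_rootSet_of_ne hQ).2 h2, ?_⟩
  rw [map_add, aeval_C] at h1
  exact (eq_neg_of_add_eq_zero_left h1).symm

/-- With fixed formal degrees the entries of the Sylvester matrix are continuous in the
coefficients. This makes the exceptional set closed, hence measurable, before Fubini is applied to
it. -/
theorem continuous_resultant_polyOfCoeffs {F : Type*} [NormedField F] (n k l : ℕ) :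
    Continuous fun a : Fin n → F =>
      resultant (polyOfCoeffs a) (derivative (polyOfCoeffs a)) k l := by
  have hc : ∀ i, Continuous fun a : Fin n → F => (polyOfCoeffs a).coeff i := by
    intro i
    simp_rw [coeff_polyOfCoeffs]
    split_ifs <;> fun_prop
  have hd : ∀ i, Continuous fun a : Fin n → F => (derivative (polyOfCoeffs a)).coeff i := by
    intro i
    simp_rw [coeff_derivative]
    exact (hc _).mul continuous_const
  unfold resultant
  refine Continuous.matrix_det (continuous_matrix fun i j => ?_)
  unfold sylvester
  refine j.addCases (fun j₁ => ?_) fun j₁ => ?_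
  · simp only [Matrix.of_apply, Fin.addCases_left]
    split_ifs
    · exact hd _
    · exact continuous_const
  · simp only [Matrix.of_apply, Fin.addCases_right]
    split_ifs
    · exact hc _
    · exact continuous_const

theorem separable_of_resultant_ne_zero {K : Type*} [Field K] [CharZero K] {n : ℕ}
    {P : K[X]} (hP : P.natDegree = n + 1)
    (h : resultant P (derivative P) (n + 1) n ≠ 0) : P.Separable := by
  have h0 : P ≠ 0 := by rintro rfl; simp at hP
  have h1 : (derivative P).natDegree = n := by rw [natDegree_derivative, hP]; rfl
  by_contra h3
  have h2 := resultant_eq_zero_iff.2 ⟨.inl h0, h3⟩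
  rw [hP, h1] at h2
  exact h h2

theorem resultant_ne_zero_of_separable {K : Type*} [Field K] [CharZero K] {n : ℕ}
    {P : K[X]} (hP : P.natDegree = n + 1) (h : P.Separable) :
    resultant P (derivative P) (n + 1) n ≠ 0 := by
  have h1 : (derivative P).natDegree = n := by rw [natDegree_derivative, hP]; rfl
  have := resultant_ne_zero _ _ h
  rwa [hP, h1] at this

theorem natDegree_polyOfCoeffs {F : Type*} [NormedField F] {n : ℕ} {a : Fin (n + 1) → F} (ha : a (Fin.last n) ≠ 0) :
    (polyOfCoeffs a).natDegree = n := by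
  refine natDegree_eq_of_le_of_coeff_ne_zero ?_ ?_
  · have := degree_polyOfCoeffs_lt a
    exact natDegree_le_of_degree_le (Order.lt_succ_iff.1 (by exact_mod_cast this))
  · rw [coeff_polyOfCoeffs, dif_pos (Nat.lt_succ_self n)]
    exact ha

theorem polyOfCoeffs_cons {F : Type*} [NormedField F] {n : ℕ} (c : F) (b : Fin n → F) :
    polyOfCoeffs (Fin.cons c b : Fin (n + 1) → F) =
      C c + polyOfCoeffs (Fin.cons 0 b : Fin (n + 1) → F) := by
  simp [polyOfCoeffs, Fin.sum_univ_succ]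

/-- Almost all polynomials of degree at most `n + 1` have degree `n + 1` and are separable. -/
theorem ae_separable_polyOfCoeffs (n : ℕ) : ∀ᵐ a ∂(haarPi p F (Fin (n + 2))),
    (polyOfCoeffs a).natDegree = n + 1 ∧ (polyOfCoeffs a).Separable := by
  have := charZero_base p F
  have := secondCountable_base p F
  have := haarF_nullSingleton p F
  set Z : Set (Fin (n + 2) → F) := {a | a (Fin.last (n + 1)) *
    resultant (polyOfCoeffs a) (derivative (polyOfCoeffs a)) (n + 1) n = 0} with hZ
  have hZm : MeasurableSet Z := by
    refine IsClosed.measurableSet (isClosed_eq ?_ continuous_const)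
    exact (continuous_apply _).mul (continuous_resultant_polyOfCoeffs _ _ _)
  have hZ0 : haarPi p F (Fin (n + 2)) Z = 0 := by
    have hmp := measurePreserving_piFinSuccAbove (fun _ : Fin (n + 2) => haarF p F) 0
    have hcons : ∀ (c : F) (b : Fin (n + 1) → F),
        (MeasurableEquiv.piFinSuccAbove (fun _ : Fin (n + 2) => F) 0).symm (c, b) =
          (Fin.cons c b : Fin (n + 2) → F) := by
      intro c b
      ext i
      simp [MeasurableEquiv.piFinSuccAbove]
    have h1 := (hmp.symm _).measure_preimage hZm.nullMeasurableSet
    rw [haarPi, ← h1, Measure.prod_apply_symm ((MeasurableEquiv.measurable _) hZm),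
      lintegral_eq_zero_iff (measurable_measure_prodMk_right ((MeasurableEquiv.measurable _) hZm))]
    -- Fix the coefficients other than the constant one, the leading one being nonzero. The
    -- derivative is then fixed and nonzero, so only finitely many constant terms are bad, and
    -- points are null.
    have hb := Measure.ae_eval_ne (fun _ : Fin (n + 1) => haarF p F) (Fin.last n) 0
    filter_upwards [hb] with b hb
    refine Set.Finite.measure_zero (Set.Finite.subset (finite_setOf_not_isCoprime_add_C
      (P := polyOfCoeffs (Fin.cons 0 b : Fin (n + 2) → F))
      (Q := derivative (polyOfCoeffs (Fin.cons 0 b : Fin (n + 2) → F))) ?_) ?_) _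
    · intro h0
      have h2 := derivative_eq_zero.1 h0
      rw [natDegree_polyOfCoeffs (by rw [← Fin.succ_last, Fin.cons_succ]; exact hb)] at h2
      exact Nat.succ_ne_zero n h2
    · intro c hc hcop
      have hdeg : (polyOfCoeffs (Fin.cons c b : Fin (n + 2) → F)).natDegree = n + 1 :=
        natDegree_polyOfCoeffs (by rw [← Fin.succ_last, Fin.cons_succ]; exact hb)
      have hd : derivative (polyOfCoeffs (Fin.cons c b : Fin (n + 2) → F)) =
        derivative (polyOfCoeffs (Fin.cons 0 b : Fin (n + 2) → F)) := by
        rw [polyOfCoeffs_cons, derivative_add, derivative_C, zero_add]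
      rw [← polyOfCoeffs_cons, ← hd] at hcop
      rw [Set.mem_preimage, Set.mem_preimage, hcons, hZ, Set.mem_ofPred_eq] at hc
      refine mul_ne_zero ?_ (resultant_ne_zero_of_separable hdeg hcop) hc
      rw [← Fin.succ_last, Fin.cons_succ]
      exact hb
  filter_upwards [compl_mem_ae_iff.2 hZ0] with a ha
  have h1 : a (Fin.last (n + 1)) ≠ 0 := left_ne_zero_of_mul ha
  have h2 := natDegree_polyOfCoeffs h1
  exact ⟨h2, separable_of_resultant_ne_zero h2 (right_ne_zero_of_mul ha)⟩

end Separable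

/-! ### From coordinates back to E -/

section Transport

variable (p : ℕ) [Fact p.Prime] {F : Type*} [NormedField F] [NormedAlgebra ℚ_[p] F]
  [FiniteDimensional ℚ_[p] F] [MeasurableSpace F] [BorelSpace F]
  {E : Type*} [CommRing E] [Algebra F E] [Module.Finite F E]

/-- A basis as a homeomorphism with the coordinate space. -/
noncomputable def basisHomeo {F E : Type*} [NormedField F] [CommRing E] [Algebra F E]
    [TopologicalSpace E] [IsModuleTopology F E] {ι : Type*} [Fintype ι]
    (B : Module.Basis ι F E) : (ι → F) ≃ₜ E :=
  haveI := IsModuleTopology.toContinuousAdd F E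
  { B.equivFun.symm.toEquiv with
    continuous_toFun := IsModuleTopology.continuous_of_linearMap B.equivFun.symm.toLinearMap
    continuous_invFun := IsModuleTopology.continuous_of_linearMap B.equivFun.toLinearMap }

theorem coe_basisHomeo {F E : Type*} [NormedField F] [CommRing E] [Algebra F E]
    [TopologicalSpace E] [IsModuleTopology F E] {ι : Type*} [Fintype ι]
    (B : Module.Basis ι F E) : (basisHomeo B : (ι → F) → E) = B.equivFun.symm := rfl

variable [TopologicalSpace E] [IsModuleTopology F E] [MeasurableSpace E] [BorelSpace E]

/-- The basis carries the unit cube onto 𝒪_E, so both sides are Haar measures giving 𝒪_E mass 1. -/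
theorem haarE_eq_map [Algebra.Etale F E] {ι : Type*} [Fintype ι]
    {b : Module.Basis ι (ringOfIntegers p F) (integersE p F E)}
    {B : Module.Basis ι F E} (hB : ∀ i, B i = (b i : E)) :
    haarE p F E = (haarPi p F ι).map (basisHomeo B) := by
  have hprop := properSpace_base p F
  have hu := ultrametric_base p F
  have := locallyCompactSpace_base p F
  have := isTopologicalAddGroup_of_moduleTopology F E
  have := locallyCompactSpace_of_moduleTopology F E
  have hU : (integersE p F E : Set E) = basisHomeo B '' Metric.closedBall 0 1 := by
    ext x
    rw [SetLike.mem_coe, mem_integersE_iff hB]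
    constructor
    · intro h
      exact ⟨B.equivFun x, mem_cube_iff.2 h, by rw [coe_basisHomeo, LinearEquiv.symm_apply_apply]⟩
    · rintro ⟨v, hv, rfl⟩ i
      rw [coe_basisHomeo, ← Module.Basis.equivFun_apply, LinearEquiv.apply_symm_apply]
      exact mem_cube_iff.1 hv i
  have hc : IsCompact (integersE p F E : Set E) := by
    rw [hU]
    exact (isCompact_closedBall _ _).image (basisHomeo B).continuous
  have ho : IsOpen (integersE p F E : Set E) := by
    rw [hU]
    exact (basisHomeo B).isOpenMap _ (IsUltrametricDist.isOpen_closedBall _ one_ne_zero)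
  have hi : (interior (integersE p F E : Set E)).Nonempty := by
    rw [ho.interior_eq]
    exact ⟨0, zero_mem (integersE p F E)⟩
  have h1 : (haarE p F E).IsAddHaarMeasure := normalizedHaar_isAddHaarMeasure hc hi
  have h2 : haarE p F E (integersE p F E : Set E) = 1 := normalizedHaar_self hc hi
  have : SecondCountableTopology F := secondCountable_base p F
  have : SecondCountableTopology E := (basisHomeo B).symm.isEmbedding.secondCountableTopology
  have : ((haarPi p F ι).map (basisHomeo B)).IsAddHaarMeasure :=
    AddEquiv.isAddHaarMeasure_map (haarPi p F ι) B.equivFun.symm.toAddEquiv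
      (basisHomeo B).continuous (basisHomeo B).symm.continuous
  refine addHaar_eq_of_apply_eq _ _ (U := (integersE p F E : Set E)) (by simp [h2]) (by simp [h2]) ?_
  rw [h2, (basisHomeo B).measurableEmbedding.map_apply, hU, Set.preimage_image_eq _
    (basisHomeo B).injective, haarPi_closedBall_one]

/-- In coordinates the lattice is the image of the unit cube under the matrix of powers of x. -/
theorem haarE_powerLattice [Algebra.Etale F E]
    {b : Module.Basis (Fin (Module.finrank F E)) (ringOfIntegers p F) (integersE p F E)}
    {B : Module.Basis (Fin (Module.finrank F E)) F E} (hB : ∀ i, B i = (b i : E))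
    (v : Fin (Module.finrank F E) → F) :
    haarE p F E (powerLattice p F (B.equivFun.symm v) : Set E) =
      absF p (powMat B 0 (Module.finrank F E) v).det := by
  have hprop := properSpace_base p F
  rw [haarE_eq_map p hB, (basisHomeo B).measurableEmbedding.map_apply]
  have h : basisHomeo B ⁻¹' (powerLattice p F (B.equivFun.symm v) : Set E) =
      (powMat B 0 (Module.finrank F E) v).mulVec '' Metric.closedBall 0 1 := by
    have hM : ∀ c : Fin (Module.finrank F E) → F,
        B.equivFun.symm ((powMat B 0 (Module.finrank F E) v).mulVec c) =
          ∑ i, c i • B.equivFun.symm v ^ (i : ℕ) := by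
      intro c
      rw [LinearEquiv.symm_apply_eq, map_sum]
      ext i
      simp [Matrix.mulVec, dotProduct, powMat, mul_comm]
    ext y
    rw [Set.mem_preimage, coe_basisHomeo, powerLattice, SetLike.mem_coe,
      Submodule.mem_span_range_iff_exists_fun]
    constructor
    · rintro ⟨c, hc⟩
      refine ⟨fun i => (c i : F), mem_cube_iff.2 fun i => (c i).2, ?_⟩
      apply B.equivFun.symm.injective
      rw [hM, ← hc]
      rfl
    · rintro ⟨c, hc, rfl⟩
      refine ⟨fun i => ⟨c i, mem_cube_iff.1 hc i⟩, ?_⟩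
      rw [hM]
      rfl
  rw [h, haarPi_image_mulVec, haarPi_closedBall_one, mul_one]

theorem rho_eq_lintegral_coordDensity [Algebra.Etale F E]
    {b : Module.Basis (Fin (Module.finrank F E)) (ringOfIntegers p F) (integersE p F E)}
    {B : Module.Basis (Fin (Module.finrank F E)) F E} (hB : ∀ i, B i = (b i : E))
    {n m : ℕ} (h : n + 1 = Module.finrank F E + m) :
    rho p F E n = ∫⁻ v, coordDensity p B m v ∂(haarPi p F _) := by
  have hprop := properSpace_base p F
  rw [rho, haarE_eq_map p hB, (basisHomeo B).measurableEmbedding.lintegral_map]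
  refine lintegral_congr fun v => ?_
  rw [coe_basisHomeo, density, coordDensity, haarE_powerLattice p hB, absDiscr_eq hB, h,
    Nat.add_sub_cancel_left, normAverage_eq]

theorem lintegral_coeffLaw (n : ℕ) (g : (Fin n → F) → ℝ≥0∞) :
    ∫⁻ a, g a ∂(coeffLaw p F n) = ∫⁻ a in Metric.closedBall 0 1, g a ∂(haarPi p F (Fin n)) := by
  rw [coeffLaw, haarPi, closedBall_pi _ zero_le_one, Measure.restrict_pi_pi]
  simp only [coe_ringOfIntegers, Pi.zero_apply]

theorem lintegral_coeffLaw_add (r m : ℕ) (g : F[X] → ℝ≥0∞) :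
    ∫⁻ a, g (polyOfCoeffs a) ∂(coeffLaw p F (r + m)) =
      ∫⁻ u in Metric.closedBall 0 1, g (sumPoly u) ∂(haarPi p F (Fin r ⊕ Fin m)) := by
  have hprop := properSpace_base p F
  rw [lintegral_coeffLaw, ← lintegral_indicator Metric.isClosed_closedBall.measurableSet,
    ← lintegral_indicator Metric.isClosed_closedBall.measurableSet,
    ← lintegral_comp_equiv p finSumFinEquiv.symm]
  refine lintegral_congr fun u => ?_
  have hmem : u ∘ finSumFinEquiv.symm ∈ Metric.closedBall (0 : Fin (r + m) → F) 1 ↔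
      u ∈ Metric.closedBall (0 : Fin r ⊕ Fin m → F) 1 := by
    rw [mem_cube_iff, mem_cube_iff]
    exact finSumFinEquiv.symm.forall_congr_right (q := fun i => ‖u i‖ ≤ 1)
  by_cases hu : u ∈ Metric.closedBall (0 : Fin r ⊕ Fin m → F) 1
  · rw [Set.indicator_of_mem hu, Set.indicator_of_mem (hmem.2 hu), sumPoly]
  · rw [Set.indicator_of_notMem hu, Set.indicator_of_notMem (mt hmem.1 hu)]

theorem ae_separable_sumPoly {r m : ℕ} (h : 2 ≤ r + m) :
    ∀ᵐ u ∂(haarPi p F (Fin r ⊕ Fin m)), (sumPoly u).Separable := by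
  obtain ⟨n, hn⟩ : ∃ n, r + m = n + 2 := ⟨r + m - 2, by omega⟩
  have h1 : ∀ᵐ a ∂(haarPi p F (Fin (r + m))), (polyOfCoeffs a).Separable := by
    rw [hn]
    exact (ae_separable_polyOfCoeffs p n).mono fun _ h => h.2
  exact (measurePreserving_comp_equiv p finSumFinEquiv.symm).quasiMeasurePreserving.ae h1

theorem expectedNewRoots_eq_lintegral_coordDensity {E : Type*} [CommRing E] [Algebra F E]
    [IsReduced E] {r : ℕ} (B : Module.Basis (Fin r) F E)
    {n m : ℕ} (hn : 0 < n) (h : n + 1 = r + m) :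
    expectedNewRoots p F E n = ∫⁻ v, coordDensity p B m v ∂(haarPi p F _) := by
  rw [expectedNewRoots, h, lintegral_coeffLaw_add p r m fun P => (numNewRoots E P : ℝ≥0∞),
    lintegral_numNewRoots p B m (ae_separable_sumPoly p (by omega)), lintegral_integralPairs_eq]

theorem rho_eq_expectedNewRoots [Algebra.Etale F E] {n : ℕ} (hn : 0 < n)
    (h : Module.finrank F E ≤ n + 1) : rho p F E n = expectedNewRoots p F E n := by
  have : IsReduced E := Algebra.FormallyUnramified.isReduced_of_field F E
  obtain ⟨b, B, hB⟩ := exists_basis_integersE p F E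
  obtain ⟨m, hm⟩ := Nat.exists_eq_add_of_le h
  rw [rho_eq_lintegral_coordDensity p hB hm, expectedNewRoots_eq_lintegral_coordDensity p B hn hm]

end Transport

/-! ### New roots, automorphisms and monic factors -/

section NewRootsAndFactors

variable {F : Type*} [Field F]

theorem etale_adjoinRoot {f : F[X]} (hf : f.Monic) (hsep : f.Separable) :
    Algebra.Etale F (AdjoinRoot f) := by
  obtain ⟨a, b, hab⟩ := hsep
  -- The separability of f is the étale condition with nothing inverted, hence g = 1; the
  -- localization away from 1 is then trivial.
  let P : StandardEtalePair F :=
    { f := f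
      monic_f := hf
      g := 1
      cond := ⟨b, a, 1, by rw [pow_one, ← hab]; ring⟩ }
  have hunit : IsUnit (AdjoinRoot.mk P.f P.g) := by
    rw [show P.g = 1 from rfl, map_one]
    exact isUnit_one
  have e := (IsLocalization.atUnit (AdjoinRoot P.f) (Localization.Away (AdjoinRoot.mk P.f P.g)) _
    hunit).restrictScalars F
  exact Algebra.Etale.of_equiv (P.equivAwayAdjoinRoot.trans e.symm)

/-- An automorphism is determined by its composites with the projections to the residue fields, and
each residue field receives finitely many algebra homomorphisms from E. -/
theorem finite_algEquiv_of_isReduced (E : Type*) [CommRing E] [Algebra F E] [Module.Finite F E]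
    [IsReduced E] : Finite (E ≃ₐ[F] E) := by
  have : IsArtinianRing E := IsArtinianRing.of_finite F E
  have hinj : Function.Injective fun (σ : E ≃ₐ[F] E) (m : MaximalSpectrum E) =>
      (Ideal.Quotient.mkₐ F m.asIdeal).comp (σ : E →ₐ[F] E) := by
    intro σ τ h
    ext x
    apply (IsArtinianRing.equivPi E).injective
    ext m
    exact DFunLike.congr_fun (congrFun h m) x
  have hfin : ∀ m : MaximalSpectrum E, Finite (E →ₐ[F] E ⧸ m.asIdeal) := fun m => by
    have := m.isMaximal
    infer_instance
  exact Finite.of_injective _ hinj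

variable {E : Type*} [CommRing E] [Algebra F E]

/-- The minimal polynomials of the elements which generate `E`. -/
def newMinpolys (F : Type*) [Field F] (E : Type*) [CommRing E] [Algebra F E] : Set F[X] :=
  {f | ∃ x : E, Algebra.adjoin F {x} = ⊤ ∧ minpoly F x = f}

/-- The monic factors of degree `r` of `P`. -/
def monicFactors (r : ℕ) (P : F[X]) : Set F[X] := {f | f.Monic ∧ f.natDegree = r ∧ f ∣ P}

variable [Module.Finite F E]

theorem exists_algEquiv_of_minpoly_eq {E' : Type*} [CommRing E'] [Algebra F E']
    [Module.Finite F E'] {x : E} {y : E'} (hx : Algebra.adjoin F {x} = ⊤)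
    (hy : Algebra.adjoin F {y} = ⊤) (h : minpoly F x = minpoly F y) :
    ∃ e : E ≃ₐ[F] E', e x = y := by
  refine ⟨(newPowerBasis hx).equivOfMinpoly (newPowerBasis hy) ?_, ?_⟩
  · rw [newPowerBasis_gen, newPowerBasis_gen, h]
  · exact (congrArg _ (newPowerBasis_gen hx).symm).trans
      (((newPowerBasis hx).equivOfMinpoly_gen (newPowerBasis hy) _).trans (newPowerBasis_gen hy))

omit [Module.Finite F E] in
theorem adjoin_algEquiv_apply {E' : Type*} [CommRing E'] [Algebra F E'] (e : E ≃ₐ[F] E') {x : E}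
    (hx : Algebra.adjoin F {x} = ⊤) : Algebra.adjoin F {e x} = ⊤ := by
  have h := AlgHom.map_adjoin (e : E →ₐ[F] E') {x}
  rw [hx, Set.image_singleton, Algebra.map_top, (AlgHom.range_eq_top _).2 e.surjective] at h
  exact h.symm

/-- The automorphisms of `E` act simply transitively on the generators of `E` which have a given
minimal polynomial. -/
theorem nonempty_fiber_minpoly_equiv {f : F[X]} (hf : f ∈ newMinpolys F E) :
    Nonempty ({x : E // Algebra.adjoin F {x} = ⊤ ∧ minpoly F x = f} ≃ (E ≃ₐ[F] E)) := by
  obtain ⟨x, hx, rfl⟩ := hf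
  refine ⟨(Equiv.ofBijective (fun σ : E ≃ₐ[F] E =>
    (⟨σ x, adjoin_algEquiv_apply σ hx, minpoly.algEquiv_eq σ x⟩ :
      {y : E // Algebra.adjoin F {y} = ⊤ ∧ minpoly F y = minpoly F x})) ⟨?_, ?_⟩).symm⟩
  · intro σ τ h
    have h1 : (σ : E →ₐ[F] E) = τ := by
      refine AlgHom.ext_of_adjoin_eq_top hx ?_
      rintro y rfl
      exact congrArg Subtype.val h
    exact AlgEquiv.ext fun y => DFunLike.congr_fun h1 y
  · rintro ⟨y, hy, hxy⟩
    obtain ⟨e, he⟩ := exists_algEquiv_of_minpoly_eq hx hy hxy.symm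
    exact ⟨e, Subtype.ext he⟩

/-- The map x ↦ minpoly x sends the new roots of P onto the factors of P of degree [E:F] that are
minimal polynomials of generators of E; each fibre is in bijection with Aut(E). -/
theorem numNewRoots_eq_card_mul (P : F[X]) :
    numNewRoots E P = (newMinpolys F E ∩ monicFactors (Module.finrank F E) P).encard *
      ENat.card (E ≃ₐ[F] E) := by
  classical
  set S := newMinpolys F E ∩ monicFactors (Module.finrank F E) P with hS
  have hmem : ∀ x : E, (aeval x P = 0 ∧ Algebra.adjoin F {x} = ⊤) →
      minpoly F x ∈ S := fun x hx =>
    ⟨⟨x, hx.2, rfl⟩, minpoly.monic (Algebra.IsIntegral.isIntegral x),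
      natDegree_minpoly_eq_finrank hx.2, minpoly.dvd F x hx.1⟩
  let φ : {x : E | aeval x P = 0 ∧ Algebra.adjoin F {x} = ⊤} → S :=
    fun x => ⟨minpoly F (x : E), hmem x x.2⟩
  have hfib : ∀ f : S, Nonempty ({x // φ x = f} ≃ (E ≃ₐ[F] E)) := by
    rintro ⟨f, hf1, hf2⟩
    obtain ⟨e⟩ := nonempty_fiber_minpoly_equiv hf1
    refine ⟨Equiv.trans ?_ e⟩
    exact
      { toFun := fun x => ⟨x.1.1, x.1.2.2, congrArg Subtype.val x.2⟩
        invFun := fun x => ⟨⟨x.1, by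
          obtain ⟨Q, hQ⟩ := hf2.2.2
          have h := minpoly.aeval F x.1
          rw [x.2.2] at h
          rw [hQ, map_mul, h, zero_mul], x.2.1⟩, Subtype.ext x.2.2⟩
        left_inv := fun x => rfl
        right_inv := fun x => rfl }
  have e := fun f => (hfib f).some
  rw [numNewRoots]
  change ENat.card {x : E | aeval x P = 0 ∧ Algebra.adjoin F {x} = ⊤} = ENat.card S * _
  rw [← ENat.card_prod]
  exact ENat.card_congr ((Equiv.sigmaFiberEquiv φ).symm.trans
    ((Equiv.sigmaCongrRight e).trans (Equiv.sigmaEquivProd _ _)))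

theorem numNewRoots_div_card [IsReduced E] (P : F[X]) :
    (numNewRoots E P : ℝ≥0∞) / (Nat.card (E ≃ₐ[F] E) : ℝ≥0∞) =
      ((newMinpolys F E ∩ monicFactors (Module.finrank F E) P).encard : ℝ≥0∞) := by
  have := finite_algEquiv_of_isReduced (F := F) E
  rw [numNewRoots_eq_card_mul, ENat.toENNReal_mul, ENat.card_eq_coe_natCard, ENat.toENNReal_coe]
  exact ENNReal.mul_div_cancel_right (by exact_mod_cast Nat.card_pos.ne') (ENNReal.natCast_ne_top _)

end NewRootsAndFactors

section Classes

universe u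

variable {F : Type u} [Field F] {r : ℕ}

theorem isReduced_finiteEtaleAlgebra (E : FiniteEtaleAlgebra F r) : IsReduced E :=
  Algebra.FormallyUnramified.isReduced_of_field F E

/-- The class is that of F[X]/(f), étale because f is separable; an algebra generated by an element
with minimal polynomial f is isomorphic to it. -/
theorem existsUnique_class_mem_newMinpolys
    {rep : FiniteEtaleAlgebra.IsoClass F r → FiniteEtaleAlgebra F r}
    (hrep : ∀ c, (⟦rep c⟧ : FiniteEtaleAlgebra.IsoClass F r) = c) {f : F[X]} (hf : f.Monic)
    (hdeg : f.natDegree = r) (hsep : f.Separable) :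
    ∃! c : FiniteEtaleAlgebra.IsoClass F r, f ∈ newMinpolys F (rep c) := by
  have := etale_adjoinRoot hf hsep
  have hfin : Module.Finite F (AdjoinRoot f) := hf.finite_adjoinRoot
  let A : FiniteEtaleAlgebra F r := ⟨AdjoinRoot f, by
    rw [(AdjoinRoot.powerBasis hf.ne_zero).finrank, AdjoinRoot.powerBasis_dim, hdeg]⟩
  have hA : f ∈ newMinpolys F A :=
    ⟨AdjoinRoot.root f, AdjoinRoot.adjoinRoot_eq_top, by
      change minpoly F (AdjoinRoot.root f) = f
      rw [AdjoinRoot.minpoly_root hf.ne_zero, hf.leadingCoeff, inv_one, C_1, mul_one]⟩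
  have key : ∀ A B : FiniteEtaleAlgebra F r, f ∈ newMinpolys F A → f ∈ newMinpolys F B →
      Nonempty (A ≃ₐ[F] B) := by
    rintro A B ⟨x, hx, hxf⟩ ⟨y, hy, hyf⟩
    obtain ⟨e, -⟩ := exists_algEquiv_of_minpoly_eq hx hy (hxf.trans hyf.symm)
    exact ⟨e⟩
  refine ⟨⟦A⟧, ?_, fun c hc => ?_⟩
  · obtain ⟨e⟩ := Quotient.exact (hrep ⟦A⟧)
    obtain ⟨x, hx, hxf⟩ := hA
    exact ⟨e.symm x, adjoin_algEquiv_apply e.symm hx, by rw [minpoly.algEquiv_eq, hxf]⟩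
  · rw [← hrep c]
    exact Quotient.sound (key _ _ hc hA)

/-- Dividing by #Aut(E) turns roots into factors, and each monic factor of degree r, being
separable, is counted for exactly one class. -/
theorem tsum_numNewRoots_div_card
    {rep : FiniteEtaleAlgebra.IsoClass F r → FiniteEtaleAlgebra F r}
    (hrep : ∀ c, (⟦rep c⟧ : FiniteEtaleAlgebra.IsoClass F r) = c) {P : F[X]} (hP : P.Separable) :
    ∑' c : FiniteEtaleAlgebra.IsoClass F r,
      (numNewRoots (rep c) P : ℝ≥0∞) / (Nat.card (rep c ≃ₐ[F] rep c) : ℝ≥0∞) =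
      ((monicFactors r P).encard : ℝ≥0∞) := by
  classical
  have h1 : ∀ c : FiniteEtaleAlgebra.IsoClass F r,
      (numNewRoots (rep c) P : ℝ≥0∞) / (Nat.card (rep c ≃ₐ[F] rep c) : ℝ≥0∞) =
        ∑' f : monicFactors r P, (newMinpolys F (rep c)).indicator (fun _ => (1 : ℝ≥0∞)) f := by
    intro c
    have := isReduced_finiteEtaleAlgebra (rep c)
    rw [numNewRoots_div_card, (rep c).finrank_eq, ← ENNReal.tsum_set_one, tsum_subtype
      (newMinpolys F (rep c) ∩ monicFactors r P) (fun _ => (1 : ℝ≥0∞)), tsum_subtype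
      (monicFactors r P) ((newMinpolys F (rep c)).indicator fun _ => (1 : ℝ≥0∞)),
      Set.indicator_indicator, Set.inter_comm]
  simp_rw [h1]
  rw [ENNReal.tsum_comm, ← ENNReal.tsum_set_one]
  refine tsum_congr fun f => ?_
  obtain ⟨c, hc, hu⟩ := existsUnique_class_mem_newMinpolys hrep f.2.1 f.2.2.1
    (hP.of_dvd f.2.2.2)
  rw [tsum_eq_single c, Set.indicator_of_mem hc]
  intro c' hc'
  exact Set.indicator_of_notMem (fun h => hc' (hu c' h)) _

end Classes

/-! ### Measurability of the number of new roots -/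

section FiberCount

/-- Finitely many points of a fibre have disjoint open neighbourhoods; the intersection of their
open images is a neighbourhood of the base point above which as many points persist. -/
theorem lowerSemicontinuous_encard_fiber {X Y : Type*} [TopologicalSpace X] [T2Space X]
    [TopologicalSpace Y] {U : Set X} {g : X → Y}
    (hg : ∀ V ⊆ U, IsOpen V → IsOpen (g '' V)) (hU : IsOpen U) :
    LowerSemicontinuous fun u : Y => ({w ∈ U | g w = u}.encard : ℝ≥0∞) := by
  intro u y hy
  obtain ⟨k, hyk, hk⟩ : ∃ k : ℕ, y < k ∧ (k : ℕ∞) ≤ {w ∈ U | g w = u}.encard := by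
    rcases h : {w ∈ U | g w = u}.encard with - | k
    · obtain ⟨k, hk⟩ := ENNReal.exists_nat_gt (ne_top_of_lt hy)
      exact ⟨k, hk, le_top⟩
    · refine ⟨k, ?_, le_rfl⟩
      have h' : {w ∈ U | g w = u}.encard = (k : ℕ∞) := h
      simpa [h'] using hy
  obtain ⟨t, hts, htk⟩ := Set.exists_subset_encard_eq hk
  have htf : t.Finite := Set.finite_of_encard_eq_coe htk
  obtain ⟨V, hV, hdisj⟩ := htf.t2_separation
  have hopen : IsOpen (⋂ w ∈ t, g '' (V w ∩ U)) :=
    htf.isOpen_biInter fun w _ => hg _ Set.inter_subset_right ((hV w).2.inter hU)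
  filter_upwards [hopen.mem_nhds (Set.mem_iInter₂.2 fun w hw =>
    ⟨w, ⟨(hV w).1, (hts hw).1⟩, (hts hw).2⟩)] with u' hu'
  refine hyk.trans_le ?_
  rw [Set.mem_iInter₂] at hu'
  choose! f hf using hu'
  have hinj : Set.InjOn f t := by
    intro a ha b hb hab
    by_contra hne
    exact Set.disjoint_left.1 (hdisj ha hb hne) (hf a ha).1.1 (hab ▸ (hf b hb).1.1)
  have h1 : (k : ℕ∞) ≤ {w ∈ U | g w = u'}.encard := by
    rw [← htk, ← hinj.encard_image]
    refine Set.encard_le_encard ?_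
    rintro _ ⟨w, hw, rfl⟩
    exact ⟨(hf w hw).1.2, (hf w hw).2⟩
  exact_mod_cast ENat.toENNReal_mono h1

end FiberCount

section Measurability

variable (p : ℕ) [Fact p.Prime] {F : Type*} [NormedField F] [NormedAlgebra ℚ_[p] F]
  [FiniteDimensional ℚ_[p] F] [MeasurableSpace F] [BorelSpace F]
  {E : Type*} [CommRing E] [Algebra F E] {r : ℕ}

theorem aemeasurable_numNewRoots (B : Module.Basis (Fin r) F E) {m : ℕ} (h : 2 ≤ r + m) :
    AEMeasurable (fun u : Fin r ⊕ Fin m → F => (numNewRoots E (sumPoly u) : ℝ≥0∞))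
      (haarPi p F (Fin r ⊕ Fin m)) := by
  have hprop := properSpace_base p F
  have hlsc : LowerSemicontinuous fun u : Fin r ⊕ Fin m → F =>
      ({w ∈ regularSet B m | rootMap B m w = u}.encard : ℝ≥0∞) := by
    refine lowerSemicontinuous_encard_fiber (fun V hV hVo => ?_) (isOpen_regularSet B m)
    exact isOpen_image_of_det_ne_zero p hVo
      ((continuousOn_rootMapQuot B m).mono
        (Set.prod_mono (fun _ h => (hV h).1) fun _ h => (hV h).1))
      (fun _ hy _ hz => rootMap_sub_rootMap B m (hV hy).1 (hV hz).1)
      fun _ hx => det_rootMapQuot_ne_zero B m (hV hx)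
  refine hlsc.measurable.aemeasurable.congr ?_
  filter_upwards [ae_separable_sumPoly p h] with u hu
  rw [encard_fiber_rootMap B m hu]

end Measurability

/-! ### Countability of the relevant isomorphism classes -/

section CountableClasses

universe u

variable (p : ℕ) [Fact p.Prime] {F : Type u} [NormedField F] [NormedAlgebra ℚ_[p] F]
  [FiniteDimensional ℚ_[p] F] {r : ℕ}

/-- With m = 1 the polynomial has degree at most r, so the minimal polynomial of a new root is its
monic normalization. It therefore determines the algebra. -/
theorem image_rootMap_inter_nonempty {E E' : Type*} [CommRing E] [Algebra F E] [CommRing E']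
    [Algebra F E'] [Nontrivial E] (B : Module.Basis (Fin r) F E)
    (B' : Module.Basis (Fin r) F E') {u : Fin r ⊕ Fin 1 → F}
    (h : u ∈ rootMap B 1 '' regularSet B 1) (h' : u ∈ rootMap B' 1 '' regularSet B' 1) :
    Nonempty (E ≃ₐ[F] E') := by
  have : Module.Finite F E := Module.Finite.of_basis B
  have : Module.Finite F E' := Module.Finite.of_basis B'
  have hr : Module.finrank F E = r := by rw [Module.finrank_eq_card_basis B, Fintype.card_fin]
  have hr' : Module.finrank F E' = r := by rw [Module.finrank_eq_card_basis B', Fintype.card_fin]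
  obtain ⟨w, hw, hwu⟩ := h
  obtain ⟨w', hw', hwu'⟩ := h'
  have hx := (det_powMat_ne_zero_iff B _).1 hw.1
  have hx' := (det_powMat_ne_zero_iff B' _).1 hw'.1
  have h0 := ((rootMap_eq_iff B 1 hw.1 u).1 hwu).2
  have h0' := ((rootMap_eq_iff B' 1 hw'.1 u).1 hwu').2
  set x := B.equivFun.symm (w ∘ Sum.inl)
  set x' := B'.equivFun.symm (w' ∘ Sum.inl)
  -- The zero polynomial is excluded by the derivative condition in `regularSet`, since N(0) = 0 in
  -- a nonzero algebra.
  have hP : sumPoly u ≠ 0 := by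
    intro hP
    have h1 := hw.2
    rw [Set.mem_ofPred_eq, hwu, hP, derivative_zero, map_zero] at h1
    have : Module.Free F E := Module.Free.of_basis B
    exact h1 Algebra.norm_zero
  have hdeg : (sumPoly u).natDegree ≤ r := by
    have := degree_polyOfCoeffs_lt (u ∘ finSumFinEquiv.symm)
    exact natDegree_le_of_degree_le (Order.lt_succ_iff.1 (by exact_mod_cast this))
  have key : ∀ f : F[X], f.Monic → f.natDegree = r → f ∣ sumPoly u →
      f = C (sumPoly u).leadingCoeff⁻¹ * sumPoly u := by
    intro f hf hfr hd
    have h1 := eq_leadingCoeff_mul_of_monic_of_dvd_of_natDegree_le hf hd (by rw [hfr]; exact hdeg)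
    have h2 : C (sumPoly u).leadingCoeff⁻¹ * (C (sumPoly u).leadingCoeff * f) = f := by
      rw [← mul_assoc, ← C_mul, inv_mul_cancel₀ (leadingCoeff_ne_zero.2 hP), C_1, one_mul]
    rw [← h1] at h2
    exact h2.symm
  have hm := key _ (minpoly.monic (Algebra.IsIntegral.isIntegral x))
    (by rw [natDegree_minpoly_eq_finrank hx, hr]) (minpoly.dvd F x h0)
  have hm' := key _ (minpoly.monic (Algebra.IsIntegral.isIntegral x'))
    (by rw [natDegree_minpoly_eq_finrank hx', hr']) (minpoly.dvd F x' h0')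
  obtain ⟨e, -⟩ := exists_algEquiv_of_minpoly_eq hx hx' (hm.trans hm'.symm)
  exact ⟨e⟩

theorem image_rootMap_nonempty {E : Type*} [CommRing E] [Algebra F E] [CharZero F] [IsReduced E]
    (B : Module.Basis (Fin r) F E) (h : (newMinpolys F E).Nonempty) :
    (rootMap B 1 '' regularSet B 1).Nonempty := by
  have : Module.Finite F E := Module.Finite.of_basis B
  have hr : Module.finrank F E = r := by rw [Module.finrank_eq_card_basis B, Fintype.card_fin]
  obtain ⟨f, x, hx, rfl⟩ := h
  have hdeg : (minpoly F x).degree < (r + 1 : ℕ) := by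
    rw [degree_eq_natDegree (minpoly.ne_zero (Algebra.IsIntegral.isIntegral x)),
      natDegree_minpoly_eq_finrank hx, hr]
    exact_mod_cast Nat.lt_succ_self r
  have hu := sumPoly_coeffVec 1 hdeg
  have hcard := encard_fiber_rootMap (E := E) B 1 (u := coeffVec r 1 (minpoly F x))
    (by rw [hu]; exact separable_minpoly_of_isReduced x)
  have hne : {w ∈ regularSet B 1 | rootMap B 1 w = coeffVec r 1 (minpoly F x)}.Nonempty := by
    rw [← Set.encard_ne_zero, hcard, hu, numNewRoots, Set.encard_ne_zero]
    exact ⟨x, minpoly.aeval F x, hx⟩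
  obtain ⟨w, hw, -⟩ := hne
  exact ⟨_, w, hw, rfl⟩

include p in
-- Distinct classes give disjoint nonempty open sets of polynomials of degree at most r in a
-- separable space. Countability permits the exchange of sum and integral; classes without
-- generators never contribute and need not be counted.
theorem countable_classes (hr : 0 < r)
    {rep : FiniteEtaleAlgebra.IsoClass F r → FiniteEtaleAlgebra F r}
    (hrep : ∀ c, (⟦rep c⟧ : FiniteEtaleAlgebra.IsoClass F r) = c) :
    {c | (newMinpolys F (rep c)).Nonempty}.Countable := by
  have := charZero_base p F
  have := properSpace_base p F
  let B : ∀ c, Module.Basis (Fin r) F (rep c) := fun c =>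
    (Module.finBasis F (rep c)).reindex (finCongr (rep c).finrank_eq)
  refine Set.PairwiseDisjoint.countable_of_isOpen
    (s := fun c => rootMap (B c) 1 '' regularSet (B c) 1) ?_ ?_ ?_
  · intro c _ c' _ hne
    refine Set.disjoint_left.2 fun u hu hu' => hne ?_
    have : Nontrivial (rep c) := Module.nontrivial_of_finrank_pos (R := F) (by
      rw [(rep c).finrank_eq]; exact hr)
    rw [← hrep c, ← hrep c']
    exact Quotient.sound (image_rootMap_inter_nonempty (B c) (B c') hu hu')
  · exact fun c _ => isOpen_image_rootMap p (B c) 1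
  · intro c hc
    have := isReduced_finiteEtaleAlgebra (rep c)
    exact image_rootMap_nonempty (B c) hc

end CountableClasses

/-! ### The weighted sum as an expected number of factors -/

section ExpectedFactors

universe u

variable (p : ℕ) [Fact p.Prime] (F : Type u) [NormedField F] [NormedAlgebra ℚ_[p] F]
  [FiniteDimensional ℚ_[p] F] [MeasurableSpace F] [BorelSpace F]

/-- The expected number of monic factors of degree `r` of a random polynomial of degree at
most `n`. -/
noncomputable def expectedFactors (r n : ℕ) : ℝ≥0∞ :=
  ∫⁻ a : Fin (n + 1) → F, ((monicFactors r (polyOfCoeffs a)).encard : ℝ≥0∞) ∂(coeffLaw p F (n + 1))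

variable {F} {r : ℕ}

/-- Exchange sum and integral, then count factors pointwise for almost every polynomial. -/
theorem tsum_expectedNewRoots_div_card (hr : 0 < r) {n : ℕ} (hrn : r ≤ n)
    {rep : FiniteEtaleAlgebra.IsoClass F r → FiniteEtaleAlgebra F r}
    (hrep : ∀ c, (⟦rep c⟧ : FiniteEtaleAlgebra.IsoClass F r) = c) :
    ∑' c : FiniteEtaleAlgebra.IsoClass F r,
      expectedNewRoots p F (rep c) n / (Nat.card (rep c ≃ₐ[F] rep c) : ℝ≥0∞) =
      expectedFactors p F r n := by
  obtain ⟨m, hm⟩ : ∃ m, n + 1 = r + m := Nat.exists_eq_add_of_le (by omega)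
  have hzero : ∀ c ∉ {c | (newMinpolys F (rep c)).Nonempty}, ∀ P : F[X],
      numNewRoots (rep c) P = 0 := by
    intro c hc P
    rw [numNewRoots, Set.encard_eq_zero, Set.eq_empty_iff_forall_notMem]
    exact fun x hx => hc ⟨_, x, hx.2, rfl⟩
  have hcount := (countable_classes p hr hrep).to_subtype
  have hE : ∀ E : FiniteEtaleAlgebra F r, expectedNewRoots p F E n =
      ∫⁻ u in Metric.closedBall 0 1, (numNewRoots E (sumPoly u) : ℝ≥0∞)
        ∂(haarPi p F (Fin r ⊕ Fin m)) := by
    intro E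
    rw [expectedNewRoots, hm, lintegral_coeffLaw_add p r m fun P => (numNewRoots E P : ℝ≥0∞)]
  rw [expectedFactors, hm, lintegral_coeffLaw_add p r m fun P =>
    ((monicFactors r P).encard : ℝ≥0∞)]
  -- This restricts the sum to a countable index set, as integrating termwise requires.
  have hsub : ∀ f : FiniteEtaleAlgebra.IsoClass F r → ℝ≥0∞,
      (∀ c ∉ {c | (newMinpolys F (rep c)).Nonempty}, f c = 0) →
      ∑' c, f c = ∑' c : {c | (newMinpolys F (rep c)).Nonempty}, f c := by
    intro f hf
    refine (tsum_subtype_eq_of_support_subset fun c hc => ?_).symm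
    by_contra h
    exact hc (hf c h)
  rw [hsub _ fun c hc => by
    rw [hE]
    simp [hzero c hc]]
  have hmeas : ∀ c : FiniteEtaleAlgebra.IsoClass F r, AEMeasurable
      (fun u : Fin r ⊕ Fin m → F => (numNewRoots (rep c) (sumPoly u) : ℝ≥0∞))
      ((haarPi p F (Fin r ⊕ Fin m)).restrict (Metric.closedBall 0 1)) := fun c =>
    (aemeasurable_numNewRoots p ((Module.finBasis F (rep c)).reindex
      (finCongr (rep c).finrank_eq)) (by omega)).restrict
  simp_rw [hE, div_eq_mul_inv]
  simp_rw [← fun c => lintegral_mul_const'' (Nat.card (rep c ≃ₐ[F] rep c) : ℝ≥0∞)⁻¹ (hmeas c)]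
  rw [← lintegral_tsum fun c : {c | (newMinpolys F (rep c)).Nonempty} => (hmeas c).mul_const _]
  refine lintegral_congr_ae (ae_restrict_of_ae ?_)
  filter_upwards [ae_separable_sumPoly p (F := F) (r := r) (m := m) (by omega)] with u hu
  rw [← tsum_numNewRoots_div_card hrep hu, hsub]
  · simp_rw [div_eq_mul_inv]
  · intro c hc
    rw [hzero c hc]
    simp

end ExpectedFactors

/-! ### Residue field, resultants and Sylvester substitutions -/

section Residue

theorem exists_irreducible_of_natDegree (k : Type*) [Field k] [Finite k] {d : ℕ} (hd : 0 < d) :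
    ∃ f : k[X], f.Monic ∧ Irreducible f ∧ f.natDegree = d := by
  obtain ⟨q, hq⟩ := CharP.exists k
  have : Fact q.Prime := ⟨(CharP.char_is_prime_or_zero k q).resolve_right fun h => by
    subst h
    have := CharP.charP_to_charZero k
    exact not_finite k⟩
  have : NeZero d := ⟨hd.ne'⟩
  let K := FiniteField.Extension k q d
  have hK : Module.finrank k K = d := FiniteField.finrank_extension k q d
  obtain ⟨α, hα⟩ := Field.exists_primitive_element k K
  have hint : IsIntegral k α := Algebra.IsIntegral.isIntegral α
  refine ⟨minpoly k α, minpoly.monic hint, minpoly.irreducible hint, ?_⟩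
  exact ((Field.primitive_element_iff_minpoly_natDegree_eq k α).1 hα).trans hK

variable (p : ℕ) [Fact p.Prime] (F : Type*) [NormedField F] [NormedAlgebra ℚ_[p] F]

variable {p F} in
theorem isUnit_ringOfIntegers_iff {a : ringOfIntegers p F} : IsUnit a ↔ ‖(a : F)‖ = 1 := by
  constructor
  · rintro ⟨u, rfl⟩
    have h1 : ‖((u : ringOfIntegers p F) : F)‖ ≤ 1 := (u : ringOfIntegers p F).2
    have h2 : ‖((u⁻¹ : (ringOfIntegers p F)ˣ) : F)‖ ≤ 1 := ((u⁻¹ : (ringOfIntegers p F)ˣ) : ringOfIntegers p F).2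
    have h3 : ((u : ringOfIntegers p F) : F) * ((u⁻¹ : (ringOfIntegers p F)ˣ) : F) = 1 := by
      rw [← Subring.coe_mul, u.mul_inv, Subring.coe_one]
    have h4 := congrArg norm h3
    rw [norm_mul, norm_one] at h4
    nlinarith [norm_nonneg ((u : ringOfIntegers p F) : F),
      norm_nonneg ((u⁻¹ : (ringOfIntegers p F)ˣ) : F)]
  · intro h
    have h0 : (a : F) ≠ 0 := by rw [← norm_pos_iff, h]; exact one_pos
    refine IsUnit.of_mul_eq_one (⟨(a : F)⁻¹, ?_⟩ : ringOfIntegers p F) (Subtype.ext ?_)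
    · rw [mem_ringOfIntegers, norm_inv, h, inv_one]
    · exact mul_inv_cancel₀ h0

instance isLocalRing_ringOfIntegers : IsLocalRing (ringOfIntegers p F) := by
  have hu := ultrametric_base p F
  refine IsLocalRing.of_nonunits_add fun a b ha hb => ?_
  rw [mem_nonunits_iff, isUnit_ringOfIntegers_iff] at ha hb ⊢
  have ha' := lt_of_le_of_ne a.2 ha
  have hb' := lt_of_le_of_ne b.2 hb
  exact ((IsUltrametricDist.norm_add_le_max (a : F) b).trans_lt (max_lt ha' hb')).ne

variable [FiniteDimensional ℚ_[p] F]

/-- The maximal ideal is an open subgroup of a compact group, hence of finite index. -/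
instance finite_residueField : Finite (IsLocalRing.ResidueField (ringOfIntegers p F)) := by
  have hu := ultrametric_base p F
  have : CompactSpace (ringOfIntegers p F) :=
    isCompact_iff_compactSpace.1 (isCompact_ringOfIntegers p F)
  let φ := (IsLocalRing.residue (ringOfIntegers p F)).toAddMonoidHom
  have hφ : Function.Surjective φ := IsLocalRing.residue_surjective
  have hopen : IsOpen (φ.ker : Set (ringOfIntegers p F)) := by
    have h : (φ.ker : Set (ringOfIntegers p F)) = {x : ringOfIntegers p F | ‖(x : F)‖ < 1} := by
      ext x
      change IsLocalRing.residue (ringOfIntegers p F) x = 0 ↔ ‖(x : F)‖ < 1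
      rw [IsLocalRing.residue_eq_zero_iff, IsLocalRing.mem_maximalIdeal, mem_nonunits_iff,
        isUnit_ringOfIntegers_iff]
      exact (lt_iff_le_and_ne.trans (and_iff_right x.2)).symm
    rw [h]
    exact isOpen_lt (by fun_prop) continuous_const
  have := AddSubgroup.quotient_finite_of_isOpen φ.ker hopen
  exact Finite.of_equiv _ (QuotientAddGroup.quotientKerEquivOfSurjective φ hφ).toEquiv

/-- There is a monic integral polynomial of degree `d` which is prime to all the primitive
polynomials of degree less than `d`, also modulo the maximal ideal. -/
theorem exists_isUnit_resultant {r d : ℕ} (hd : r < d) :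
    ∃ G : (ringOfIntegers p F)[X], G.Monic ∧ G.natDegree = d ∧
      ∀ A : (ringOfIntegers p F)[X], A.natDegree ≤ r → (∃ i, IsUnit (A.coeff i)) →
        IsUnit (resultant G A d r) := by
  let k := IsLocalRing.ResidueField (ringOfIntegers p F)
  obtain ⟨g, hg, hirr, hgd⟩ := exists_irreducible_of_natDegree k (by omega : 0 < d)
  have hlift : g ∈ lifts (IsLocalRing.residue (ringOfIntegers p F)) := by
    rw [mem_lifts]
    exact map_surjective _ IsLocalRing.residue_surjective g
  obtain ⟨G, hG, hGd, hGm⟩ := lifts_and_natDegree_eq_and_monic hlift hg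
  refine ⟨G, hGm, hGd.trans hgd, ?_⟩
  rintro A hA ⟨i, hi⟩
  rw [← IsLocalRing.residue_ne_zero_iff_isUnit, ← resultant_map_map, hG]
  set a := A.map (IsLocalRing.residue (ringOfIntegers p F)) with ha
  have ha0 : a ≠ 0 := by
    intro h
    have := congrArg (fun f => f.coeff i) h
    simp only [ha, coeff_map, coeff_zero] at this
    exact (IsLocalRing.residue_ne_zero_iff_isUnit _).2 hi this
  have had : a.natDegree ≤ r := natDegree_map_le.trans hA
  -- The irreducible g has degree d > r, so it cannot divide the nonzero polynomial a of degree at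
  -- most r.
  have hcop : IsCoprime g a := (hirr.coprime_iff_not_dvd).2 fun h => by
    have := natDegree_le_of_dvd h ha0
    omega
  -- The reduction may have degree smaller than the formal degree r; the excess only multiplies the
  -- resultant by powers of the leading coefficient 1 of g.
  obtain ⟨j, rfl⟩ := Nat.exists_eq_add_of_le had
  rw [resultant_add_right_deg _ _ _ _ _ le_rfl, ← hgd, hg.coeff_natDegree, one_pow, one_mul]
  exact resultant_ne_zero _ _ hcop

end Residue

section NormResultant

/-- Both sides are the product of the values of G at the roots of the minimal polynomial of x. -/
theorem resultant_minpoly_eq_norm {F E : Type*} [Field F] [CommRing E] [Algebra F E]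
    [Module.Finite F E] {x : E} (hx : Algebra.adjoin F {x} = ⊤)
    (hsep : (minpoly F x).Separable) {G : F[X]} {d : ℕ} (hG : G.natDegree ≤ d) :
    resultant (minpoly F x) G (Module.finrank F E) d = Algebra.norm F (aeval x G) := by
  let L := (minpoly F x).SplittingField
  have hs : ((minpoly F x).map (algebraMap F L)).Splits := SplittingField.splits _
  obtain ⟨α, -, hprod, hN, -⟩ := exists_roots_of_adjoin_eq_top hx hsep (L := L) hs
  have hm : ((minpoly F x).map (algebraMap F L)).Monic :=
    (minpoly.monic (Algebra.IsIntegral.isIntegral x)).map _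
  have hd : ((minpoly F x).map (algebraMap F L)).natDegree = Module.finrank F E := by
    rw [natDegree_map, natDegree_minpoly_eq_finrank hx]
  have hres := resultant_eq_prod_eval ((minpoly F x).map (algebraMap F L))
    (G.map (algebraMap F L)) d (natDegree_map_le.trans hG) hs
  rw [hd, hm.leadingCoeff, one_pow, one_mul] at hres
  apply (algebraMap F L).injective
  rw [hN, ← resultant_map_map, hres]
  have hroots : ((minpoly F x).map (algebraMap F L)).roots = Finset.univ.val.map α := by
    rw [hprod]
    have := roots_multiset_prod_X_sub_C (Finset.univ.val.map α)
    rwa [Multiset.map_map] at this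
  rw [hroots, Multiset.map_map]
  refine Finset.prod_congr rfl fun i _ => ?_
  rw [Function.comp_apply, eval_map_algebraMap]

end NormResultant

section SylvesterSubstitution

theorem coeff_mul_polyOfCoeffs {F : Type*} [NormedField F] {n : ℕ} (f : F[X]) (Q : Fin n → F)
    (i : ℕ) : (f * polyOfCoeffs Q).coeff i =
      ∑ j : Fin n, if (j : ℕ) ≤ i then f.coeff (i - j) * Q j else 0 := by
  simp only [polyOfCoeffs, Finset.mul_sum, finsetSum_coeff]
  refine Finset.sum_congr rfl fun j _ => ?_
  rw [← C_mul_X_pow_eq_monomial, ← mul_assoc, coeff_mul_X_pow', coeff_mul_C]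

theorem degree_mul_polyOfCoeffs_lt {F : Type*} [NormedField F] {m n : ℕ} {f : F[X]}
    (hf : f.natDegree ≤ m) (Q : Fin n → F) : (f * polyOfCoeffs Q).degree < (m + n : ℕ) := by
  rcases eq_or_ne f 0 with rfl | hf0
  · rw [zero_mul, degree_zero]
    exact WithBot.bot_lt_coe _
  · rw [degree_mul, degree_eq_natDegree hf0, Nat.cast_add]
    exact (WithBot.add_lt_add_left (WithBot.natCast_ne_bot _) (degree_polyOfCoeffs_lt Q)).trans_le
      (add_le_add_left (by exact_mod_cast hf) _)

/-- The Sylvester matrix represents (U, V) ↦ gU + fV in monomial bases; when its determinant is a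
unit, it becomes a measure-preserving substitution on integral polynomials. -/
theorem sylvester_mulVec {F : Type*} [NormedField F] {f g : F[X]} {m n : ℕ} (hf : f.natDegree ≤ m)
    (hg : g.natDegree ≤ n) (u : Fin (m + n) → F) :
    polyOfCoeffs ((sylvester f g m n).mulVec u) =
      g * polyOfCoeffs (fun j => u (Fin.castAdd n j)) +
        f * polyOfCoeffs (fun j => u (Fin.natAdd m j)) := by
  have hdeg : (g * polyOfCoeffs (fun j => u (Fin.castAdd n j)) +
      f * polyOfCoeffs (fun j => u (Fin.natAdd m j))).degree < (m + n : ℕ) := by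
    refine (degree_add_le _ _).trans_lt (max_lt ?_ (degree_mul_polyOfCoeffs_lt hf _))
    rw [add_comm m n]
    exact degree_mul_polyOfCoeffs_lt hg _
  rw [← polyOfCoeffs_coeff hdeg]
  congr 1
  ext i
  rw [coeff_add, coeff_mul_polyOfCoeffs, coeff_mul_polyOfCoeffs, Matrix.mulVec, dotProduct,
    Fin.sum_univ_add]
  have key : ∀ (h : F[X]) (k j : ℕ) (c : F), h.natDegree ≤ k →
      (if (i : ℕ) ∈ Set.Icc j (j + k) then h.coeff (i - j) else 0) * c =
        if j ≤ i then h.coeff (i - j) * c else 0 := by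
    intro h k j c hk
    by_cases h1 : j ≤ (i : ℕ)
    · by_cases h2 : (i : ℕ) ≤ j + k
      · rw [if_pos ⟨h1, h2⟩, if_pos h1]
      · rw [if_neg fun h3 => h2 h3.2, if_pos h1, coeff_eq_zero_of_natDegree_lt (by omega)]
    · rw [if_neg fun h3 => h1 h3.1, if_neg h1, zero_mul]
  congr 1
  · refine Finset.sum_congr rfl fun j _ => ?_
    rw [← key g n j _ hg, sylvester, Matrix.of_apply, Fin.addCases_left]
  · refine Finset.sum_congr rfl fun j _ => ?_
    rw [← key f m j _ hf, sylvester, Matrix.of_apply, Fin.addCases_right]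

variable (p : ℕ) [Fact p.Prime] {F : Type*} [NormedField F] [NormedAlgebra ℚ_[p] F]

theorem map_mulVec_mem_cube {ι : Type*} [Fintype ι] (N : Matrix ι ι (ringOfIntegers p F))
    {u : ι → F} (hu : u ∈ Metric.closedBall (0 : ι → F) 1) :
    (N.map (ringOfIntegers p F).subtype).mulVec u ∈ Metric.closedBall (0 : ι → F) 1 := by
  rw [mem_cube_iff] at hu ⊢
  exact fun i => (ringOfIntegers p F).sum_mem fun j _ =>
    (ringOfIntegers p F).mul_mem (N i j).2 (hu j)

theorem map_mulVec_mem_cube_iff {ι : Type*} [Fintype ι] [DecidableEq ι]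
    {N : Matrix ι ι (ringOfIntegers p F)} (hN : IsUnit N.det) {u : ι → F} :
    (N.map (ringOfIntegers p F).subtype).mulVec u ∈ Metric.closedBall (0 : ι → F) 1 ↔
      u ∈ Metric.closedBall (0 : ι → F) 1 := by
  refine ⟨fun h => ?_, map_mulVec_mem_cube p N⟩
  have h1 := map_mulVec_mem_cube p N⁻¹ h
  rwa [Matrix.mulVec_mulVec, ← Matrix.map_mul, Matrix.nonsing_inv_mul _ hN,
    Matrix.map_one _ (map_zero _) (map_one _), Matrix.one_mulVec] at h1

variable [FiniteDimensional ℚ_[p] F] [MeasurableSpace F] [BorelSpace F]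

theorem setLIntegral_cube_map_mulVec {ι : Type*} [Fintype ι] [DecidableEq ι]
    {N : Matrix ι ι (ringOfIntegers p F)} (hN : IsUnit N.det) (g : (ι → F) → ℝ≥0∞) :
    ∫⁻ u in Metric.closedBall 0 1, g ((N.map (ringOfIntegers p F).subtype).mulVec u)
        ∂(haarPi p F ι) = ∫⁻ u in Metric.closedBall 0 1, g u ∂(haarPi p F ι) := by
  have hprop := properSpace_base p F
  have hdet : (N.map (ringOfIntegers p F).subtype).det = (N.det : F) :=
    (RingHom.map_det (ringOfIntegers p F).subtype N).symm
  have hnorm := isUnit_ringOfIntegers_iff.1 hN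
  have hne : (N.map (ringOfIntegers p F).subtype).det ≠ 0 := by
    rw [hdet, ← norm_pos_iff, hnorm]
    exact one_pos
  rw [← lintegral_indicator Metric.isClosed_closedBall.measurableSet,
    ← lintegral_indicator Metric.isClosed_closedBall.measurableSet,
    ← lintegral_comp_mulVec p _ hne ((Metric.closedBall 0 1).indicator fun u => g u), hdet,
    absF_eq_one_of_norm_eq_one p hnorm, one_mul]
  refine lintegral_congr fun u => ?_
  by_cases hu : u ∈ Metric.closedBall (0 : ι → F) 1
  · rw [Set.indicator_of_mem hu, Set.indicator_of_mem ((map_mulVec_mem_cube_iff p hN).2 hu)]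
  · rw [Set.indicator_of_notMem hu,
      Set.indicator_of_notMem (mt (map_mulVec_mem_cube_iff p hN).1 hu)]

theorem setLIntegral_cube_natAdd (d m : ℕ) {g : (Fin m → F) → ℝ≥0∞} (hg : Measurable g) :
    ∫⁻ u in Metric.closedBall 0 1, g (fun j => u (Fin.natAdd d j)) ∂(haarPi p F (Fin (d + m))) =
      ∫⁻ Q in Metric.closedBall 0 1, g Q ∂(haarPi p F (Fin m)) := by
  have hprop := properSpace_base p F
  have hm : ∀ k, MeasurableSet (Metric.closedBall (0 : Fin k → F) 1) := fun k =>
    Metric.isClosed_closedBall.measurableSet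
  have hmem : ∀ (v : Fin d → F) (Q : Fin m → F),
      Sum.elim v Q ∘ finSumFinEquiv.symm ∈ Metric.closedBall (0 : Fin (d + m) → F) 1 ↔
        v ∈ Metric.closedBall (0 : Fin d → F) 1 ∧ Q ∈ Metric.closedBall (0 : Fin m → F) 1 := by
    intro v Q
    rw [mem_cube_iff, mem_cube_iff, mem_cube_iff, Fin.forall_fin_add]
    simp
  rw [← lintegral_indicator (hm _), ← lintegral_indicator (hm _),
    ← lintegral_comp_equiv p finSumFinEquiv.symm, lintegral_haarPi_sum]
  · have h : ∀ (v : Fin d → F) (Q : Fin m → F),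
        (Metric.closedBall 0 1).indicator (fun u : Fin (d + m) → F => g fun j => u (Fin.natAdd d j))
          (Sum.elim v Q ∘ finSumFinEquiv.symm) = (Metric.closedBall (0 : Fin d → F) 1).indicator 1 v *
            (Metric.closedBall (0 : Fin m → F) 1).indicator g Q := by
      intro v Q
      by_cases hv : v ∈ Metric.closedBall (0 : Fin d → F) 1 <;>
        by_cases hQ : Q ∈ Metric.closedBall (0 : Fin m → F) 1 <;>
        simp [Set.indicator, hmem, hv, hQ]
    simp_rw [h]
    rw [lintegral_lintegral_mul (measurable_one.indicator (hm _)).aemeasurable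
      (hg.indicator (hm _)).aemeasurable]
    rw [lintegral_indicator_one (hm _), haarPi_closedBall_one, one_mul]
  · refine (Measurable.indicator ?_ (hm _)).comp ?_ |>.aemeasurable
    · exact hg.comp (by fun_prop)
    · fun_prop

end SylvesterSubstitution

/-! ### Independence of the density from the degree -/

section Stability

variable (p : ℕ) [Fact p.Prime] {F : Type*} [NormedField F] [NormedAlgebra ℚ_[p] F]

theorem exists_primitive_multiple {f : F[X]} (hf : f ≠ 0) :
    ∃ (a : F) (A : (ringOfIntegers p F)[X]), A.map (ringOfIntegers p F).subtype = C a * f ∧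
      ‖a‖ = (gauss f)⁻¹ ∧ ∃ i, IsUnit (A.coeff i) := by
  obtain ⟨i, hi⟩ := exists_gauss_eq f
  have hfi : f.coeff i ≠ 0 := by
    intro h
    rw [h, norm_zero] at hi
    apply hf
    ext j
    have := norm_coeff_le_gauss f j
    rw [hi] at this
    simpa using this
  have hpos : 0 < ‖f.coeff i‖ := norm_pos_iff.2 hfi
  have hl : C (f.coeff i)⁻¹ * f ∈ lifts (ringOfIntegers p F).subtype := by
    rw [lifts_iff_coeff_lifts]
    intro j
    refine ⟨⟨(C (f.coeff i)⁻¹ * f).coeff j, ?_⟩, rfl⟩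
    rw [mem_ringOfIntegers, coeff_C_mul, norm_mul, norm_inv, ← hi, inv_mul_le_one₀ (hi ▸ hpos)]
    exact norm_coeff_le_gauss f j
  obtain ⟨A, hA⟩ := (mem_lifts _).1 hl
  refine ⟨(f.coeff i)⁻¹, A, hA, by rw [norm_inv, hi], i, ?_⟩
  have := congrArg (fun P => P.coeff i) hA
  simp only [coeff_map, coeff_C_mul, inv_mul_cancel₀ hfi] at this
  rw [isUnit_ringOfIntegers_iff]
  exact (congrArg norm this).trans norm_one

variable [FiniteDimensional ℚ_[p] F] [MeasurableSpace F] [BorelSpace F]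
  {E : Type*} [CommRing E] [Algebra F E] [Module.Finite F E]

theorem continuous_norm_aeval_polyOfCoeffs {F : Type*} [NormedField F] [Algebra F E]
    [Module.Finite F E] (m : ℕ) (x : E) :
    Continuous fun Q : Fin m → F => Algebra.norm F (aeval x (polyOfCoeffs Q)) := by
  let b := Module.finBasis F E
  have h : (fun Q : Fin m → F => Algebra.norm F (aeval x (polyOfCoeffs Q))) =
      fun Q : Fin m → F => (∑ i : Fin m, Q i • Algebra.leftMulMatrix b (x ^ (i : ℕ))).det := by
    ext Q
    rw [Algebra.norm_eq_matrix_det b, aeval_polyOfCoeffs, map_sum]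
    simp_rw [map_smul]
  rw [h]
  fun_prop

/-- Write Q = AU + GV with A a primitive multiple of the minimal polynomial and G as in
`exists_isUnit_resultant`. This substitution is unimodular, A(x) = 0, and hence N(Q(x)) =
N(G(x))N(V(x)); the variable U integrates out to 1. The bound [E:F] ≤ m ensures that A fits in the
formal degree m of the Sylvester matrix. -/
theorem normAverage_add [IsReduced E] {x : E} (hx : Algebra.adjoin F {x} = ⊤) {m d : ℕ}
    (hm : Module.finrank F E ≤ m) (hd : Module.finrank F E < d) :
    normAverage p (F := F) (d + m) x = height p F x ^ d * normAverage p (F := F) m x := by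
  have := charZero_base p F
  have hprop := properSpace_base p F
  have hsep := separable_minpoly_of_isReduced (F := F) x
  have hfm : (minpoly F x).Monic := minpoly.monic (Algebra.IsIntegral.isIntegral x)
  obtain ⟨G, hG, hGd, hres⟩ := exists_isUnit_resultant p F hd
  obtain ⟨a, A, hA, ha, hAi⟩ := exists_primitive_multiple p hfm.ne_zero
  set ι := (ringOfIntegers p F).subtype with hι
  have hinj : Function.Injective ι := Subtype.val_injective
  have hgpos : 0 < gauss (minpoly F x) := zero_lt_one.trans_le (one_le_gauss_of_monic hfm)
  have ha0 : a ≠ 0 := by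
    rw [← norm_pos_iff, ha]
    exact inv_pos.2 hgpos
  have hAd : A.natDegree = Module.finrank F E := by
    rw [← natDegree_map_eq_of_injective hinj, hA, natDegree_C_mul ha0,
      natDegree_minpoly_eq_finrank hx]
  have hunit := hres A hAd.le hAi
  have hGι : (G.map ι).natDegree = d := by rw [natDegree_map_eq_of_injective hinj, hGd]
  -- Up to sign the resultant of G and A is a^d N(G(x)). It is a unit, and |a| is the inverse of the
  -- Gauss norm of the minimal polynomial, that is, of the height before normalization.
  have hGN : absF p (Algebra.norm F (aeval x (G.map ι))) = height p F x ^ d := by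
    have h1 : ι (resultant G A d (Module.finrank F E)) = a ^ d *
        ((-1) ^ (d * Module.finrank F E) * Algebra.norm F (aeval x (G.map ι))) := by
      rw [← resultant_map_map, hA, resultant_C_mul_right, resultant_comm,
        resultant_minpoly_eq_norm hx hsep hGι.le]
    have h2 : ‖ι (resultant G A d (Module.finrank F E))‖ = 1 := isUnit_ringOfIntegers_iff.1 hunit
    rw [h1, norm_mul, norm_mul, norm_pow, norm_pow, norm_neg, norm_one, one_pow, one_mul, ha,
      inv_pow, inv_mul_eq_one₀ (pow_pos hgpos d).ne'] at h2
    rw [height_eq_gauss p hx, absF, ← h2, ← ENNReal.ofReal_pow (pow_nonneg hgpos.le _), ← pow_mul,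
      ← pow_mul, mul_comm]
  -- Raising the formal degree of A from [E:F] to m multiplies the resultant by a power of the
  -- leading coefficient of G, which is 1.
  have hdet : IsUnit (sylvester G A d m).det := by
    obtain ⟨k, rfl⟩ := Nat.exists_eq_add_of_le hm
    have := resultant_add_right_deg G A d (Module.finrank F E) k hAd.le
    rw [resultant] at this
    rw [this, ← hGd, hG.coeff_natDegree, one_pow, one_mul, hGd]
    exact hunit
  have hax : aeval x (A.map ι) = 0 := by rw [hA, map_mul, minpoly.aeval, mul_zero]
  have key : ∀ u : Fin (d + m) → F, absF p (Algebra.norm F (aeval x (polyOfCoeffs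
      (((sylvester G A d m).map ι).mulVec u)))) = height p F x ^ d *
        absF p (Algebra.norm F (aeval x (polyOfCoeffs fun j => u (Fin.natAdd d j)))) := by
    intro u
    have h1 : (sylvester G A d m).map ι = sylvester (G.map ι) (A.map ι) d m :=
      (sylvester_map_map _ _ _ _ ι).symm
    rw [h1, sylvester_mulVec hGι.le
      (by rw [natDegree_map_eq_of_injective hinj, hAd]; exact hm), map_add, map_mul, map_mul, hax,
      zero_mul, zero_add, map_mul, absF_mul, hGN]
  have hH : height p F x ^ d ≠ ∞ := by
    rw [← hGN]
    exact absF_ne_top p _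
  rw [normAverage, ← setLIntegral_cube_map_mulVec p hdet, lintegral_congr key, lintegral_const_mul' _ _ hH, normAverage, setLIntegral_cube_natAdd p d m
    (g := fun Q => absF p (Algebra.norm F (aeval x (polyOfCoeffs Q))))]
  exact ((continuous_absF p).comp (continuous_norm_aeval_polyOfCoeffs m x)).measurable

/-- The factor H(x)^d gained by the average cancels the one gained by the denominator. Off the new
elements both densities vanish. -/
theorem coordDensity_add [IsReduced E] {r : ℕ} (B : Module.Basis (Fin r) F E) {m d : ℕ}
    (hm : r ≤ m) (hd : r < d) (v : Fin r → F) :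
    coordDensity p B (d + m) v = coordDensity p B m v := by
  have hr : Module.finrank F E = r := by rw [Module.finrank_eq_card_basis B, Fintype.card_fin]
  by_cases hv : (powMat B 0 r v).det = 0
  · simp [coordDensity, hv, absF_zero]
  have hx := (det_powMat_ne_zero_iff B v).1 hv
  have hH0 : height p F (B.equivFun.symm v) ≠ 0 := by
    rw [height_eq_gauss p hx]
    have := one_le_gauss_of_monic (minpoly.monic
      (Algebra.IsIntegral.isIntegral (R := F) (B.equivFun.symm v)))
    simp only [ne_eq, ENNReal.ofReal_eq_zero, not_le]
    positivity
  have hH : height p F (B.equivFun.symm v) ≠ ∞ := by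
    rw [height_eq_gauss p hx]
    exact ENNReal.ofReal_ne_top
  rw [coordDensity, coordDensity, normAverage_add p hx (by omega) (by omega), ← add_assoc,
    add_right_comm, pow_add, ← mul_assoc]
  congr 1
  rw [← ENNReal.mul_div_right_comm, ENNReal.mul_div_mul_right _ _ (pow_ne_zero d hH0)
    (ENNReal.pow_ne_top hH)]

end Stability

/-! ### Complementary factors and the induction on the degree -/

section Factors

theorem monicFactors_zero {K : Type*} [Field K] (P : K[X]) : monicFactors 0 P = {1} := by
  ext f
  constructor
  · rintro ⟨hf, hd, -⟩
    exact hf.natDegree_eq_zero.1 hd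
  · rintro rfl
    exact ⟨monic_one, natDegree_one, one_dvd _⟩

/-- Send a factor to its cofactor in the monic normalization of P; this is injective by
cancellation. -/
theorem encard_monicFactors_sub_le {K : Type*} [Field K] {P : K[X]} {r n : ℕ} (hP : P.natDegree = n)
    (hP0 : P ≠ 0) (hr : r ≤ n) : (monicFactors r P).encard ≤ (monicFactors (n - r) P).encard := by
  have hlc := leadingCoeff_ne_zero.2 hP0
  have hC : C P.leadingCoeff⁻¹ * P ∣ P := by
    refine ⟨C P.leadingCoeff, ?_⟩
    rw [mul_right_comm, ← C_mul, inv_mul_cancel₀ hlc, C_1, one_mul]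
  have hm : (C P.leadingCoeff⁻¹ * P).Monic := by
    rw [Monic, leadingCoeff_mul, leadingCoeff_C, inv_mul_cancel₀ hlc]
  have hdeg : (C P.leadingCoeff⁻¹ * P).natDegree = n := by
    rw [natDegree_C_mul (inv_ne_zero hlc), hP]
  have hex : ∀ f : K[X], f ∈ monicFactors r P → ∃ g, C P.leadingCoeff⁻¹ * P = f * g :=
    fun f hf => hf.2.2.mul_left _
  choose! g hg using hex
  refine Set.encard_le_encard_of_injOn (f := g) ?_ ?_
  · intro f hf
    have h1 : (g f).Monic := hf.1.of_mul_monic_left (hg f hf ▸ hm)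
    refine ⟨h1, ?_, (Dvd.intro_left _ (hg f hf).symm).trans hC⟩
    have h2 := hdeg
    rw [hg f hf, hf.1.natDegree_mul h1, hf.2.1] at h2
    omega
  · intro f hf f' hf' h
    have h1 := (hg f hf).symm.trans (hg f' hf')
    rw [h] at h1
    refine mul_right_cancel₀ ?_ h1
    intro h0
    have := hg f' hf'
    rw [h0, mul_zero] at this
    exact hm.ne_zero this

theorem encard_monicFactors_sub {K : Type*} [Field K] {P : K[X]} {r n : ℕ} (hP : P.natDegree = n)
    (hP0 : P ≠ 0) (hr : r ≤ n) : (monicFactors (n - r) P).encard = (monicFactors r P).encard := by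
  refine le_antisymm ?_ (encard_monicFactors_sub_le hP hP0 hr)
  have := encard_monicFactors_sub_le hP hP0 (Nat.sub_le n r)
  rwa [Nat.sub_sub_self hr] at this

end Factors

section Total

universe u

variable (p : ℕ) [Fact p.Prime] (F : Type u) [NormedField F] [NormedAlgebra ℚ_[p] F]
  [FiniteDimensional ℚ_[p] F] [MeasurableSpace F] [BorelSpace F]

theorem expectedFactors_zero (n : ℕ) : expectedFactors p F 0 n = 1 := by
  rw [expectedFactors, lintegral_coeffLaw p (n + 1) fun a =>
    ((monicFactors 0 (polyOfCoeffs a)).encard : ℝ≥0∞)]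
  simp [monicFactors_zero, haarPi_closedBall_one]

theorem expectedFactors_sub {r n : ℕ} (hn : 0 < n) (hr : r ≤ n) :
    expectedFactors p F (n - r) n = expectedFactors p F r n := by
  obtain ⟨k, rfl⟩ := Nat.exists_eq_succ_of_ne_zero hn.ne'
  rw [expectedFactors, expectedFactors, lintegral_coeffLaw p _ fun a =>
    ((monicFactors (k.succ - r) (polyOfCoeffs a)).encard : ℝ≥0∞), lintegral_coeffLaw p _ fun a =>
    ((monicFactors r (polyOfCoeffs a)).encard : ℝ≥0∞)]
  refine lintegral_congr_ae (ae_restrict_of_ae ?_)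
  filter_upwards [ae_separable_polyOfCoeffs p (F := F) k] with a ha
  rw [encard_monicFactors_sub ha.1 ha.2.ne_zero hr]

/-- The hypothesis on n says r ≤ m for m = n + 1 - r, so the densities of all classes agree for n
and n + d. -/
theorem expectedFactors_add {r n d : ℕ} (hr : 0 < r) (hn : 2 * r ≤ n + 1) (hd : r < d) :
    expectedFactors p F r (n + d) = expectedFactors p F r n := by
  obtain ⟨m, hm⟩ : ∃ m, n + 1 = r + m := Nat.exists_eq_add_of_le (by omega)
  have hrep : ∀ c : FiniteEtaleAlgebra.IsoClass F r,
      (⟦c.out⟧ : FiniteEtaleAlgebra.IsoClass F r) = c := fun c => Quotient.out_eq c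
  rw [← tsum_expectedNewRoots_div_card p hr (by omega) hrep,
    ← tsum_expectedNewRoots_div_card p hr (by omega) hrep]
  refine tsum_congr fun c => ?_
  have := isReduced_finiteEtaleAlgebra c.out
  let B : Module.Basis (Fin r) F c.out :=
    (Module.finBasis F c.out).reindex (finCongr c.out.finrank_eq)
  rw [expectedNewRoots_eq_lintegral_coordDensity p B (by omega) hm,
    expectedNewRoots_eq_lintegral_coordDensity p B (n := n + d) (m := d + m) (by omega) (by omega)]
  simp_rw [coordDensity_add p B (by omega : r ≤ m) hd]

theorem expectedFactors_eq_of_le {r n : ℕ} (hr : 0 < r) (hn : 2 * r ≤ n + 1) :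
    expectedFactors p F r n = expectedFactors p F r (2 * r - 1) := by
  induction n, (by omega : 2 * r - 1 ≤ n) using Nat.le_induction with
  | base => rfl
  | succ n hmn ih =>
    -- Only shifts by d > r are available, so n and n + 1 are compared through n + r + 2, reached
    -- from them by shifts of r + 2 and r + 1.
    rw [← ih (by omega), ← expectedFactors_add p F hr hn (Nat.lt_succ_self r),
      ← expectedFactors_add p F (n := n) hr (by omega) (d := r + 2) (by omega)]
    congr 1
    omega

/-- In the stable range n may be replaced by 2r - 1, where complementary factors have degree r - 1;
this drives an induction on r. For larger r, taking complementary factors first leads back to the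
stable range. -/
theorem expectedFactors_eq_one {r n : ℕ} (hn : 0 < n) (hr : r ≤ n) : expectedFactors p F r n = 1 := by
  have key : ∀ r n : ℕ, 2 * r ≤ n + 1 → expectedFactors p F r n = 1 := by
    intro r
    induction r with
    | zero => exact fun n _ => expectedFactors_zero p F n
    | succ r ih =>
      intro n hn
      rw [expectedFactors_eq_of_le p F (Nat.succ_pos r) hn,
        ← expectedFactors_sub p F (by omega) (by omega)]
      rw [show 2 * (r + 1) - 1 - (r + 1) = r by omega]
      exact ih _ (by omega)
  rcases le_or_gt (2 * r) (n + 1) with h | h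
  · exact key r n h
  · rw [← expectedFactors_sub p F hn hr]
    exact key _ _ (by omega)

end Total

end PadicRoots

open PadicRoots in
theorem theoremG (p : ℕ) [Fact p.Prime] (F : Type*) [NormedField F] [NormedAlgebra ℚ_[p] F]
    [FiniteDimensional ℚ_[p] F] [MeasurableSpace F] [BorelSpace F]
    (r n : ℕ) (hr : 0 < r) (hrn : r ≤ n) :
    (∀ E : FiniteEtaleAlgebra F r, rho p F E n = expectedNewRoots p F E n) ∧
    ∀ rep : FiniteEtaleAlgebra.IsoClass F r → FiniteEtaleAlgebra F r,
      (∀ c, (⟦rep c⟧ : FiniteEtaleAlgebra.IsoClass F r) = c) →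
      ∑' c : FiniteEtaleAlgebra.IsoClass F r,
        rho p F (rep c) n / (Nat.card (rep c ≃ₐ[F] rep c) : ℝ≥0∞) = 1 := by
  have h1 : ∀ E : FiniteEtaleAlgebra F r, rho p F E n = expectedNewRoots p F E n := fun E =>
    rho_eq_expectedNewRoots p (by omega) (by rw [E.finrank_eq]; omega)
  refine ⟨h1, fun rep hrep => ?_⟩
  simp_rw [h1]
  rw [tsum_expectedNewRoots_div_card p hr hrn hrep, expectedFactors_eq_one p F (by omega) hrn]
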